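/- Let $\mathcal C$ be a symmetric monoidal category (product $\otimes$, unit $1$) that has all small limits, and let $\star_{\mathcal C}$ be its final object. **Symmetric sequences, wreath products.** Let $\Sigma_*$ be the category of finite sets and bijections and $\Sigma_0\subset\Sigma_*$ the full subcategory of empty sets. A symmetric sequence is a functor $\Sigma_*\to\mathcal C$. For a category $A$, the wreath product $\Sigma_*\wr A$ has as objects the finite families $\{a_s\}_{s\in S}$ of objects of $A$, and as morphisms $\{a_s\}_{S}\to\{b_t\}_{T}$ the bijections $\sigma:S\to T$ with morphisms $a_s\to b_{\sigma(s)}$. For functors $O:\Sigma_*\to\mathcal C$ and $F:A\to\mathcal C$ put $$O\circledcirc F:\Sigma_*\wr A\to\mathcal C,\qquad \{a_s\}_{s\in S}\mapsto O(S)\otimes\bigotimes_{s\in S}F(a_s)$$ (unordered tensor product). Let $\gamma^2:\Sigma_*\wr\Sigma_*\to\Sigma_*$ be $\{S_t\}_{t\in T}\mapsto\coprod_tS_t$; more generally $\gamma^2\wr\mathrm{Id}:\Sigma_*\wr\Sigma_*\wr A\to\Sigma_*\wr A$ turns a family of families into one family, and $s_0:A\to\Sigma_*\wr A$ is $a\mapsto\{a\}$.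 Let $\mathbb 1$ be the symmetric sequence with $\mathbb 1(T)=1$ if $|T|=1$ and $\mathbb 1(T)=\star_{\mathcal C}$ otherwise. **Cooperads and coalgebras.** A counital cooperad is a symmetric sequence $\mathcal O$ with natural transformations $\tilde\Delta:\mathcal O\gamma^2\to\mathcal O\circledcirc\mathcal O$ and $\tilde\epsilon:\mathcal O\to\mathbb 1$ such that the two composites $\mathcal O\gamma^3\to\mathcal O\circledcirc\mathcal O\circledcirc\mathcal O$, where $\gamma^3=\gamma^2(\gamma^2\wr\mathrm{Id})\cong\gamma^2(\mathrm{Id}\wr\gamma^2)$, agree, and such that applying $\tilde\Delta$ to $\{S\}$, respectively to $\{\star\}_{s\in S}$ (with $\star$ a one-point set), followed by $\tilde\epsilon$ on the first factor, respectively on the factors $\mathcal O(\star)$, is the identity of $\mathcal O(S)$ for every finite set $S$. A coalgebra over $\mathcal O$ is an object $c$ of $\mathcal C$, viewed as a constant functor on $\Sigma_0$, with a natural transformation $\tilde\Delta_c:c\,\bar\gamma^2\to\mathcal O\circledcirc c$ of functors on $\Sigma_*\wr\Sigma_0$ ($\bar\gamma^2$ being the functor to $\Sigma_0$), such that the two composites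 $c\,\bar\gamma^3\to\mathcal O\circledcirc\mathcal O\circledcirc c$, through $(\mathcal O\circledcirc c)(\gamma^2\wr\mathrm{Id})$ and through $(\mathcal O\circledcirc c)(\mathrm{Id}\wr\bar\gamma^2)$, agree and such that $c=c\,\bar\gamma^2 s_0\to(\mathcal O\circledcirc c)s_0\to(\mathbb 1\circledcirc c)s_0=c$ is the identity. **Leafless trees and the terms.** For $n\ge0$ let $\hat\emptyset_{n+1}$ be the category of leafless trees of level $n+1$ and isomorphisms, i.e. of chains $\star\leftarrow S_1\leftarrow\cdots\leftarrow S_n\leftarrow\emptyset$ of finite sets and isomorphisms of chains, realized as $\Sigma_*\wr(\cdots\wr(\Sigma_*\wr\Sigma_0))$ with $n$ factors $\Sigma_*$. Let $\bar\gamma:\hat\emptyset_{n+1}\to\Sigma_0$ be the functor which forgets $S_1,\dots,S_n$. On $\hat\emptyset_{n+1}$ there is the functor $\mathcal O^{\circledcirc n}\circledcirc c$ (with value $c$ for $n=0$); let $\mathcal O^{\hat\circ n}\,\hat\circ\,c\in\mathcal C$ be the value at $\emptyset$ of its right Kan extension along $\bar\gamma$. **Structure maps.** For $0\le i\le n$ let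 $\partial_i:\hat\emptyset_{n+2}\to\hat\emptyset_{n+1}$ forget $S_{i+1}$ and let $s_i:\hat\emptyset_{n+1}\to\hat\emptyset_{n+2}$ double $S_i$ (where $S_0=\star$); both commute with the functors $\bar\gamma$. Applying $\tilde\Delta$ to the $i$-th factor $\mathcal O$ (counted from $0$) if $i<n$, or $\tilde\Delta_c$ to $c$ if $i=n$, gives $(\mathcal O^{\circledcirc n}\circledcirc c)\,\partial_i\to\mathcal O^{\circledcirc(n+1)}\circledcirc c$; applying $\tilde\epsilon$ to the $i$-th factor gives $(\mathcal O^{\circledcirc(n+1)}\circledcirc c)\,s_i\to\mathcal O^{\circledcirc n}\circledcirc c$. By the universal property of right Kan extensions these induce $$\Delta_i:\mathcal O^{\hat\circ n}\hat\circ c\to\mathcal O^{\hat\circ(n+1)}\hat\circ c,\qquad \epsilon_i:\mathcal O^{\hat\circ(n+1)}\hat\circ c\to\mathcal O^{\hat\circ n}\hat\circ c\qquad(0\le i\le n).$$ For $n=0$, where $\mathcal O^{\hat\circ0}\hat\circ c=c$, these are $\Delta_c:c\to\mathcal O\,\hat\circ\,c$ and $\epsilon_c:\mathcal O\,\hat\circ\,c\to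 c$. **Theorem.** For every coalgebra $c$ over a counital cooperad $\mathcal O$ in $\mathcal C$, the objects $X^n=\mathcal O^{\hat\circ(n+1)}\,\hat\circ\,c$ $(n\ge0)$, with cofaces $d^i=\Delta_i:X^n\to X^{n+1}$ $(0\le i\le n+1)$, codegeneracies $\sigma^j=\epsilon_{j+1}:X^{n+1}\to X^n$ $(0\le j\le n)$ and coaugmentation $\Delta_c:c\to X^0$, form a coaugmented cosimplicial object of $\mathcal C$. Moreover the remaining maps $\epsilon_0:X^{n+1}\to X^n$ and $\epsilon_c:X^0\to c$ form an extra codegeneracy: $$\epsilon_c\Delta_c=\mathrm{id}_c,\qquad \epsilon_0d^0=\mathrm{id}_{X^n},\qquad \epsilon_0d^1=\Delta_c\epsilon_c\ \text{ on } X^0,\qquad \epsilon_0d^{i+1}=d^i\epsilon_0:X^{n+1}\to X^{n+1}\ (0\le i\le n+1),$$ $$\epsilon_c\sigma^0=\epsilon_c\epsilon_0\ \text{ on } X^1,\qquad \epsilon_0\sigma^{j+1}=\sigma^j\epsilon_0:X^{n+2}\to X^n\ (0\le j\le n).$$ -/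

import Mathlib

open CategoryTheory MonoidalCategory Limits

universe v u

/-!
Conventions. `C` is a symmetric monoidal category. Finite sets are finite types in `Type`.
Contents:
* unordered tensor products `tens` over finite sets in `C`, with the coherence isomorphisms
  between them;
* the groupoid `FinBij` (written `Σ_*`) and wreath product categories `Wreath A` (`Σ_* ≀ A`);
* the products `circ O F` (`O ⊚ F`), counital cooperads and their coalgebras;
* the categories `Level n` of leafless trees, with their face and degeneracy functors, and the
  right Kan extensions of the functors `O ⊚ ⋯ ⊚ O ⊚ c` on them, with the induced cofaces and
  codegeneracies.
-/

namespace TreeCooperad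

/-! ## Unordered tensor products

To speak of the tensor product of a family indexed by a finite set, we use formal bracketed
products (`Word`), formal composites of the structure isomorphisms of a symmetric monoidal
category between them (`FHom`), and the coherence theorem. -/

/-- Formal bracketed products of elements of `S`. -/
inductive Word (S : Type) : Type
  | one : Word S
  | of : S → Word S
  | mul : Word S → Word S → Word S

namespace Word

variable {S T U : Type}

/-- Substitution. -/
def bind (k : S → Word T) : Word S → Word T
  | one => one
  | of s => k s
  | mul e e' => mul (bind k e) (bind k e')

/-- The factors of `e`, from left to right, followed by the list `l`. -/
def flat : Word S → List S → List S
  | one, l => l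
  | of s, l => s :: l
  | mul e e', l => flat e (flat e' l)

/-- The right-bracketed product of a list. -/
def ofList : List S → Word S
  | [] => one
  | s :: l => mul (of s) (ofList l)

theorem bind_of (e : Word S) : e.bind of = e := by
  induction e with
  | one => rfl
  | of s => rfl
  | mul e e' h h' => simp [bind, h, h']

theorem bind_bind (k : S → Word T) (k' : T → Word U) (e : Word S) :
    (e.bind k).bind k' = e.bind (fun s => (k s).bind k') := by
  induction e with
  | one => rfl
  | of s => rfl
  | mul e e' h h' => simp [bind, h, h']

theorem flat_append (e : Word S) (l : List S) : e.flat l = e.flat [] ++ l := by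
  induction e generalizing l with
  | one => rfl
  | of s => rfl
  | mul e e' h h' => rw [flat, flat, h, h (e'.flat []), h', List.append_assoc]

theorem flat_ofList (l : List S) : (ofList l).flat [] = l := by
  induction l with
  | nil => rfl
  | cons s l h => simp [ofList, flat, h]

theorem flat_bind (k : S → Word T) (e : Word S) :
    (e.bind k).flat [] = (e.flat []).flatMap (fun s => (k s).flat []) := by
  induction e with
  | one => rfl
  | of s => simp [bind, flat]
  | mul e e' h h' =>
    rw [bind, flat, flat_append, h, h', flat, flat_append e (e'.flat []), List.flatMap_append]

/-- Formal composites of associators, unitors, braidings and their tensor products. -/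
inductive FHom : Word S → Word S → Type
  | id (e) : FHom e e
  | comp {e e' e''} : FHom e e' → FHom e' e'' → FHom e e''
  | tensor {a a' b b'} : FHom a a' → FHom b b' → FHom (mul a b) (mul a' b')
  | assoc (a b c) : FHom (mul (mul a b) c) (mul a (mul b c))
  | assocInv (a b c) : FHom (mul a (mul b c)) (mul (mul a b) c)
  | leftU (a) : FHom (mul one a) a
  | leftUInv (a) : FHom a (mul one a)
  | rightU (a) : FHom (mul a one) a
  | rightUInv (a) : FHom a (mul a one)
  | braid (a b) : FHom (mul a b) (mul b a)

theorem FHom.normal (e : Word S) (l : List S) :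
    Nonempty (FHom (mul e (ofList l)) (ofList (e.flat l))) ∧
      Nonempty (FHom (ofList (e.flat l)) (mul e (ofList l))) := by
  induction e generalizing l with
  | one => exact ⟨⟨.leftU _⟩, ⟨.leftUInv _⟩⟩
  | of s => exact ⟨⟨.id _⟩, ⟨.id _⟩⟩
  | mul a b ha hb =>
    obtain ⟨⟨f⟩, ⟨f'⟩⟩ := hb l
    obtain ⟨⟨g⟩, ⟨g'⟩⟩ := ha (b.flat l)
    exact ⟨⟨(FHom.assoc _ _ _).comp (((FHom.id a).tensor f).comp g)⟩,
      ⟨g'.comp (((FHom.id a).tensor f').comp (FHom.assocInv _ _ _))⟩⟩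

theorem FHom.ofPerm {l l' : List S} (h : l.Perm l') : Nonempty (FHom (ofList l) (ofList l')) := by
  induction h with
  | nil => exact ⟨.id _⟩
  | cons s _ ih => obtain ⟨f⟩ := ih; exact ⟨(FHom.id _).tensor f⟩
  | swap a b l =>
    exact ⟨(FHom.assocInv _ _ _).comp (((FHom.braid _ _).tensor (.id _)).comp (FHom.assoc _ _ _))⟩
  | trans _ _ h h' => obtain ⟨f⟩ := h; obtain ⟨g⟩ := h'; exact ⟨f.comp g⟩

theorem FHom.exists_of_perm {e e' : Word S} (h : (e.flat []).Perm (e'.flat [])) :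
    Nonempty (FHom e e') := by
  obtain ⟨⟨f⟩, -⟩ := FHom.normal e []
  obtain ⟨-, ⟨g⟩⟩ := FHom.normal e' []
  obtain ⟨p⟩ := FHom.ofPerm h
  exact ⟨(FHom.rightUInv e).comp (f.comp (p.comp (g.comp (.rightU _))))⟩

/-- Substitution. -/
def FHom.bind (k : S → Word T) : ∀ {e e' : Word S}, FHom e e' → FHom (e.bind k) (e'.bind k)
  | _, _, .id e => .id _
  | _, _, .comp f g => .comp (f.bind k) (g.bind k)
  | _, _, .tensor f g => .tensor (f.bind k) (g.bind k)
  | _, _, .assoc a b c => .assoc _ _ _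
  | _, _, .assocInv a b c => .assocInv _ _ _
  | _, _, .leftU a => .leftU _
  | _, _, .leftUInv a => .leftUInv _
  | _, _, .rightU a => .rightU _
  | _, _, .rightUInv a => .rightUInv _
  | _, _, .braid a b => .braid _ _

variable {C : Type u} [Category.{v} C] [MonoidalCategory C]

/-- The product in `C` denoted by a formal product, for a family of factors `X`. -/
def ev (X : S → C) : Word S → C
  | one => 𝟙_ C
  | of s => X s
  | mul e e' => ev X e ⊗ ev X e'

/-- The tensor product of the morphisms `φ s`, one for each factor of the product. -/
def evBind {X : S → C} {Y : T → C} (k : S → Word T) (φ : ∀ s, X s ⟶ (k s).ev Y) :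
    ∀ e : Word S, e.ev X ⟶ (e.bind k).ev Y
  | one => 𝟙 (𝟙_ C)
  | of s => φ s
  | mul e e' => evBind k φ e ⊗ₘ evBind k φ e'

variable [SymmetricCategory C]

/-- The morphism of `C` denoted by a formal composite of structure isomorphisms. -/
def FHom.interp (X : S → C) : ∀ {e e' : Word S}, FHom e e' → (e.ev X ⟶ e'.ev X)
  | _, _, .id e => 𝟙 (e.ev X)
  | _, _, .comp f g => f.interp X ≫ g.interp X
  | _, _, .tensor f g => f.interp X ⊗ₘ g.interp X
  | _, _, .assoc a b c => (α_ (a.ev X) (b.ev X) (c.ev X)).hom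
  | _, _, .assocInv a b c => (α_ (a.ev X) (b.ev X) (c.ev X)).inv
  | _, _, .leftU a => (λ_ (a.ev X)).hom
  | _, _, .leftUInv a => (λ_ (a.ev X)).inv
  | _, _, .rightU a => (ρ_ (a.ev X)).hom
  | _, _, .rightUInv a => (ρ_ (a.ev X)).inv
  | _, _, .braid a b => (β_ (a.ev X) (b.ev X)).hom

theorem interp_evBind {X : S → C} {Y : T → C} (k : S → Word T) (φ : ∀ s, X s ⟶ (k s).ev Y)
    {e e' : Word S} (f : FHom e e') :
    f.interp X ≫ evBind k φ e' = evBind k φ e ≫ (f.bind k).interp Y := by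
  induction f with
  | id e => exact (Category.id_comp _).trans (Category.comp_id _).symm
  | comp f g hf hg =>
    simp only [FHom.interp, FHom.bind, Category.assoc, hg]
    rw [← Category.assoc, hf, Category.assoc]
  | tensor f g hf hg =>
    simp only [FHom.interp, FHom.bind, evBind]
    erw [tensorHom_comp_tensorHom, hf, hg, ← tensorHom_comp_tensorHom]; rfl
  | assoc a b c => exact (associator_naturality _ _ _).symm
  | assocInv a b c => exact (associator_inv_naturality _ _ _).symm
  | leftU a =>
    have := leftUnitor_naturality (evBind k φ a)
    rw [← id_tensorHom] at this
    exact this.symm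
  | leftUInv a =>
    have := leftUnitor_inv_naturality (evBind k φ a)
    rw [← id_tensorHom] at this
    exact this.symm
  | rightU a =>
    have := rightUnitor_naturality (evBind k φ a)
    rw [← tensorHom_id] at this
    exact this.symm
  | rightUInv a =>
    have := rightUnitor_inv_naturality (evBind k φ a)
    rw [← tensorHom_id] at this
    exact this.symm
  | braid a b => exact (BraidedCategory.braiding_naturality _ _).symm

/-! ### Coherence for symmetric monoidal categories

Two composites of structure isomorphisms between the same products agree, if no factor is
repeated. -/

/-- The exchange of the first two factors. -/
def sw (a b c : C) : a ⊗ (b ⊗ c) ⟶ b ⊗ (a ⊗ c) :=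
  (α_ a b c).inv ≫ ((β_ a b).hom ▷ c) ≫ (α_ b a c).hom

theorem sw_sw (a b c : C) : sw a b c ≫ sw b a c = 𝟙 _ := by
  simp [sw, ← comp_whiskerRight_assoc]

theorem sw_sw_assoc (a b c : C) {d : C} (f : a ⊗ (b ⊗ c) ⟶ d) :
    sw a b c ≫ sw b a c ≫ f = f := by
  rw [← Category.assoc, sw_sw, Category.id_comp]

theorem sw_nat (a b : C) {c d : C} (f : c ⟶ d) :
    sw a b c ≫ (b ◁ a ◁ f) = (a ◁ b ◁ f) ≫ sw a b d := by
  simp only [sw, Category.assoc]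
  rw [← associator_naturality_right, ← whisker_exchange_assoc, associator_inv_naturality_right_assoc]

theorem sw_nat_assoc (a b : C) {c d e : C} (f : c ⟶ d) (g : b ⊗ (a ⊗ d) ⟶ e) :
    sw a b c ≫ (b ◁ a ◁ f) ≫ g = (a ◁ b ◁ f) ≫ sw a b d ≫ g := by
  rw [← Category.assoc, sw_nat, Category.assoc]

theorem sw_yb (a b c d : C) :
    (a ◁ sw b c d) ≫ sw a c (b ⊗ d) ≫ (c ◁ sw a b d) =
      sw a b (c ⊗ d) ≫ (b ◁ sw a c d) ≫ sw b c (a ⊗ d) := by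
  have h := congr_arg (fun f => (α_ a b (c ⊗ d)).inv ≫ (α_ (a ⊗ b) c d).inv ≫
    ((α_ a b c).hom ≫ f) ▷ d ≫ (α_ c (b ⊗ a) d).hom ≫ c ◁ (α_ b a d).hom)
    (BraidedCategory.yang_baxter a b c)
  simp only [sw]
  refine Eq.trans ?_ (h.symm.trans ?_) <;> monoidal

theorem sw_yb_assoc (a b c d : C) {e : C} (f : c ⊗ (b ⊗ (a ⊗ d)) ⟶ e) :
    (a ◁ sw b c d) ≫ sw a c (b ⊗ d) ≫ (c ◁ sw a b d) ≫ f =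
      sw a b (c ⊗ d) ≫ (b ◁ sw a c d) ≫ sw b c (a ⊗ d) ≫ f := by
  have h := congr_arg (· ≫ f) (sw_yb a b c d)
  simpa only [Category.assoc] using h

theorem exch_aux {a b d l l₁ l₂ m : C} (i : a ⊗ l ⟶ l₁) (j : b ⊗ l₁ ⟶ l₂) (i' : b ⊗ l ⟶ m)
    (j' : a ⊗ m ⟶ l₂) (h : (b ◁ i) ≫ j = sw b a l ≫ (a ◁ i') ≫ j') :
    (b ◁ (sw a d l ≫ (d ◁ i))) ≫ sw b d l₁ ≫ (d ◁ j) =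
      sw b a (d ⊗ l) ≫ (a ◁ (sw b d l ≫ (d ◁ i'))) ≫ sw a d m ≫ (d ◁ j') := by
  simp only [MonoidalCategory.whiskerLeft_comp, Category.assoc]
  rw [← sw_nat_assoc, ← MonoidalCategory.whiskerLeft_comp, h, ← sw_nat_assoc]
  simp only [MonoidalCategory.whiskerLeft_comp]
  rw [sw_yb_assoc]

/-- The right-bracketed tensor product of a list of factors. -/
def lprod (X : S → C) : List S → C
  | [] => 𝟙_ C
  | s :: l => X s ⊗ lprod X l

/-- `Ins a l l'`: the list `l'` arises from `l` by inserting `a` somewhere. -/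
inductive Ins (a : S) : List S → List S → Type
  | here (l) : Ins a l (a :: l)
  | there (b) {l l'} : Ins a l l' → Ins a (b :: l) (b :: l')

/-- The isomorphism that moves the first factor to the place where it is inserted. -/
def Ins.ev (X : S → C) {a : S} : ∀ {l l' : List S}, Ins a l l' → (X a ⊗ lprod X l ⟶ lprod X l')
  | _, _, .here l => 𝟙 (X a ⊗ lprod X l)
  | _, _, .there (l := l) b i => sw (X a) (X b) (lprod X l) ≫ (X b ◁ i.ev X)

theorem here_aux {a b l m : C} (i : a ⊗ l ⟶ m) :
    (b ◁ i) ≫ 𝟙 (b ⊗ m) = sw b a l ≫ (a ◁ 𝟙 (b ⊗ l)) ≫ sw a b l ≫ (b ◁ i) := by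
  simp [sw_sw_assoc]

theorem here_aux' {a b l m : C} (j : b ⊗ l ⟶ m) :
    (b ◁ 𝟙 (a ⊗ l)) ≫ sw b a l ≫ (a ◁ j) = sw b a l ≫ (a ◁ j) ≫ 𝟙 (a ⊗ m) := by
  simp

theorem Ins.exchange (X : S → C) {a b : S} {l l₁ l₂ : List S} (i : Ins a l l₁) (j : Ins b l₁ l₂) :
    ∃ (l₁' : List S) (i' : Ins b l l₁') (j' : Ins a l₁' l₂),
      (X b ◁ i.ev X) ≫ j.ev X = sw (X b) (X a) (lprod X l) ≫ (X a ◁ i'.ev X) ≫ j'.ev X := by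
  induction j generalizing l with
  | here l₁ => exact ⟨_, .here _, .there _ i, here_aux (i.ev X)⟩
  | there d j ih =>
    cases i with
    | here => exact ⟨_, j, .here _, here_aux' (j.ev X)⟩
    | there _ i =>
      obtain ⟨m, i', j', h⟩ := ih i
      exact ⟨_, .there d i', .there d j', exch_aux _ _ _ _ h⟩

/-- The canonical permutation morphisms between right-bracketed products. -/
inductive Perm (X : S → C) : ∀ l l' : List S, (lprod X l ⟶ lprod X l') → Prop
  | nil : Perm X [] [] (𝟙 (𝟙_ C))
  | cons {a : S} {l m l' : List S} (i : Ins a m l') {f : lprod X l ⟶ lprod X m} :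
      Perm X l m f → Perm X (a :: l) l' ((X a ◁ f) ≫ i.ev X)

theorem Perm.refl (X : S → C) (l : List S) : Perm X l l (𝟙 _) := by
  induction l with
  | nil => exact .nil
  | cons a l ih =>
    have := Perm.cons (.here (a := a) l) ih
    have h : (X a ◁ (𝟙 (lprod X l))) ≫ 𝟙 (X a ⊗ lprod X l) = 𝟙 (X a ⊗ lprod X l) := by simp
    exact h ▸ this

theorem pull_aux {a b m l n n1 l' : C} (i : a ⊗ m ⟶ l) (g0 : l ⟶ n) (k : b ⊗ n ⟶ l') {n0 : C}
    (g0' : m ⟶ n0) (j0 : a ⊗ n0 ⟶ n) (h : i ≫ g0 = (a ◁ g0') ≫ j0)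
    (j0' : b ⊗ n0 ⟶ n1) (k' : a ⊗ n1 ⟶ l')
    (h' : (b ◁ j0) ≫ k = sw b a n0 ≫ (a ◁ j0') ≫ k') :
    (sw a b m ≫ (b ◁ i)) ≫ (b ◁ g0) ≫ k = (a ◁ ((b ◁ g0') ≫ j0')) ≫ k' := by
  simp only [Category.assoc]
  rw [← MonoidalCategory.whiskerLeft_comp_assoc, h, MonoidalCategory.whiskerLeft_comp,
    Category.assoc, h', sw_nat_assoc, sw_sw_assoc]
  simp

theorem Perm.pull (X : S → C) {l' l'' : List S} {g : lprod X l' ⟶ lprod X l''}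
    (hg : Perm X l' l'' g) {a : S} {m : List S} (i : Ins a m l') :
    ∃ (m' : List S) (g' : lprod X m ⟶ lprod X m') (j : Ins a m' l''),
      Perm X m m' g' ∧ i.ev X ≫ g = (X a ◁ g') ≫ j.ev X := by
  induction hg generalizing m with
  | nil => cases i
  | cons k hg0 ih =>
    cases i with
    | here => exact ⟨_, _, k, hg0, Category.id_comp _⟩
    | there b i =>
      obtain ⟨n0, g0', j0, hp, h⟩ := ih i
      obtain ⟨n1, j0', k', h'⟩ := Ins.exchange X j0 k
      exact ⟨_, _, k', .cons j0' hp, pull_aux _ _ _ _ _ h _ _ h'⟩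

theorem trans_aux {a l m l' l'' m' : C} (f : l ⟶ m) (i : a ⊗ m ⟶ l') (g : l' ⟶ l'')
    (g' : m ⟶ m') (j : a ⊗ m' ⟶ l'') (h : i ≫ g = (a ◁ g') ≫ j) :
    (a ◁ (f ≫ g')) ≫ j = ((a ◁ f) ≫ i) ≫ g := by
  simp [h]

theorem Perm.trans (X : S → C) {l l' l'' : List S} {f : lprod X l ⟶ lprod X l'}
    {g : lprod X l' ⟶ lprod X l''} (hf : Perm X l l' f) (hg : Perm X l' l'' g) :
    Perm X l l'' (f ≫ g) := by
  induction hf generalizing l'' with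
  | nil => exact (Category.id_comp g).symm ▸ hg
  | @cons a l m l' i f hf ih =>
    obtain ⟨m', g', j, hp, h⟩ := hg.pull X i
    exact trans_aux f (i.ev X) g g' (j.ev X) h ▸ Perm.cons j (ih hp)

theorem Ins.mem {a : S} {l l' : List S} (i : Ins a l l') : l'.Perm (a :: l) := by
  induction i with
  | here => exact .refl _
  | there b i ih => exact (ih.cons b).trans (.swap _ _ _)

theorem Ins.unique {a : S} {l m l' : List S} (h : l'.Nodup) (i : Ins a l l') (j : Ins a m l') :
    l = m ∧ HEq i j := by
  induction i generalizing m with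
  | here l =>
    cases j with
    | here => exact ⟨rfl, HEq.rfl⟩
    | there _ j => exact absurd (j.mem.mem_iff.2 (by simp)) (List.nodup_cons.1 h).1
  | there b i ih =>
    cases j with
    | here => exact absurd (i.mem.mem_iff.2 (by simp)) (List.nodup_cons.1 h).1
    | there _ j =>
      obtain ⟨rfl, hij⟩ := ih (List.nodup_cons.1 h).2 j
      cases hij
      exact ⟨rfl, HEq.rfl⟩

theorem Perm.unique (X : S → C) {l l' : List S} (h : l'.Nodup) {f g : lprod X l ⟶ lprod X l'}
    (hf : Perm X l l' f) (hg : Perm X l l' g) : f = g := by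
  induction hf with
  | nil => cases hg; rfl
  | @cons a l m l' i f hf ih =>
    cases hg with
    | @cons _ _ m' _ j g hg =>
      obtain ⟨rfl, hij⟩ := Ins.unique h i j
      cases hij
      rw [ih (List.nodup_cons.1 (i.mem.nodup_iff.1 h)).2 hg]

/-- The associativity isomorphism to the right-bracketed product. -/
def nm (X : S → C) : ∀ (e : Word S) (l : List S), (e.ev X ⊗ lprod X l) ≅ lprod X (e.flat l)
  | one, l => λ_ (lprod X l)
  | of s, l => Iso.refl (X s ⊗ lprod X l)
  | mul a b, l => α_ (a.ev X) (b.ev X) (lprod X l) ≪≫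
      whiskerLeftIso (a.ev X) (nm X b l) ≪≫ nm X a (b.flat l)

/-- After right-bracketing, `f` becomes a permutation morphism. -/
def Good (X : S → C) {e e' : Word S} (f : e.ev X ⟶ e'.ev X) : Prop :=
  ∀ (l l' : List S) (g : lprod X l ⟶ lprod X l'), Perm X l l' g →
    Perm X (e.flat l) (e'.flat l') ((nm X e l).inv ≫ (f ⊗ₘ g) ≫ (nm X e' l').hom)

theorem Good.comp (X : S → C) {e e' e'' : Word S} {f : e.ev X ⟶ e'.ev X} {f' : e'.ev X ⟶ e''.ev X}
    (hf : Good X f) (hf' : Good X f') : Good X (f ≫ f') := by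
  intro l l' g hg
  have := (hf _ _ _ (Perm.refl X l)).trans X (hf' _ _ _ hg)
  have h : ((nm X e l).inv ≫ (f ⊗ₘ 𝟙 (lprod X l)) ≫ (nm X e' l).hom) ≫
      ((nm X e' l).inv ≫ (f' ⊗ₘ g) ≫ (nm X e'' l').hom) =
      (nm X e l).inv ≫ ((f ≫ f') ⊗ₘ g) ≫ (nm X e'' l').hom := by
    simp [MonoidalCategory.tensorHom_def]
  exact h ▸ this

theorem tensor_aux {A B L M N A' B' L' M' N' : C} (nB : B ⊗ L ≅ M) (nA : A ⊗ M ≅ N)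
    (nB' : B' ⊗ L' ≅ M') (nA' : A' ⊗ M' ≅ N') (f : A ⟶ A') (f' : B ⟶ B') (g : L ⟶ L') :
    nA.inv ≫ (f ⊗ₘ (nB.inv ≫ (f' ⊗ₘ g) ≫ nB'.hom)) ≫ nA'.hom =
      (α_ A B L ≪≫ whiskerLeftIso A nB ≪≫ nA).inv ≫ ((f ⊗ₘ f') ⊗ₘ g) ≫
        (α_ A' B' L' ≪≫ whiskerLeftIso A' nB' ≪≫ nA').hom := by
  simp only [MonoidalCategory.tensorHom_def, Iso.trans_inv, Iso.trans_hom, whiskerLeftIso_inv,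
    whiskerLeftIso_hom, MonoidalCategory.whiskerLeft_comp, Category.assoc]
  rw [← whisker_exchange_assoc]
  simp

theorem Good.tensor (X : S → C) {a a' b b' : Word S} {f : a.ev X ⟶ a'.ev X}
    {f' : b.ev X ⟶ b'.ev X} (hf : Good X f) (hf' : Good X f') :
    Good X (e := mul a b) (e' := mul a' b') (f ⊗ₘ f') := by
  intro l l' g hg
  exact tensor_aux (nm X b l) (nm X a _) (nm X b' l') (nm X a' _) f f' g ▸ hf _ _ _ (hf' _ _ _ hg)

theorem Good.id (X : S → C) (e : Word S) : Good X (𝟙 (e.ev X)) := by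
  induction e with
  | one =>
    intro l l' g hg
    have h : (λ_ (lprod X l)).inv ≫ (𝟙 (𝟙_ C) ⊗ₘ g) ≫ (λ_ (lprod X l')).hom = g := by simp
    exact h.symm ▸ hg
  | of s =>
    intro l l' g hg
    have h : 𝟙 (X s ⊗ lprod X l) ≫ (𝟙 (X s) ⊗ₘ g) ≫ 𝟙 (X s ⊗ lprod X l') =
      (X s ◁ g) ≫ 𝟙 (X s ⊗ lprod X l') := by simp
    exact h.symm ▸ Perm.cons (.here _) hg
  | mul a b ha hb =>
    have h : (𝟙 (a.ev X) ⊗ₘ 𝟙 (b.ev X)) = 𝟙 (a.ev X ⊗ b.ev X) := by simp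
    exact h ▸ ha.tensor X hb

theorem assoc_aux {A B K L M N P Q : C} (nC : K ⊗ L ≅ M) (nB : B ⊗ M ≅ N) (nA : A ⊗ N ≅ P)
    {L' : C} (g : L ⟶ L') (n' : (A ⊗ (B ⊗ K)) ⊗ L' ⟶ Q) :
    (α_ A (B ⊗ K) L ≪≫ whiskerLeftIso A (α_ B K L ≪≫ whiskerLeftIso B nC ≪≫ nB) ≪≫ nA).inv ≫
      (𝟙 (A ⊗ (B ⊗ K)) ⊗ₘ g) ≫ n' =
    (α_ (A ⊗ B) K L ≪≫ whiskerLeftIso (A ⊗ B) nC ≪≫ α_ A B M ≪≫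
      whiskerLeftIso A nB ≪≫ nA).inv ≫ ((α_ A B K).hom ⊗ₘ g) ≫ n' := by
  simp [MonoidalCategory.tensorHom_def]

theorem Good.assoc (X : S → C) (a b c : Word S) :
    Good X (e := mul (mul a b) c) (e' := mul a (mul b c))
      (α_ (a.ev X) (b.ev X) (c.ev X)).hom := by
  intro l l' g hg
  exact assoc_aux (nm X c l) (nm X b _) (nm X a _) g (nm X (mul a (mul b c)) l').hom ▸
    Good.id X (mul a (mul b c)) l l' g hg

theorem assocInv_aux {A B K L M N P Q : C} (nC : K ⊗ L ≅ M) (nB : B ⊗ M ≅ N) (nA : A ⊗ N ≅ P)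
    {L' : C} (g : L ⟶ L') (n' : ((A ⊗ B) ⊗ K) ⊗ L' ⟶ Q) :
    (α_ (A ⊗ B) K L ≪≫ whiskerLeftIso (A ⊗ B) nC ≪≫ α_ A B M ≪≫
      whiskerLeftIso A nB ≪≫ nA).inv ≫ (𝟙 ((A ⊗ B) ⊗ K) ⊗ₘ g) ≫ n' =
    (α_ A (B ⊗ K) L ≪≫ whiskerLeftIso A (α_ B K L ≪≫ whiskerLeftIso B nC ≪≫ nB) ≪≫ nA).inv ≫
      ((α_ A B K).inv ⊗ₘ g) ≫ n' := by
  simp [MonoidalCategory.tensorHom_def]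

theorem Good.assocInv (X : S → C) (a b c : Word S) :
    Good X (e := mul a (mul b c)) (e' := mul (mul a b) c)
      (α_ (a.ev X) (b.ev X) (c.ev X)).inv := by
  intro l l' g hg
  exact assocInv_aux (nm X c l) (nm X b _) (nm X a _) g (nm X (mul (mul a b) c) l').hom ▸
    Good.id X (mul (mul a b) c) l l' g hg

theorem left_aux {A L M Q L' : C} (nA : A ⊗ L ≅ M) (g : L ⟶ L') (n' : A ⊗ L' ⟶ Q) :
    nA.inv ≫ (𝟙 A ⊗ₘ g) ≫ n' =
      (α_ (𝟙_ C) A L ≪≫ whiskerLeftIso (𝟙_ C) nA ≪≫ λ_ M).inv ≫ ((λ_ A).hom ⊗ₘ g) ≫ n' := by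
  simp [MonoidalCategory.tensorHom_def]

theorem Good.left (X : S → C) (a : Word S) :
    Good X (e := mul one a) (e' := a) (λ_ (a.ev X)).hom := by
  intro l l' g hg
  exact left_aux (nm X a l) g (nm X a l').hom ▸ Good.id X a l l' g hg

theorem leftInv_aux {A L M Q L' : C} (nA : A ⊗ L ≅ M) (g : L ⟶ L') (n' : (𝟙_ C ⊗ A) ⊗ L' ⟶ Q) :
    (α_ (𝟙_ C) A L ≪≫ whiskerLeftIso (𝟙_ C) nA ≪≫ λ_ M).inv ≫ (𝟙 (𝟙_ C ⊗ A) ⊗ₘ g) ≫ n' =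
    nA.inv ≫ ((λ_ A).inv ⊗ₘ g) ≫ n' := by
  simp [MonoidalCategory.tensorHom_def]

theorem Good.leftInv (X : S → C) (a : Word S) :
    Good X (e := a) (e' := mul one a) (λ_ (a.ev X)).inv := by
  intro l l' g hg
  exact leftInv_aux (nm X a l) g (nm X (mul one a) l').hom ▸ Good.id X (mul one a) l l' g hg

theorem right_aux {A L M Q L' : C} (nA : A ⊗ L ≅ M) (g : L ⟶ L') (n' : A ⊗ L' ⟶ Q) :
    nA.inv ≫ (𝟙 A ⊗ₘ g) ≫ n' =
      (α_ A (𝟙_ C) L ≪≫ whiskerLeftIso A (λ_ L) ≪≫ nA).inv ≫ ((ρ_ A).hom ⊗ₘ g) ≫ n' := by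
  simp [MonoidalCategory.tensorHom_def]

theorem Good.right (X : S → C) (a : Word S) :
    Good X (e := mul a one) (e' := a) (ρ_ (a.ev X)).hom := by
  intro l l' g hg
  exact right_aux (nm X a l) g (nm X a l').hom ▸ Good.id X a l l' g hg

theorem rightInv_aux {A L M Q L' : C} (nA : A ⊗ L ≅ M) (g : L ⟶ L') (n' : (A ⊗ 𝟙_ C) ⊗ L' ⟶ Q) :
    (α_ A (𝟙_ C) L ≪≫ whiskerLeftIso A (λ_ L) ≪≫ nA).inv ≫ (𝟙 (A ⊗ 𝟙_ C) ⊗ₘ g) ≫ n' =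
    nA.inv ≫ ((ρ_ A).inv ⊗ₘ g) ≫ n' := by
  simp [MonoidalCategory.tensorHom_def]

theorem Good.rightInv (X : S → C) (a : Word S) :
    Good X (e := a) (e' := mul a one) (ρ_ (a.ev X)).inv := by
  intro l l' g hg
  exact rightInv_aux (nm X a l) g (nm X (mul a one) l').hom ▸ Good.id X (mul a one) l l' g hg

theorem braid_aux {A B L L' : C} (g : L ⟶ L') :
    (A ◁ ((B ◁ g) ≫ 𝟙 (B ⊗ L'))) ≫ sw A B L' ≫ (B ◁ 𝟙 (A ⊗ L')) =
    (α_ A B L ≪≫ whiskerLeftIso A (Iso.refl (B ⊗ L)) ≪≫ Iso.refl (A ⊗ (B ⊗ L))).inv ≫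
      ((β_ A B).hom ⊗ₘ g) ≫
        (α_ B A L' ≪≫ whiskerLeftIso B (Iso.refl (A ⊗ L')) ≪≫ Iso.refl (B ⊗ (A ⊗ L'))).hom := by
  simp [MonoidalCategory.tensorHom_def', sw]

theorem Good.braidOf (X : S → C) (s : S) (b : Word S) :
    Good X (e := mul (of s) b) (e' := mul b (of s)) (β_ (X s) (b.ev X)).hom := by
  induction b with
  | one =>
    have h : (ρ_ (X s)).hom ≫ (λ_ (X s)).inv = (β_ (X s) (𝟙_ C)).hom := by simp
    exact h ▸ (Good.right X (of s)).comp X (Good.leftInv X (of s))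
  | of t =>
    intro l l' g hg
    exact braid_aux g ▸ Perm.cons (.there t (.here (a := s) l')) (Perm.cons (.here (a := t) l') hg)
  | mul a b ha hb =>
    have h : (α_ (X s) (a.ev X) (b.ev X)).inv ≫ ((β_ (X s) (a.ev X)).hom ⊗ₘ 𝟙 (b.ev X)) ≫
        (α_ (a.ev X) (X s) (b.ev X)).hom ≫ (𝟙 (a.ev X) ⊗ₘ (β_ (X s) (b.ev X)).hom) ≫
        (α_ (a.ev X) (b.ev X) (X s)).inv = (β_ (X s) (a.ev X ⊗ b.ev X)).hom := by
      simp
    exact h ▸ (Good.assocInv X (of s) a b).comp X ((ha.tensor X (Good.id X b)).comp X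
      ((Good.assoc X a (of s) b).comp X (((Good.id X a).tensor X hb).comp X
        (Good.assocInv X a b (of s)))))

theorem Good.braid (X : S → C) (a b : Word S) :
    Good X (e := mul a b) (e' := mul b a) (β_ (a.ev X) (b.ev X)).hom := by
  induction a with
  | one =>
    have h : (λ_ (b.ev X)).hom ≫ (ρ_ (b.ev X)).inv = (β_ (𝟙_ C) (b.ev X)).hom := by simp
    exact h ▸ (Good.left X b).comp X (Good.rightInv X b)
  | of s => exact Good.braidOf X s b
  | mul a c ha hc =>
    have h : (α_ (a.ev X) (c.ev X) (b.ev X)).hom ≫ (𝟙 (a.ev X) ⊗ₘ (β_ (c.ev X) (b.ev X)).hom) ≫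
        (α_ (a.ev X) (b.ev X) (c.ev X)).inv ≫ ((β_ (a.ev X) (b.ev X)).hom ⊗ₘ 𝟙 (c.ev X)) ≫
        (α_ (b.ev X) (a.ev X) (c.ev X)).hom = (β_ (a.ev X ⊗ c.ev X) (b.ev X)).hom := by
      simp
    exact h ▸ (Good.assoc X a c b).comp X (((Good.id X a).tensor X hc).comp X
      ((Good.assocInv X a b c).comp X ((ha.tensor X (Good.id X c)).comp X
        (Good.assoc X b a c))))

theorem FHom.good (X : S → C) {e e' : Word S} (f : FHom e e') : Good X (f.interp X) := by
  induction f with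
  | id e => exact Good.id X e
  | comp f g hf hg => exact hf.comp X hg
  | tensor f g hf hg => exact hf.tensor X hg
  | assoc a b c => exact Good.assoc X a b c
  | assocInv a b c => exact Good.assocInv X a b c
  | leftU a => exact Good.left X a
  | leftUInv a => exact Good.leftInv X a
  | rightU a => exact Good.right X a
  | rightUInv a => exact Good.rightInv X a
  | braid a b => exact Good.braid X a b

/-- Coherence: parallel formal structure morphisms between expressions without repeated leaves
have the same interpretation. -/
theorem FHom.coherence (X : S → C) {e e' : Word S} (h : (e'.flat []).Nodup) (f g : FHom e e') :
    f.interp X = g.interp X := by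
  have key := (f.good X [] [] (𝟙 _) .nil).unique X h (g.good X [] [] (𝟙 _) .nil)
  have key' : (f.interp X ⊗ₘ 𝟙 (𝟙_ C)) = (g.interp X ⊗ₘ 𝟙 (𝟙_ C)) :=
    (Iso.cancel_iso_hom_right _ _ (nm X e' [])).1 ((Iso.cancel_iso_inv_left (nm X e []) _ _).1 key)
  rw [tensorHom_id, tensorHom_id] at key'
  exact (MonoidalCategory.whiskerRight_iff _ _).1 key'

/-! ### Morphisms determined by what they do on the factors -/

theorem evBind_evBind {X : S → C} {Y : T → C} {Z : U → C} (k : S → Word T)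
    (φ : ∀ s, X s ⟶ (k s).ev Y) (k' : T → Word U) (φ' : ∀ t, Y t ⟶ (k' t).ev Z) (e : Word S) :
    ∃ f : FHom (e.bind fun s => (k s).bind k') ((e.bind k).bind k'),
      evBind k φ e ≫ evBind k' φ' (e.bind k) =
        evBind (fun s => (k s).bind k') (fun s => φ s ≫ evBind k' φ' (k s)) e ≫ f.interp Z := by
  induction e with
  | one => exact ⟨.id _, rfl⟩
  | of s => exact ⟨.id _, (Category.comp_id _).symm⟩
  | mul a b ha hb =>
    obtain ⟨f, hf⟩ := ha
    obtain ⟨g, hg⟩ := hb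
    refine ⟨.tensor f g, ?_⟩
    have := congr_arg₂ (fun x y => x ⊗ₘ y) hf hg
    exact (tensorHom_comp_tensorHom _ _ _ _).trans
      (this.trans (tensorHom_comp_tensorHom _ _ _ _).symm)

theorem evBind_of (X : S → C) (e : Word S) :
    ∃ f : FHom (e.bind of) e, 𝟙 (e.ev X) =
      evBind (X := X) (Y := X) of (fun s => 𝟙 (X s)) e ≫ f.interp X := by
  induction e with
  | one => exact ⟨.id _, (Category.comp_id _).symm⟩
  | of s => exact ⟨.id _, (Category.comp_id _).symm⟩
  | mul a b ha hb =>
    obtain ⟨f, hf⟩ := ha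
    obtain ⟨g, hg⟩ := hb
    refine ⟨.tensor f g, ?_⟩
    have := congr_arg₂ (fun x y => x ⊗ₘ y) hf hg
    exact (id_tensorHom_id _ _).symm.trans (this.trans (tensorHom_comp_tensorHom _ _ _ _).symm)

theorem evBind_congr {X : S → C} {Y : T → C} (k k' : S → Word T)
    (φ : ∀ s, X s ⟶ (k s).ev Y) (φ' : ∀ s, X s ⟶ (k' s).ev Y) (h : ∀ s, FHom (k s) (k' s))
    (hφ : ∀ s, φ' s = φ s ≫ (h s).interp Y) (e : Word S) :
    ∃ f : FHom (e.bind k) (e.bind k'), evBind k' φ' e = evBind k φ e ≫ f.interp Y := by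
  induction e with
  | one => exact ⟨.id _, (Category.comp_id _).symm⟩
  | of s => exact ⟨h s, hφ s⟩
  | mul a b ha hb =>
    obtain ⟨f, hf⟩ := ha
    obtain ⟨g, hg⟩ := hb
    refine ⟨.tensor f g, ?_⟩
    have := congr_arg₂ (fun x y => x ⊗ₘ y) hf hg
    exact this.trans (tensorHom_comp_tensorHom _ _ _ _).symm

theorem evBind_isIso {X : S → C} {Y : T → C} (k : S → Word T)
    (φ : ∀ s, X s ⟶ (k s).ev Y) [∀ s, IsIso (φ s)] (e : Word S) : IsIso (evBind k φ e) := by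
  induction e with
  | one => exact inferInstanceAs (IsIso (𝟙 (𝟙_ C)))
  | of s => exact inferInstanceAs (IsIso (φ s))
  | mul a b ha hb => exact inferInstanceAs (IsIso (evBind k φ a ⊗ₘ evBind k φ b))

/-- `m` is, up to the coherence isomorphisms, the tensor product of the morphisms `φ s`. -/
def Rep {X : S → C} {Y : T → C} (k : S → Word T) (φ : ∀ s, X s ⟶ (k s).ev Y)
    {e : Word S} {e' : Word T} (m : e.ev X ⟶ e'.ev Y) : Prop :=
  ∃ f : FHom (e.bind k) e', m = evBind k φ e ≫ f.interp Y

theorem Rep.unique {X : S → C} {Y : T → C} {k : S → Word T} {φ : ∀ s, X s ⟶ (k s).ev Y}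
    {e : Word S} {e' : Word T} {m m' : e.ev X ⟶ e'.ev Y} (h : Rep k φ m) (h' : Rep k φ m')
    (he : (e'.flat []).Nodup) : m = m' := by
  obtain ⟨f, rfl⟩ := h
  obtain ⟨f', rfl⟩ := h'
  rw [f.coherence Y he f']

theorem Rep.comp {X : S → C} {Y : T → C} {Z : U → C} {k : S → Word T}
    {φ : ∀ s, X s ⟶ (k s).ev Y} {k' : T → Word U} {φ' : ∀ t, Y t ⟶ (k' t).ev Z}
    {e : Word S} {e' : Word T} {e'' : Word U} {m : e.ev X ⟶ e'.ev Y} {m' : e'.ev Y ⟶ e''.ev Z}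
    (h : Rep k φ m) (h' : Rep k' φ' m') :
    Rep (fun s => (k s).bind k') (fun s => φ s ≫ evBind k' φ' (k s)) (m ≫ m') := by
  obtain ⟨f, rfl⟩ := h
  obtain ⟨f', rfl⟩ := h'
  obtain ⟨g, hg⟩ := evBind_evBind k φ k' φ' e
  refine ⟨g.comp ((f.bind k').comp f'), ?_⟩
  have h := interp_evBind k' φ' f
  calc (evBind k φ e ≫ f.interp Y) ≫ (evBind k' φ' e' ≫ f'.interp Z)
      = evBind k φ e ≫ (f.interp Y ≫ evBind k' φ' e') ≫ f'.interp Z := by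
        simp only [Category.assoc]
    _ = (evBind k φ e ≫ evBind k' φ' (e.bind k)) ≫ (f.bind k').interp Z ≫ f'.interp Z := by
        rw [h]; simp only [Category.assoc]
    _ = _ := by rw [hg]; simp only [FHom.interp, Category.assoc]

theorem Rep.ofFHom (X : S → C) {e e' : Word S} (f : FHom e e') :
    Rep (X := X) (Y := X) of (fun s => 𝟙 (X s)) (f.interp X) := by
  obtain ⟨g, hg⟩ := evBind_of X e
  refine ⟨g.comp f, ?_⟩
  calc f.interp X = 𝟙 _ ≫ f.interp X := (Category.id_comp _).symm
    _ = _ := by rw [hg]; simp only [FHom.interp, Category.assoc]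

theorem Rep.congr {X : S → C} {Y : T → C} {k k' : S → Word T} {φ : ∀ s, X s ⟶ (k s).ev Y}
    {φ' : ∀ s, X s ⟶ (k' s).ev Y} {e : Word S} {e' : Word T} {m : e.ev X ⟶ e'.ev Y}
    (hm : Rep k' φ' m) (h : ∀ s, ∃ f : FHom (k s) (k' s), φ' s = φ s ≫ f.interp Y) :
    Rep k φ m := by
  choose h hφ using h
  obtain ⟨f, rfl⟩ := hm
  obtain ⟨g, hg⟩ := evBind_congr k k' φ φ' h hφ e
  exact ⟨g.comp f, by rw [hg]; simp only [FHom.interp, Category.assoc]⟩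

theorem Rep.congr' {X : S → C} {Y : T → C} {k : S → Word T} {φ φ' : ∀ s, X s ⟶ (k s).ev Y}
    {e : Word S} {e' : Word T} {m : e.ev X ⟶ e'.ev Y}
    (hm : Rep k φ' m) (h : ∀ s, φ' s = φ s) : Rep k φ m :=
  (funext h : φ' = φ) ▸ hm

theorem FHom.exists_inv (X : S → C) {e e' : Word S} (f : FHom e e') :
    ∃ g : FHom e' e, f.interp X ≫ g.interp X = 𝟙 _ := by
  induction f with
  | id e => exact ⟨.id _, Category.comp_id _⟩
  | comp f f' hf hf' =>
    obtain ⟨g, hg⟩ := hf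
    obtain ⟨g', hg'⟩ := hf'
    refine ⟨g'.comp g, ?_⟩
    simp only [FHom.interp, Category.assoc, reassoc_of% hg', hg]
  | tensor f f' hf hf' =>
    obtain ⟨g, hg⟩ := hf
    obtain ⟨g', hg'⟩ := hf'
    refine ⟨g.tensor g', ?_⟩
    exact (tensorHom_comp_tensorHom _ _ _ _).trans
      ((congr_arg₂ (fun x y => x ⊗ₘ y) hg hg').trans (id_tensorHom_id _ _))
  | assoc a b c => exact ⟨.assocInv _ _ _, Iso.hom_inv_id (α_ _ _ _)⟩
  | assocInv a b c => exact ⟨.assoc _ _ _, Iso.inv_hom_id (α_ _ _ _)⟩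
  | leftU a => exact ⟨.leftUInv _, Iso.hom_inv_id (λ_ _)⟩
  | leftUInv a => exact ⟨.leftU _, Iso.inv_hom_id (λ_ _)⟩
  | rightU a => exact ⟨.rightUInv _, Iso.hom_inv_id (ρ_ _)⟩
  | rightUInv a => exact ⟨.rightU _, Iso.inv_hom_id (ρ_ _)⟩
  | braid a b => exact ⟨.braid _ _, SymmetricCategory.symmetry _ _⟩

/-! ### Unordered tensor products -/

/-- `e` mentions each element of `S` exactly once. -/
def Full (e : Word S) : Prop := (e.flat []).Nodup ∧ ∀ s, s ∈ e.flat []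

theorem Full.perm {e e' : Word S} (h : e.Full) (h' : e'.Full) :
    (e.flat []).Perm (e'.flat []) :=
  (List.perm_ext_iff_of_nodup h.1 h'.1).2 fun s => ⟨fun _ => h'.2 s, fun _ => h.2 s⟩

theorem Full.bind {e : Word S} (he : e.Full) {k : S → Word T}
    (h₁ : ∀ s, ((k s).flat []).Nodup)
    (h₂ : ∀ s s' t, t ∈ (k s).flat [] → t ∈ (k s').flat [] → s = s')
    (h₃ : ∀ t, ∃ s, t ∈ (k s).flat []) : (e.bind k).Full := by
  refine ⟨?_, fun t => ?_⟩
  · rw [flat_bind, List.nodup_flatMap]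
    refine ⟨fun s _ => h₁ s, he.1.imp fun {s s'} hs => ?_⟩
    rw [Function.onFun, List.disjoint_left]
    exact fun t ht ht' => hs (h₂ s s' t ht ht')
  · obtain ⟨s, hs⟩ := h₃ t
    rw [flat_bind, List.mem_flatMap]
    exact ⟨s, he.2 s, hs⟩

theorem Full.bindEquiv {e : Word S} (he : e.Full) (σ : S ≃ T) :
    (e.bind fun s => of (σ s)).Full :=
  he.bind (fun s => by simp [flat])
    (fun s s' t h h' => σ.injective ((List.mem_singleton.1 h).symm.trans (List.mem_singleton.1 h')))
    (fun t => ⟨σ.symm t, by simp [flat]⟩)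

variable (S) in
/-- A chosen ordering of a finite set, as a right-bracketed product of its elements. -/
noncomputable def std [Finite S] : Word S :=
  letI := Fintype.ofFinite S
  ofList (Finset.univ : Finset S).toList

variable (S) in
theorem std_full [Finite S] : (std S).Full := by
  let _ := Fintype.ofFinite S
  refine ⟨?_, fun s => ?_⟩ <;> rw [std, flat_ofList]
  · exact Finset.nodup_toList _
  · simp

/-- The coherence morphism between two bracketed and ordered products of the same factors. -/
noncomputable def canon (X : S → C) (e e' : Word S) (h : (e.flat []).Perm (e'.flat [])) :
    e.ev X ⟶ e'.ev X :=
  (Classical.choice (FHom.exists_of_perm h)).interp X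

theorem Rep.canon {X : S → C} {Y : T → C} {k : S → Word T} {φ : ∀ s, X s ⟶ (k s).ev Y}
    {e : Word S} {e' e'' : Word T} {m : e.ev X ⟶ e'.ev Y} (hm : Rep k φ m)
    (h : (e'.flat []).Perm (e''.flat [])) : Rep k φ (m ≫ Word.canon Y e' e'' h) := by
  obtain ⟨f, rfl⟩ := hm
  exact ⟨f.comp (Classical.choice (FHom.exists_of_perm h)), by
    simp only [FHom.interp, Word.canon, Category.assoc]⟩

theorem Rep.evBind {X : S → C} {Y : T → C} (k : S → Word T) (φ : ∀ s, X s ⟶ (k s).ev Y)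
    (e : Word S) : Rep k φ (evBind k φ e) :=
  ⟨.id _, (Category.comp_id _).symm⟩

theorem canon_isIso (X : S → C) (e e' : Word S) (h : (e.flat []).Perm (e'.flat []))
    (he : (e.flat []).Nodup) : IsIso (canon X e e' h) := by
  refine ⟨canon X e' e h.symm, ?_, ?_⟩
  · exact FHom.coherence X he (FHom.comp (Classical.choice (FHom.exists_of_perm h))
      (Classical.choice (FHom.exists_of_perm h.symm))) (.id _)
  · exact FHom.coherence X (h.nodup_iff.1 he)
      (FHom.comp (Classical.choice (FHom.exists_of_perm h.symm))
      (Classical.choice (FHom.exists_of_perm h))) (.id _)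

end Word

open Word

section Tens

variable {S T U V : Type} [Finite S] [Finite T] {C : Type u} [Category.{v} C] [MonoidalCategory C]

/-- The tensor product `⨂_{s ∈ S} X s` of a family indexed by a finite set. It is formed with a
chosen ordering of `S`; any two orderings are canonically identified through the symmetry. -/
noncomputable def tens (X : S → C) : C := (std S).ev X

variable [SymmetricCategory C]

/-- The morphism `⨂_{s ∈ S} X s ⟶ ⨂_{t ∈ T} Y t` given by a bijection `σ : S ≃ T` and morphisms
`X s ⟶ Y (σ s)`; it permutes the factors through the symmetry. -/
noncomputable def tensMap {X : S → C} {Y : T → C} (σ : S ≃ T) (φ : ∀ s, X s ⟶ Y (σ s)) :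
    tens X ⟶ tens Y :=
  evBind (X := X) (Y := Y) (fun s => of (σ s)) φ (std S) ≫
    canon Y _ _ (((std_full S).bindEquiv σ).perm (std_full T))

theorem tensMap_rep {X : S → C} {Y : T → C} (σ : S ≃ T) (φ : ∀ s, X s ⟶ Y (σ s)) :
    Rep (X := X) (Y := Y) (fun s => of (σ s)) φ (e := std S) (e' := std T) (tensMap σ φ) :=
  (Rep.evBind _ _ _).canon _

theorem tensMap_id (X : S → C) : tensMap (Equiv.refl S) (fun s => 𝟙 (X s)) = 𝟙 (tens X) :=
  (tensMap_rep _ _).unique (Rep.ofFHom X (.id _)) (std_full S).1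

theorem tensMap_comp [Finite U] {X : S → C} {Y : T → C} {Z : U → C} (σ : S ≃ T) (τ : T ≃ U)
    (φ : ∀ s, X s ⟶ Y (σ s)) (ψ : ∀ t, Y t ⟶ Z (τ t)) :
    tensMap (σ.trans τ) (fun s => φ s ≫ ψ (σ s)) = tensMap σ φ ≫ tensMap τ ψ :=
  (tensMap_rep (σ.trans τ) _).unique ((tensMap_rep σ φ).comp (tensMap_rep τ ψ)) (std_full U).1

theorem tensMap_evBind {X : S → C} {Y : T → C} {Z : U → C} {W : V → C} (σ : S ≃ T)
    (p : ∀ s, X s ⟶ Y (σ s)) (k₁ : S → Word U) (φ₁ : ∀ s, X s ⟶ (k₁ s).ev Z)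
    (k₂ : T → Word V) (φ₂ : ∀ t, Y t ⟶ (k₂ t).ev W) (k₃ : U → Word V)
    (φ₃ : ∀ u, Z u ⟶ (k₃ u).ev W)
    (H : ∀ s, ∃ h : FHom ((k₁ s).bind k₃) (k₂ (σ s)),
      p s ≫ φ₂ (σ s) = (φ₁ s ≫ evBind k₃ φ₃ (k₁ s)) ≫ h.interp W) :
    ∃ h : FHom (((std S).bind k₁).bind k₃) ((std T).bind k₂),
      tensMap σ p ≫ evBind k₂ φ₂ (std T) =
        (evBind k₁ φ₁ (std S) ≫ evBind k₃ φ₃ ((std S).bind k₁)) ≫ h.interp W := by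
  obtain ⟨f, hf⟩ := ((tensMap_rep σ p).comp (Rep.evBind k₂ φ₂ (std T))).congr H
  obtain ⟨g, hg⟩ := evBind_evBind k₁ φ₁ k₃ φ₃ (std S)
  obtain ⟨g', hg'⟩ := g.exists_inv W
  refine ⟨g'.comp f, hf.trans ?_⟩
  rw [hg]
  simp only [FHom.interp, Category.assoc]
  rw [reassoc_of% hg']

section Merge

variable {P : S → C} {R : S → Type} [∀ s, Finite (R s)] {Q : ∀ s, R s → C}

variable (P Q) in
/-- The factors of `(⨂_s P s) ⊗ ⨂_{(s, r)} Q s r`, as one family. -/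
def mergeFam : S ⊕ (Σ s, R s) → C
  | .inl s => P s
  | .inr x => Q x.1 x.2

variable (S R) in
/-- The formal product `P_s ⊗ ⨂_r Q_{s, r}`. -/
noncomputable def mergeTgt (s : S) : Word (S ⊕ (Σ s, R s)) :=
  mul (of (.inl s)) ((std (R s)).bind fun r => of (.inr ⟨s, r⟩))

variable (S R) in
/-- The formal product `(⨂_s P_s) ⊗ ⨂_{(s, r)} Q_{s, r}`. -/
noncomputable def mergeSrc : Word (S ⊕ (Σ s, R s)) :=
  mul ((std S).bind fun s => of (.inl s)) ((std (Σ s, R s)).bind fun x => of (.inr x))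

theorem flat_bind_of {S T : Type} (ι : S → T) (e : Word S) :
    (e.bind fun s => of (ι s)).flat [] = (e.flat []).map ι := by
  rw [flat_bind]
  exact List.flatMap_pure_eq_map ι _

variable (S R) in
theorem mergeSrc_full : (mergeSrc S R).Full := by
  have h : (mergeSrc S R).flat [] =
      ((std S).flat []).map .inl ++ ((std (Σ s, R s)).flat []).map .inr := by
    rw [mergeSrc, flat, flat_append, flat_bind_of, flat_bind_of]
  refine ⟨h ▸ List.nodup_append.2 ⟨(std_full S).1.map Sum.inl_injective,
    (std_full _).1.map Sum.inr_injective, by simp⟩, fun s => ?_⟩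
  rw [h]
  rcases s with s | s
  · simpa using (std_full S).2 s
  · simpa using (std_full _).2 s

variable (S R) in
theorem mergeTgt_full : ((std S).bind (mergeTgt S R)).Full := by
  have h : ∀ s, (mergeTgt S R s).flat [] =
      .inl s :: ((std (R s)).flat []).map (fun r => .inr ⟨s, r⟩) := fun s => by
    rw [mergeTgt, flat, flat, flat_bind_of]
  refine (std_full S).bind (fun s => ?_) (fun s s' t ht ht' => ?_) (fun t => ?_)
  · rw [h, List.nodup_cons]
    exact ⟨by simp, (std_full _).1.map fun a b hab => by simpa using hab⟩
  · rw [h] at ht ht'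
    rcases t with t | t
    · simp at ht ht'
      exact ht.symm.trans ht'
    · simp at ht ht'
      obtain ⟨r, -, rfl⟩ := ht
      obtain ⟨r', -, hr⟩ := ht'
      exact (Sigma.mk.inj hr).1.symm
  · rcases t with s | ⟨s, r⟩
    · exact ⟨s, by rw [h]; simp⟩
    · exact ⟨s, by rw [h]; simpa using (std_full _).2 r⟩

/-- The identification of `⨂_s Z (ι s)` with a product of factors from the family `Z`. -/
noncomputable def incl (Z : U → C) (ι : S → U) :
    tens (fun s => Z (ι s)) ⟶ ((std S).bind fun s => of (ι s)).ev Z :=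
  evBind (X := fun s => Z (ι s)) (fun s => of (ι s)) (fun s => 𝟙 (Z (ι s))) (std S)

instance incl_isIso (Z : U → C) (ι : S → U) : IsIso (incl Z ι) :=
  have : ∀ s, IsIso (X := Z (ι s)) (Y := (of (ι s)).ev Z) (𝟙 (Z (ι s))) := fun s =>
    inferInstanceAs (IsIso (𝟙 (Z (ι s))))
  evBind_isIso (X := fun s => Z (ι s)) (fun s => of (ι s)) (fun s => 𝟙 (Z (ι s))) (std S)

variable (P Q) in
/-- Identification with a formal product. -/
noncomputable def splitSrc : tens P ⊗ tens (fun x : Σ s, R s => Q x.1 x.2) ⟶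
    (mergeSrc S R).ev (mergeFam P Q) :=
  incl (mergeFam P Q) .inl ⊗ₘ incl (mergeFam P Q) .inr

variable (P Q) in
/-- Identification with a formal product. -/
noncomputable def splitFib (s : S) : P s ⊗ tens (Q s) ⟶ (mergeTgt S R s).ev (mergeFam P Q) :=
  𝟙 (P s) ⊗ₘ incl (mergeFam P Q) (fun r => .inr ⟨s, r⟩)

instance splitFib_isIso (s : S) : IsIso (splitFib P Q s) :=
  inferInstanceAs (IsIso (𝟙 (P s) ⊗ₘ incl (mergeFam P Q) (fun r => .inr ⟨s, r⟩)))

variable (P Q) in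
/-- Identification with a formal product. -/
noncomputable def splitTgt : tens (fun s => P s ⊗ tens (Q s)) ⟶
    ((std S).bind (mergeTgt S R)).ev (mergeFam P Q) :=
  evBind (mergeTgt S R) (splitFib P Q) (std S)

instance splitTgt_isIso : IsIso (splitTgt P Q) :=
  evBind_isIso (mergeTgt S R) (splitFib P Q) (std S)

variable (P Q) in
/-- The coherence isomorphism `(⨂_s P_s) ⊗ ⨂_{(s, r)} Q_{s, r} ≅ ⨂_s (P_s ⊗ ⨂_r Q_{s, r})`. -/
noncomputable def merge : tens P ⊗ tens (fun x : Σ s, R s => Q x.1 x.2) ⟶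
    tens (fun s => P s ⊗ tens (Q s)) :=
  splitSrc P Q ≫
    canon (mergeFam P Q) _ _ ((mergeSrc_full S R).perm (mergeTgt_full S R)) ≫
    inv (splitTgt P Q)

theorem tensMap_incl {U V : Type} {Z : U → C} {W : V → C} (ι : S → U) (κ : T → V) (σ : S ≃ T)
    (Φ : U → V) (z : ∀ u, Z u ⟶ W (Φ u)) (p : ∀ s, Z (ι s) ⟶ W (κ (σ s)))
    (H : ∀ s, ∃ f : FHom (of (Φ (ι s))) (of (κ (σ s))), p s = z (ι s) ≫ f.interp W) :
    ∃ h : FHom (((std S).bind fun s => of (ι s)).bind fun u => of (Φ u))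
        ((std T).bind fun t => of (κ t)),
      tensMap (X := fun s => Z (ι s)) (Y := fun t => W (κ t)) σ p ≫ incl W κ =
        (incl Z ι ≫ evBind (X := Z) (Y := W) (fun u => of (Φ u)) z _) ≫ h.interp W := by
  refine tensMap_evBind (X := fun s => Z (ι s)) (Y := fun t => W (κ t)) (Z := Z) (W := W) σ p _ _
    _ _ _ _ fun s => ?_
  obtain ⟨f, hf⟩ := H s
  exact ⟨f, ((Category.comp_id _).trans hf).trans (congr_arg (· ≫ _) (Category.id_comp _).symm)⟩

theorem fib_aux {P₀ P₁ T₀ T₁ U₀ U₁ V₁ : C} (p : P₀ ⟶ P₁) (t : T₀ ⟶ T₁) (i' : T₁ ⟶ V₁)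
    (i : T₀ ⟶ U₀) (e : U₀ ⟶ U₁) (f : U₁ ⟶ V₁) (h : t ≫ i' = (i ≫ e) ≫ f) :
    (p ⊗ₘ t) ≫ (𝟙 P₁ ⊗ₘ i') = ((𝟙 P₀ ⊗ₘ i) ≫ (p ⊗ₘ e)) ≫ (𝟙 P₁ ⊗ₘ f) := by
  rw [tensorHom_comp_tensorHom, h]
  simp only [tensorHom_comp_tensorHom, Category.comp_id, Category.id_comp]

theorem src_aux {A A' B B' E E' F F' V V' : C} (a : A ⟶ A') (b : B ⟶ B') (i' : A' ⟶ V)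
    (j' : B' ⟶ V') (i : A ⟶ E) (j : B ⟶ E') (e : E ⟶ F) (e' : E' ⟶ F') (f : F ⟶ V)
    (f' : F' ⟶ V') (h : a ≫ i' = (i ≫ e) ≫ f) (h' : b ≫ j' = (j ≫ e') ≫ f') :
    (a ⊗ₘ b) ≫ (i' ⊗ₘ j') = ((i ⊗ₘ j) ≫ (e ⊗ₘ e')) ≫ (f ⊗ₘ f') := by
  simp only [tensorHom_comp_tensorHom, h, h']

theorem square_aux {A A' B B' D D' E F G K : C} (ab : A ⟶ A') (s' : A' ⟶ B') (s : A ⟶ B)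
    (e : B ⟶ E) (fg : E ⟶ B') (c : B ⟶ D) (n : D ⟶ F) (cb : E ⟶ F) (t : G ⟶ K)
    (g' : K ⟶ D') (g : G ⟶ D) (h : F ⟶ D') (c' : B' ⟶ D') [IsIso g] [IsIso g']
    (h₁ : ab ≫ s' = (s ≫ e) ≫ fg) (h₂ : c ≫ n = e ≫ cb) (h₃ : t ≫ g' = (g ≫ n) ≫ h)
    (h₄ : fg ≫ c' = cb ≫ h) :
    ab ≫ (s' ≫ c' ≫ inv g') = (s ≫ c ≫ inv g) ≫ t := by
  rw [← cancel_mono g']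
  simp only [Category.assoc, IsIso.inv_hom_id, Category.comp_id, h₃, IsIso.inv_hom_id_assoc]
  rw [reassoc_of% h₁, h₄, reassoc_of% h₂]

theorem merge_natural {P' : T → C} {R' : T → Type} [∀ s, Finite (R' s)] {Q' : ∀ s, R' s → C}
    (σ : S ≃ T) (τ : ∀ s, R s ≃ R' (σ s)) (p : ∀ s, P s ⟶ P' (σ s))
    (q : ∀ s r, Q s r ⟶ Q' (σ s) (τ s r)) :
    (tensMap σ p ⊗ₘ tensMap (X := fun x : Σ s, R s => Q x.1 x.2)
      (Y := fun x : Σ s, R' s => Q' x.1 x.2) (σ.sigmaCongr τ) (fun x => q x.1 x.2)) ≫ merge P' Q' =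
    merge P Q ≫ tensMap (X := fun s => P s ⊗ tens (Q s)) (Y := fun s => P' s ⊗ tens (Q' s)) σ
      (fun s => p s ⊗ₘ tensMap (τ s) (q s)) := by
  let Φ : S ⊕ (Σ s, R s) → T ⊕ (Σ s, R' s)
    | .inl s => .inl (σ s)
    | .inr x => .inr ⟨σ x.1, τ x.1 x.2⟩
  let z : ∀ u, mergeFam P Q u ⟶ mergeFam P' Q' (Φ u)
    | .inl s => p s
    | .inr x => q x.1 x.2
  -- the fibrewise comparison
  obtain ⟨h, hh⟩ := tensMap_evBind (X := fun s => P s ⊗ tens (Q s))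
    (Y := fun s => P' s ⊗ tens (Q' s)) (W := mergeFam P' Q') σ
    (fun s => p s ⊗ₘ tensMap (τ s) (q s)) (mergeTgt S R) (splitFib P Q) (mergeTgt T R')
    (splitFib P' Q') (fun u => of (Φ u)) z fun s => by
      obtain ⟨f, hf⟩ := tensMap_incl (Z := mergeFam P Q) (W := mergeFam P' Q')
        (fun r : R s => .inr ⟨s, r⟩) (fun r : R' (σ s) => .inr ⟨σ s, r⟩) (τ s) Φ z (q s)
        (fun r => ⟨.id _, (Category.comp_id _).symm⟩)
      refine ⟨.tensor (.id _) f, ?_⟩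
      exact fib_aux _ _ _ _ _ _ hf
  obtain ⟨f, hf⟩ := tensMap_incl (Z := mergeFam P Q) (W := mergeFam P' Q')
    Sum.inl Sum.inl σ Φ z p (fun r => ⟨.id _, (Category.comp_id _).symm⟩)
  obtain ⟨g, hg⟩ := tensMap_incl (Z := mergeFam P Q) (W := mergeFam P' Q')
    Sum.inr Sum.inr (σ.sigmaCongr τ) Φ z (fun x => q x.1 x.2)
      (fun r => ⟨.id _, (Category.comp_id _).symm⟩)
  exact square_aux _ (splitSrc P' Q') (splitSrc P Q)
    (evBind (X := mergeFam P Q) (Y := mergeFam P' Q') (fun u => of (Φ u)) z (mergeSrc S R))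
    ((FHom.tensor f g).interp (mergeFam P' Q')) _
    (evBind (X := mergeFam P Q) (Y := mergeFam P' Q') (fun u => of (Φ u)) z _) _ _
    (splitTgt P' Q') (splitTgt P Q) (h.interp (mergeFam P' Q')) _
    (src_aux _ _ _ _ _ _ _ _ _ _ hf hg) (interp_evBind _ _ _) hh
    (FHom.coherence (mergeFam P' Q') (mergeTgt_full T R').1
      (.comp (.tensor f g) (Classical.choice
        (FHom.exists_of_perm ((mergeSrc_full T R').perm (mergeTgt_full T R')))))
      (.comp (FHom.bind (fun u => of (Φ u)) (Classical.choice
        (FHom.exists_of_perm ((mergeSrc_full S R).perm (mergeTgt_full S R))))) h))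

end Merge

/-- The coherence isomorphism `⨂_{s ∈ S} 1 ≅ 1`. -/
noncomputable def tensUnit (S : Type) [Finite S] : tens (fun _ : S => 𝟙_ C) ⟶ 𝟙_ C :=
  evBind (X := fun _ : S => 𝟙_ C) (Y := fun x : PEmpty => x.elim) (fun _ => one)
      (fun _ => 𝟙 (𝟙_ C)) (std S) ≫
    canon (fun x : PEmpty => x.elim) _ one (by
      rw [flat_bind]; simp [flat])

/-- The coherence isomorphism `⨂_{s ∈ {⋆}} X ≅ X`. -/
noncomputable def tensPoint (X : C) : tens (fun _ : PUnit => X) ⟶ X :=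
  canon (fun _ : PUnit => X) (std PUnit) (of PUnit.unit)
    ((std_full PUnit).perm ⟨by simp [flat], fun s => by simp [flat]⟩)

theorem tensPoint_natural {X Y : C} (f : X ⟶ Y) :
    tensMap (X := fun _ : PUnit => X) (Y := fun _ : PUnit => Y) (Equiv.refl PUnit) (fun _ => f) ≫
      tensPoint Y = tensPoint X ≫ f := by
  have h := (Rep.ofFHom (fun _ : PUnit => X) (Classical.choice (FHom.exists_of_perm
    ((std_full PUnit).perm (e' := of PUnit.unit) ⟨by simp [flat], fun s => by simp [flat]⟩)))).comp
    (Rep.evBind (X := fun _ : PUnit => X) (Y := fun _ : PUnit => Y) (fun s => of s) (fun _ => f)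
      (of PUnit.unit))
  refine Rep.unique (X := fun _ : PUnit => X) (Y := fun _ : PUnit => Y) (e := std PUnit)
    (e' := of PUnit.unit) (k := fun s => of s) (φ := fun _ => f)
    ((tensMap_rep (X := fun _ : PUnit => X) (Y := fun _ : PUnit => Y) (Equiv.refl PUnit)
      (fun _ => f)).canon _)
    (h.congr' fun s => (Category.id_comp _)) (by simp [flat])

end Tens

/-! ## Finite sets and wreath products -/

/-- Finite sets, the objects of the category `Σ_*` of finite sets and bijections. -/
structure FinBij where
  carrier : Type
  [finite : Finite carrier]

attribute [instance] FinBij.finite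

instance : Category.{0} FinBij where
  Hom S T := S.carrier ≃ T.carrier
  id S := Equiv.refl _
  comp f g := f.trans g

/-- A bijection as a morphism of `Σ_*`. -/
def FinBij.homOf {S T : FinBij} (e : S.carrier ≃ T.carrier) : S ⟶ T := e

/-- Objects of the wreath product category `Σ_* ≀ A`: finite families `{A_s}_{s ∈ S}` of objects
of `A`. -/
structure Wreath (A : Type u) where
  base : FinBij
  fam : base.carrier → A

namespace Wreath

section
variable {A : Type u} [Category.{v} A] {B : Type*} [Category* B]

/-- Morphisms `{A_s}_{s ∈ S} ⟶ {B_t}_{t ∈ T}` of `Σ_* ≀ A`: a bijection `σ : S ≃ T` and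
morphisms `A_s ⟶ B_{σ s}`. -/
structure Hom (x y : Wreath A) where
  base : x.base.carrier ≃ y.base.carrier
  fam : ∀ s, x.fam s ⟶ y.fam (base s)

theorem Hom.mk_eq {x y : Wreath A} {b b' : x.base.carrier ≃ y.base.carrier} (h : b = b')
    (F : ∀ s, x.fam s ⟶ y.fam (b s)) (F' : ∀ s, x.fam s ⟶ y.fam (b' s))
    (hF : ∀ s, F s ≫ eqToHom (by rw [h]) = F' s) : Hom.mk b F = Hom.mk b' F' := by
  subst h
  exact congr_arg _ (funext fun s => (Category.comp_id _).symm.trans (hF s))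

instance : Category (Wreath A) where
  Hom x y := Hom x y
  id x := ⟨Equiv.refl _, fun s => 𝟙 (x.fam s)⟩
  comp f g := ⟨f.base.trans g.base, fun s => f.fam s ≫ g.fam (f.base s)⟩
  id_comp f := by
    cases f; exact congr_arg (Hom.mk _) (funext fun _ => Category.id_comp _)
  comp_id f := by
    cases f; exact congr_arg (Hom.mk _) (funext fun _ => Category.comp_id _)
  assoc f g h := congr_arg (Hom.mk _) (funext fun _ => Category.assoc _ _ _)

/-- The functor `Id ≀ G : Σ_* ≀ A ⥤ Σ_* ≀ B`. -/
def map (G : A ⥤ B) : Wreath A ⥤ Wreath B where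
  obj x := ⟨x.base, fun s => G.obj (x.fam s)⟩
  map f := ⟨f.base, fun s => G.map (f.fam s)⟩
  map_id _ := congr_arg (Hom.mk _) (funext fun _ => G.map_id _)
  map_comp _ _ := congr_arg (Hom.mk _) (funext fun _ => G.map_comp _ _)

/-- The functor `γ² ≀ Id : Σ_* ≀ Σ_* ≀ A ⥤ Σ_* ≀ A`, which composes the maps `⋆ ← S ← T` of
finite sets, and so turns a family of families into one family over the disjoint union. On trees,
it forgets the vertices at height 1. -/
def flatten (A : Type u) [Category.{v} A] : Wreath (Wreath A) ⥤ Wreath A where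
  obj x := ⟨⟨Σ s : x.base.carrier, (x.fam s).base.carrier⟩, fun p => (x.fam p.1).fam p.2⟩
  map f := ⟨f.base.sigmaCongr fun s => (f.fam s).base, fun p => (f.fam p.1).fam p.2⟩
  map_id _ := rfl
  map_comp {x _ z} f g := Hom.mk_eq
    (x := ⟨⟨Σ s : x.base.carrier, (x.fam s).base.carrier⟩, fun p => (x.fam p.1).fam p.2⟩)
    (y := ⟨⟨Σ s : z.base.carrier, (z.fam s).base.carrier⟩, fun p => (z.fam p.1).fam p.2⟩)
    (b := (f ≫ g).base.sigmaCongr fun s => ((f ≫ g).fam s).base)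
    (b' := (f.base.sigmaCongr fun s => (f.fam s).base).trans
      (g.base.sigmaCongr fun s => (g.fam s).base)) (Equiv.ext fun _ => rfl)
    (fun p => (f.fam p.1).fam p.2 ≫ (g.fam (f.base p.1)).fam ((f.fam p.1).base p.2))
    (fun p => (f.fam p.1).fam p.2 ≫ (g.fam (f.base p.1)).fam ((f.fam p.1).base p.2))
    fun _ => (congr_arg (_ ≫ ·) (eqToHom_refl _ _)).trans (Category.comp_id _)

/-- The functor `s_0 : A ⥤ Σ_* ≀ A`, sending `a` to the one-element family `{a}`. On trees, it
doubles the vertex at height 0. -/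
def point (A : Type u) [Category.{v} A] : A ⥤ Wreath A where
  obj a := ⟨⟨PUnit⟩, fun _ => a⟩
  map f := ⟨Equiv.refl _, fun _ => f⟩

/-- The functor `γ² : Σ_* ≀ Σ_* ⥤ Σ_*`, `{S_t}_{t ∈ T} ↦ ∐_t S_t`. -/
def total : Wreath FinBij ⥤ FinBij where
  obj x := ⟨Σ s : x.base.carrier, (x.fam s).carrier⟩
  map f := f.base.sigmaCongr fun s => f.fam s
  map_id _ := rfl
  map_comp _ _ := Equiv.ext fun _ => rfl

end
theorem isIso_mk {A : Type u} [Category.{v} A] {x y : Wreath A} (b : x.base.carrier ≃ y.base.carrier)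
    (φ : ∀ s, x.fam s ⟶ y.fam (b s)) [∀ s, IsIso (φ s)] :
    Nonempty (x ≅ y) := by
  refine ⟨⟨⟨b, φ⟩, ⟨b.symm, fun t => eqToHom (by simp) ≫ inv (φ (b.symm t))⟩, ?_, ?_⟩⟩
  · refine Hom.mk_eq (b := b.trans b.symm) (b' := Equiv.refl _) (by simp) _ _ fun s => ?_
    have : ∀ s' (h : s' = s), (φ s ≫ eqToHom (by rw [h]) ≫ inv (φ s')) ≫
        eqToHom (by rw [h]) = 𝟙 (x.fam s) := by
      rintro s' rfl; simp
    exact this _ (b.symm_apply_apply s)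
  · refine Hom.mk_eq (b := b.symm.trans b) (b' := Equiv.refl _) (by simp) _ _ fun t => ?_
    simp
    exact eqToHom_trans _ _

instance essentiallySmall (A : Type 1) [Category.{0} A] [EssentiallySmall.{0} A] :
    EssentiallySmall.{0} (Wreath A) := by
  rw [essentiallySmall_iff]
  refine ⟨?_, inferInstance⟩
  have : Small.{0} (Skeleton A) := ((essentiallySmall_iff A).1 inferInstance).1
  refine small_of_surjective (α := Σ n : ℕ, Fin n → Skeleton A)
    (f := fun p => toSkeleton ⟨⟨Fin p.1⟩, fun i => (fromSkeleton A).obj (p.2 i)⟩) fun x => ?_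
  obtain ⟨y, rfl⟩ : ∃ y, toSkeleton y = x := ⟨_, Quotient.out_eq x⟩
  obtain ⟨n, ⟨e⟩⟩ := Finite.exists_equiv_fin y.base.carrier
  refine ⟨⟨n, fun i => toSkeleton (y.fam (e.symm i))⟩, ?_⟩
  exact congr_toSkeleton_of_iso <| Classical.choice <| isIso_mk (x := ⟨⟨Fin n⟩, fun i => (fromSkeleton A).obj (toSkeleton (y.fam (e.symm i)))⟩)
    (y := y) e.symm fun i => (fromSkeletonToSkeletonIso (y.fam (e.symm i))).hom

end Wreath

section Circ

variable {C : Type u} [Category.{v} C] [MonoidalCategory C] [SymmetricCategory C]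
  {W : Type*} [Category* W]

/-- The functor `O ⊚ F : Σ_* ≀ W ⥤ C`, `{w_s}_{s ∈ S} ↦ O(S) ⊗ ⨂_{s ∈ S} F(w_s)`. -/
noncomputable def circ (O : FinBij ⥤ C) (F : W ⥤ C) : Wreath W ⥤ C where
  obj x := O.obj x.base ⊗ tens fun s => F.obj (x.fam s)
  map {x y} f := O.map (X := x.base) (Y := y.base) f.base ⊗ₘ
    tensMap f.base fun s => F.map (f.fam s)
  map_id x := by
    refine (congr_arg₂ (fun a b => a ⊗ₘ b) (O.map_id x.base) ?_).trans (id_tensorHom_id _ _)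
    refine Eq.trans ?_ (tensMap_id fun s => F.obj (x.fam s))
    exact congr_arg (tensMap (Equiv.refl _)) (funext fun s => F.map_id _)
  map_comp {x y z} f g := by
    refine (congr_arg₂ (fun a b => a ⊗ₘ b)
      (O.map_comp (X := x.base) (Y := y.base) (Z := z.base) f.base g.base) ?_).trans
      (tensorHom_comp_tensorHom _ _ _ _).symm
    refine Eq.trans ?_ (tensMap_comp (X := fun s => F.obj (x.fam s))
      (Y := fun s => F.obj (y.fam s)) (Z := fun s => F.obj (z.fam s)) f.base g.base
      (fun s => F.map (f.fam s)) (fun s => F.map (g.fam s)))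
    exact congr_arg (tensMap (f.base.trans g.base)) (funext fun s => F.map_comp _ _)

/-- The natural transformation `Id ⊚ θ : O ⊚ F ⟶ O ⊚ G`. -/
noncomputable def circMap (O : FinBij ⥤ C) {F G : W ⥤ C} (θ : F ⟶ G) : circ O F ⟶ circ O G where
  app x := O.obj x.base ◁ tensMap (Equiv.refl _) fun s => θ.app (x.fam s)
  naturality x y f := by
    have h : tensMap (X := fun s => F.obj (x.fam s)) (Y := fun s => F.obj (y.fam s)) f.base
          (fun s => F.map (f.fam s)) ≫
        tensMap (Y := fun s => G.obj (y.fam s)) (Equiv.refl _) (fun s => θ.app (y.fam s)) =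
        tensMap (Y := fun s => G.obj (x.fam s)) (Equiv.refl _) (fun s => θ.app (x.fam s)) ≫
          tensMap (X := fun s => G.obj (x.fam s)) (Y := fun s => G.obj (y.fam s)) f.base
            (fun s => G.map (f.fam s)) := by
      refine (tensMap_comp (X := fun s => F.obj (x.fam s)) (Y := fun s => F.obj (y.fam s))
        (Z := fun s => G.obj (y.fam s)) f.base (Equiv.refl _) (fun s => F.map (f.fam s))
        (fun s => θ.app (y.fam s))).symm.trans (Eq.trans ?_
          (tensMap_comp (X := fun s => F.obj (x.fam s)) (Y := fun s => G.obj (x.fam s))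
            (Z := fun s => G.obj (y.fam s)) (Equiv.refl _) f.base (fun s => θ.app (x.fam s))
            (fun s => G.map (f.fam s))))
      exact congr_arg (tensMap f.base) (funext fun s => θ.naturality _)
    have h' : ∀ {a b c d : C} (i : O.obj x.base ⟶ O.obj y.base) (p : a ⟶ b) (q : b ⟶ c) (p' : a ⟶ d) (q' : d ⟶ c),
        p ≫ q = p' ≫ q' → (i ⊗ₘ p) ≫ (O.obj y.base ◁ q) = (O.obj x.base ◁ p') ≫ (i ⊗ₘ q') := by
      intro a b c d i p q p' q' h
      simp only [← id_tensorHom, tensorHom_comp_tensorHom, h, Category.id_comp, Category.comp_id]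
    exact h' _ _ _ _ _ h

/-- The natural transformation `(O ⊚ F) (γ² ≀ Id) ⟶ (O ⊚ O) ⊚ F ≅ O ⊚ (O ⊚ F)` induced by a
natural transformation `Δ : O γ² ⟶ O ⊚ O`. -/
noncomputable def cocompWreath {O : FinBij ⥤ C} (Δ : Wreath.total ⋙ O ⟶ circ O O) (F : W ⥤ C) :
    Wreath.flatten W ⋙ circ O F ⟶ circ O (circ O F) where
  app x :=
    (Δ.app ⟨x.base, fun s => (x.fam s).base⟩ ⊗ₘ 𝟙 (tens fun p : Σ s, (x.fam s).base.carrier => F.obj ((x.fam p.1).fam p.2))) ≫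
      (α_ _ _ _).hom ≫
      (O.obj x.base ◁ merge (fun s => O.obj (x.fam s).base)
        (fun s r => F.obj ((x.fam s).fam r)))
  naturality x y f := by
    have h' : ∀ {a a' b b' p p' q q' m m' : C} (i : a ⟶ a') (d : a ⟶ p ⊗ q) (d' : a' ⟶ p' ⊗ q') (j : p ⟶ p') (k : q ⟶ q') (t : b ⟶ b')
       (μ : q ⊗ b ⟶ m) (μ' : q' ⊗ b' ⟶ m') (l : m ⟶ m'), i ≫ d' = d ≫ (j ⊗ₘ k) → (k ⊗ₘ t) ≫ μ' = μ ≫ l →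
       (i ⊗ₘ t) ≫ ((d' ⊗ₘ 𝟙 b') ≫ (α_ _ _ _).hom ≫ (p' ◁ μ')) = ((d ⊗ₘ 𝟙 b) ≫ (α_ _ _ _).hom ≫ (p ◁ μ)) ≫ (j ⊗ₘ l) := by
      intro a a' b b' p p' q q' m m' i d d' j k t μ μ' l h₁ h₂
      simp only [tensorHom_comp_tensorHom_assoc, h₁, Category.comp_id, Category.assoc]
      have : (d ≫ (j ⊗ₘ k)) ⊗ₘ t = (d ⊗ₘ 𝟙 b) ≫ ((j ⊗ₘ k) ⊗ₘ t) := by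
        rw [tensorHom_comp_tensorHom, Category.id_comp]
      rw [this, Category.assoc, associator_naturality_assoc]
      simp only [← id_tensorHom, tensorHom_comp_tensorHom, h₂, Category.id_comp, Category.comp_id]
    exact h' _ _ _ _ _ _ _ _ _ (Δ.naturality (X := ⟨x.base, fun s => (x.fam s).base⟩)
      (Y := ⟨y.base, fun s => (y.fam s).base⟩) ⟨f.base, fun s => (f.fam s).base⟩)
      (merge_natural (P := fun s => O.obj (x.fam s).base) (P' := fun s => O.obj (y.fam s).base)
        (Q := fun s r => F.obj ((x.fam s).fam r)) (Q' := fun s r => F.obj ((y.fam s).fam r)) f.base (fun s => (f.fam s).base)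
        (fun s => O.map (X := (x.fam s).base) (Y := (y.fam (f.base s)).base) (f.fam s).base)
        (fun s r => F.map ((f.fam s).fam r)))

section Counit

variable [HasTerminal C]

variable (C) in
open Classical in
/-- The counit symmetric sequence: the unit object in arity one, the final object elsewhere. -/
noncomputable def unitSeq : FinBij ⥤ C where
  obj S := if Nat.card S.carrier = 1 then 𝟙_ C else ⊤_ C
  map f := eqToHom (by rw [Nat.card_congr f])
  map_id _ := rfl
  map_comp _ _ := (eqToHom_trans _ _).symm

/-- The morphism `O(⋆) ⟶ 1` given by `ε : O ⟶ unitSeq C`. -/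
noncomputable def counitPt {O : FinBij ⥤ C} (ε : O ⟶ unitSeq C) : O.obj ⟨PUnit⟩ ⟶ 𝟙_ C :=
  ε.app ⟨PUnit⟩ ≫ eqToHom (if_pos Nat.card_unique)

/-- The natural transformation `(O ⊚ F) s_0 ⟶ (unitSeq ⊚ F) s_0 ≅ F` induced by `ε`. -/
noncomputable def counitPoint {O : FinBij ⥤ C} (ε : O ⟶ unitSeq C) (F : W ⥤ C) :
    Wreath.point W ⋙ circ O F ⟶ F where
  app w := (counitPt ε ⊗ₘ tensPoint (F.obj w)) ≫ (λ_ (F.obj w)).hom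
  naturality w w' f := by
    have h' : ∀ {o a a' b b' : C} (i : o ⟶ o) (e : o ⟶ 𝟙_ C) (t : a ⟶ a') (p : a ⟶ b) (p' : a' ⟶ b') (g : b ⟶ b'),
      i = 𝟙 _ → t ≫ p' = p ≫ g → (i ⊗ₘ t) ≫ ((e ⊗ₘ p') ≫ (λ_ b').hom) = ((e ⊗ₘ p) ≫ (λ_ b).hom) ≫ g := by
      rintro o a a' b b' i e t p p' g rfl h
      simp only [tensorHom_comp_tensorHom_assoc, h, Category.assoc, Category.id_comp]
      simp [MonoidalCategory.tensorHom_def]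
    exact h' _ _ _ _ _ _ (O.map_id _) (tensPoint_natural (F.map f))

variable (C) in
/-- A counital cooperad: a symmetric sequence with a cocomposition and a counit.
* `coassoc`: the two composites `O γ³ ⟶ O ⊚ O ⊚ O`, through `(O ⊚ O) (γ² ≀ Id)` and through
  `(O ⊚ O) (Id ≀ γ²)`, agree; here `γ² (γ² ≀ Id)` and `γ² (Id ≀ γ²)` are identified through the
  bijection `∐_{(s, t)} U_{s, t} ≃ ∐_s ∐_t U_{s, t}`.
* `counit_left`: `O = O γ² s_0 ⟶ (O ⊚ O) s_0 ⟶ (unitSeq ⊚ O) s_0 = O` is the identity.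
* `counit_right`: `O = O γ² s_1 ⟶ (O ⊚ O) s_1 ⟶ (O ⊚ unitSeq) s_1 = O` is the identity, where
  `s_1 : Σ_* ⥤ Σ_* ≀ Σ_*` sends `S` to the family `{⋆}_{s ∈ S}`. -/
structure Cooperad where
  /-- the symmetric sequence -/
  obj : FinBij ⥤ C
  /-- the cocomposition -/
  cocomp : Wreath.total ⋙ obj ⟶ circ obj obj
  /-- the counit -/
  counit : obj ⟶ unitSeq C
  coassoc : ∀ x : Wreath (Wreath FinBij),
    cocomp.app ((Wreath.flatten FinBij).obj x) ≫ (cocompWreath cocomp obj).app x =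
      obj.map (X := Wreath.total.obj ((Wreath.flatten FinBij).obj x))
          (Y := Wreath.total.obj ((Wreath.map Wreath.total).obj x))
          (FinBij.homOf (Equiv.sigmaAssoc fun s t => ((x.fam s).fam t).carrier)) ≫
        cocomp.app ((Wreath.map Wreath.total).obj x) ≫ (circMap obj cocomp).app x
  counit_left : ∀ S : FinBij,
    obj.map (Y := Wreath.total.obj ((Wreath.point FinBij).obj S))
        (FinBij.homOf (Equiv.uniqueSigma fun _ : PUnit => S.carrier).symm) ≫
      cocomp.app ((Wreath.point FinBij).obj S) ≫ (counitPoint counit obj).app S = 𝟙 (obj.obj S)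
  counit_right : ∀ S : FinBij,
    obj.map (Y := Wreath.total.obj ⟨S, fun _ => ⟨PUnit⟩⟩)
        (FinBij.homOf (Equiv.sigmaPUnit S.carrier).symm) ≫
      cocomp.app ⟨S, fun _ => ⟨PUnit⟩⟩ ≫
      (obj.obj S ◁ (tensMap (Equiv.refl _) (fun _ => counitPt counit) ≫ tensUnit S.carrier)) ≫
      (ρ_ _).hom = 𝟙 (obj.obj S)

/-! ## Coalgebras -/

/-- The category `Σ_0` of empty sets. -/
abbrev Sigma0 := ObjectProperty.FullSubcategory fun S : FinBij => IsEmpty S.carrier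

/-- The empty set, as an object of `Σ_0`. -/
def empty : Sigma0 := ⟨⟨PEmpty⟩, inferInstance⟩

/-- A coalgebra over the cooperad `O`: an object `c` of `C`, viewed as a (constant) functor on
`Σ_0`, with a natural transformation `c γ̄² ⟶ O ⊚ c` of functors on `Σ_* ≀ Σ_0`.
* `coassoc`: the two composites `c γ̄³ ⟶ O ⊚ O ⊚ c`, through `(O ⊚ c) (γ² ≀ Id)` and through
  `(O ⊚ c) (Id ≀ γ̄²)`, agree.
* `counit`: `c = c γ̄² s_0 ⟶ (O ⊚ c) s_0 ⟶ (unitSeq ⊚ c) s_0 = c` is the identity. -/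
structure Coalgebra (O : Cooperad C) where
  /-- the underlying object -/
  obj : C
  /-- the comultiplication -/
  comul : (Functor.const (Wreath Sigma0)).obj obj ⟶ circ O.obj ((Functor.const Sigma0).obj obj)
  coassoc : ∀ x : Wreath (Wreath Sigma0),
    comul.app ((Wreath.flatten Sigma0).obj x) ≫
        (cocompWreath O.cocomp ((Functor.const Sigma0).obj obj)).app x =
      comul.app ((Wreath.map ((Functor.const (Wreath Sigma0)).obj empty)).obj x) ≫
        (circMap O.obj comul).app x
  counit : ∀ E : Sigma0,
    comul.app ((Wreath.point Sigma0).obj E) ≫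
      (counitPoint O.counit ((Functor.const Sigma0).obj obj)).app E = 𝟙 obj

/-! ## The cosimplicial complex of a coalgebra -/

/-- The category of leafless trees of level `n + 1` and their isomorphisms, equivalently of chains
`⋆ ← S_1 ← ⋯ ← S_n ← ∅` of finite sets and their isomorphisms:
`Σ_* ≀ (Σ_* ≀ ⋯ (Σ_* ≀ Σ_0))`, with `n` factors `Σ_*`. A leafless tree of level 1 is a single
vertex with an empty set of incoming edges; a leafless tree of level `n + 2` is given by the finite
set of the incoming edges of its lowest vertex and a leafless tree of level `n + 1` on each of
them. -/
def Level : ℕ → Cat.{0, 1}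
  | 0 => Cat.of Sigma0
  | n + 1 => Cat.of (Wreath (Level n))

/-- The face functor that forgets the vertices at height `i + 1`, i.e. deletes `S_{i + 1}` from
the chain `⋆ ← S_1 ← ⋯ ← S_{n + 1} ← ∅` by composing maps, for `0 ≤ i ≤ n`. -/
def face : ∀ n : ℕ, Fin (n + 1) → Level (n + 1) ⥤ Level n
  | 0, _ => (Functor.const (Wreath Sigma0)).obj empty
  | n + 1, ⟨0, _⟩ => Wreath.flatten (Level n)
  | n + 1, ⟨i + 1, h⟩ => Wreath.map (face n ⟨i, Nat.lt_of_succ_lt_succ h⟩)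

/-- The degeneracy functor that doubles the vertices at height `i`, i.e. replaces `S_i` by
`S_i ← S_i` in the chain `⋆ = S_0 ← S_1 ← ⋯ ← S_n ← ∅`, for `0 ≤ i ≤ n`. -/
def degen : ∀ n : ℕ, Fin (n + 1) → Level n ⥤ Level (n + 1)
  | 0, _ => Wreath.point Sigma0
  | n + 1, ⟨0, _⟩ => Wreath.point (Level (n + 1))
  | n + 1, ⟨i + 1, h⟩ => Wreath.map (degen n ⟨i, Nat.lt_of_succ_lt_succ h⟩)

/-- The functor `γ̄` to `Σ_0`, which forgets all vertices but the lowest one: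
`(⋆ ← S_1 ← ⋯ ← S_n ← ∅) ↦ (⋆ ← ∅)`. -/
def gam (n : ℕ) : Level n ⥤ Sigma0 := (Functor.const (Level n)).obj empty

instance essentiallySmall_sigma0 : EssentiallySmall.{0} Sigma0 := by
  rw [essentiallySmall_iff]
  refine ⟨?_, inferInstance⟩
  refine small_of_surjective (α := Unit) (f := fun _ => toSkeleton empty) fun x => ?_
  obtain ⟨y, rfl⟩ : ∃ y, toSkeleton y = x := ⟨_, Quotient.out_eq x⟩
  have := y.2
  exact ⟨(), congr_toSkeleton_of_iso (ObjectProperty.isoMk _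
    (X := empty) (Y := y)
    ⟨FinBij.homOf (S := ⟨PEmpty⟩) (T := y.1) (Equiv.equivOfIsEmpty _ _),
      FinBij.homOf (S := y.1) (T := ⟨PEmpty⟩) (Equiv.equivOfIsEmpty _ _),
      Equiv.ext fun s => PEmpty.elim s, Equiv.ext fun s => (y.2.false s).elim⟩)⟩

instance essentiallySmall_level (n : ℕ) : EssentiallySmall.{0} (Level n) := by
  induction n with
  | zero => exact essentiallySmall_sigma0
  | succ n ih => exact Wreath.essentiallySmall (Level n)

namespace Coalgebra

variable {O : Cooperad C} (c : Coalgebra O)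

/-- The functor `O ⊚ ⋯ ⊚ O ⊚ c` on leafless trees of level `n + 1`, with `n` factors `O`. -/
noncomputable def treeFunctor : ∀ n : ℕ, Level n ⥤ C
  | 0 => (Functor.const Sigma0).obj c.obj
  | n + 1 => circ O.obj (treeFunctor n)

/-- The natural transformation `(O^{⊚ n} ⊚ c) ∂_i ⟶ O^{⊚ (n + 1)} ⊚ c` that applies the
cocomposition to the `i`-th factor `O` (counted from `0`) if `i < n`, and the comultiplication to
`c` if `i = n`. -/
noncomputable def faceTrans : ∀ (n : ℕ) (i : Fin (n + 1)),
    face n i ⋙ c.treeFunctor n ⟶ c.treeFunctor (n + 1)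
  | 0, _ => c.comul
  | n + 1, ⟨0, _⟩ => cocompWreath O.cocomp (c.treeFunctor n)
  | n + 1, ⟨i + 1, h⟩ => circMap O.obj (faceTrans n ⟨i, Nat.lt_of_succ_lt_succ h⟩)

/-- The natural transformation `(O^{⊚ (n + 1)} ⊚ c) s_i ⟶ O^{⊚ n} ⊚ c` that applies the counit
to the `i`-th factor `O` (counted from `0`). -/
noncomputable def degenTrans : ∀ (n : ℕ) (i : Fin (n + 1)),
    degen n i ⋙ c.treeFunctor (n + 1) ⟶ c.treeFunctor n
  | 0, _ => counitPoint O.counit (c.treeFunctor 0)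
  | n + 1, ⟨0, _⟩ => counitPoint O.counit (c.treeFunctor (n + 1))
  | n + 1, ⟨i + 1, h⟩ => circMap O.obj (degenTrans n ⟨i, Nat.lt_of_succ_lt_succ h⟩)

end Coalgebra

end Counit

section Complex

variable {C : Type u} [Category.{v} C] [MonoidalCategory C] [SymmetricCategory C] [HasLimits C]

instance hasRightKan (n : ℕ) (F : Level n ⥤ C) : (gam n).HasPointwiseRightKanExtension F := by
  have : HasLimitsOfSize.{0, 0} C := hasLimitsOfSizeShrink.{0, 0, v, v} C
  intro E
  have := hasLimitsOfShape_of_essentiallySmall.{0} (StructuredArrow E (gam n)) C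
  infer_instance

namespace Coalgebra

variable {O : Cooperad C} (c : Coalgebra O)

/-- The right Kan extension of `O^{⊚ n} ⊚ c` along `γ̄`. -/
noncomputable def kan (n : ℕ) : Sigma0 ⥤ C := (gam n).rightKanExtension (c.treeFunctor n)

/-- The universal natural transformation of the right Kan extension. -/
noncomputable def proj (n : ℕ) : gam n ⋙ c.kan n ⟶ c.treeFunctor n :=
  (gam n).rightKanExtensionCounit (c.treeFunctor n)

instance isRightKan (n : ℕ) : (c.kan n).IsRightKanExtension (c.proj n) :=
  inferInstanceAs (((gam n).rightKanExtension (c.treeFunctor n)).IsRightKanExtension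
    ((gam n).rightKanExtensionCounit (c.treeFunctor n)))

/-- The universal property of the right Kan extension. -/
noncomputable def lift (n : ℕ) (B : Sigma0 ⥤ C) (β : gam n ⋙ B ⟶ c.treeFunctor n) :
    B ⟶ c.kan n :=
  (c.kan n).liftOfIsRightKanExtension (c.proj n) B β

/-- The object `O^{∘̂ n} ∘̂ c` of `C`: the value at `∅` of the right Kan extension. -/
noncomputable def term (n : ℕ) : C := (c.kan n).obj empty

/-- The coface `O^{∘̂ n} ∘̂ c ⟶ O^{∘̂ (n + 1)} ∘̂ c` induced by `faceTrans n i`; note that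
`γ̄ ∂_i = γ̄`. -/
noncomputable def coface (n : ℕ) (i : Fin (n + 1)) : c.term n ⟶ c.term (n + 1) :=
  (c.lift (n + 1) (c.kan n)
    (Functor.whiskerLeft (face n i) (c.proj n) ≫ c.faceTrans n i)).app empty

/-- The codegeneracy `O^{∘̂ (n + 1)} ∘̂ c ⟶ O^{∘̂ n} ∘̂ c` induced by `degenTrans n i`; note that
`γ̄ s_i = γ̄`. -/
noncomputable def codegen (n : ℕ) (i : Fin (n + 1)) : c.term (n + 1) ⟶ c.term n :=
  (c.lift n (c.kan (n + 1))
    (Functor.whiskerLeft (degen n i) (c.proj (n + 1)) ≫ c.degenTrans n i)).app empty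

/-- The map `Δ_c : c ⟶ O ∘̂ c` induced by the comultiplication. -/
noncomputable def coaug : c.obj ⟶ c.term 1 :=
  (c.lift 1 ((Functor.const Sigma0).obj c.obj) c.comul).app empty

/-- The map `O ∘̂ c ⟶ c` induced by the counit of `O`. -/
noncomputable def coaugRetract : c.term 1 ⟶ c.obj :=
  (c.proj 1).app ((Wreath.point Sigma0).obj empty) ≫ (c.degenTrans 0 0).app empty

end Coalgebra
end Complex
end Circ
end TreeCooperad

/-! Every identity is checked tree by tree and then carried through the universal property of the
right Kan extension. As `gam n` is constant, `c.term n` behaves like the limit of `c.treeFunctor n`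
over all leafless trees: the projections `termProj` are compatible with every morphism of trees
(`termProj_map`) and jointly monic (`term_hom_ext`). Two composites of cofaces and codegeneracies
therefore agree as soon as, at each tree, the corresponding composites of `faceTrans` and
`degenTrans` agree up to the action of some morphism of trees. This freedom is needed, since
forgetting vertices in two orders yields iterated disjoint unions that are bracketed differently. It
explains the clauses `∃ a` throughout.

At a tree, the argument is an induction on the height that strips off the outermost factor `O`. If
both operations take place above the root, the identity is that of the subtrees, tensored together
(`circ_square`, `circ_triangle`). If one takes place at the root and the other one further up, they
commute by naturality (`cocompWreath_natural`, `counitPoint_natural`). If they meet, the identity is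
an axiom of the cooperad or of the coalgebra, for the cooperad tensored with the remaining factors
(`cocompWreath_coassoc`, `cocompWreath_counit_left`, `cocompWreath_counit_right`). Adding these
factors requires associativity and unit laws for the reshuffling `merge`, which are instances of
symmetric monoidal coherence, in the form `Coh.unique`.

The identities hold for all the codegeneracies. The cosimplicial object uses those of positive
index; the one of index 0 is left over, and its identities are the extra codegeneracy. At the
bottom, `c.obj` is compared with `c.term 0`. The coaugmentation equalizes the first two cofaces
because the counit axiom lets it factor through the coface out of `c.term 0`.

To turn generators and relations into a functor on the simplex category, the category presented by
them is shown to be equivalent to it: fullness holds because faces and degeneracies generate, and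
faithfulness because the factorization into degeneracies followed by faces is determined by the
monotone map. -/

namespace TreeCooperad

open Word

/-! ### Morphisms that are coherence isomorphisms relative to formal products -/

namespace Word

variable {U V : Type}

theorem flat_mul (a b : Word U) : (mul a b).flat [] = a.flat [] ++ b.flat [] := by
  rw [flat, flat_append]

/-- Structure isomorphisms only permute the factors, so absence of repetitions passes from the
source to the target, where the coherence theorem asks for it. -/
theorem FHom.perm {e e' : Word U} (f : FHom e e') : (e.flat []).Perm (e'.flat []) := by
  induction f with
  | id e => exact .refl _
  | comp f g hf hg => exact hf.trans hg
  | tensor f g hf hg => rw [flat_mul, flat_mul]; exact hf.append hg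
  | assoc a b c => exact .refl _
  | assocInv a b c => exact .refl _
  | leftU a => exact .refl _
  | leftUInv a => exact .refl _
  | rightU a => exact .refl _
  | rightUInv a => exact .refl _
  | braid a b => rw [flat_mul, flat_mul]; exact List.perm_append_comm

variable {C : Type u} [Category.{v} C] [MonoidalCategory C] [SymmetricCategory C]

/-- With the objects `A` and `B` identified with formal products of objects `Z u` through `a` and
`b`, the morphism `m : A ⟶ B` is a composite of structure isomorphisms. -/
def Coh {Z : U → C} {A B : C} {e e' : Word U} (a : A ⟶ e.ev Z) (b : B ⟶ e'.ev Z) (m : A ⟶ B) :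
    Prop :=
  ∃ f : FHom e e', m ≫ b = a ≫ f.interp Z

namespace Coh

variable {Z : U → C}

/-- The form in which coherence is applied: to prove an equality of reshufflings, name all the
factors by distinct letters and show that each side is built from structure isomorphisms. The
closure properties that follow do the latter mechanically. -/
theorem unique {A B : C} {e e' : Word U} {a : A ⟶ e.ev Z} {b : B ⟶ e'.ev Z} [Mono b]
    {m m' : A ⟶ B} (h : Coh a b m) (h' : Coh a b m') (he : (e.flat []).Nodup) : m = m' := by
  obtain ⟨f, hf⟩ := h
  obtain ⟨f', hf'⟩ := h'
  rw [← cancel_mono b, hf, hf', f.coherence Z (f.perm.nodup_iff.1 he) f']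

theorem id {A : C} {e : Word U} (a : A ⟶ e.ev Z) : Coh a a (𝟙 A) :=
  ⟨.id _, (Category.id_comp _).trans (Category.comp_id _).symm⟩

theorem comp {A B D : C} {e e' e'' : Word U} {a : A ⟶ e.ev Z} {b : B ⟶ e'.ev Z}
    {d : D ⟶ e''.ev Z} {m : A ⟶ B} {m' : B ⟶ D} (h : Coh a b m) (h' : Coh b d m') :
    Coh a d (m ≫ m') := by
  obtain ⟨f, hf⟩ := h
  obtain ⟨f', hf'⟩ := h'
  refine ⟨f.comp f', ?_⟩
  rw [Category.assoc, hf', reassoc_of% hf]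
  rfl

/-- The identification with a formal product of a tensor product of two factors. -/
def pair {A B : C} {e e' : Word U} (a : A ⟶ e.ev Z) (b : B ⟶ e'.ev Z) :
    A ⊗ B ⟶ (mul e e').ev Z :=
  a ⊗ₘ b

theorem tensor {A B A' B' : C} {e e' k k' : Word U} {a : A ⟶ e.ev Z} {b : B ⟶ e'.ev Z}
    {a' : A' ⟶ k.ev Z} {b' : B' ⟶ k'.ev Z} {m : A ⟶ A'} {n : B ⟶ B'} (h : Coh a a' m)
    (h' : Coh b b' n) : Coh (pair a b) (pair a' b') (m ⊗ₘ n) := by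
  obtain ⟨f, hf⟩ := h
  obtain ⟨f', hf'⟩ := h'
  refine ⟨f.tensor f', ?_⟩
  exact (tensorHom_comp_tensorHom _ _ _ _).trans
    ((congr_arg₂ (fun x y => x ⊗ₘ y) hf hf').trans (tensorHom_comp_tensorHom _ _ _ _).symm)

theorem assoc {A B D : C} {e e' e'' : Word U} (a : A ⟶ e.ev Z) (b : B ⟶ e'.ev Z)
    (d : D ⟶ e''.ev Z) : Coh (pair (pair a b) d) (pair a (pair b d)) (α_ A B D).hom :=
  ⟨.assoc _ _ _, (associator_naturality _ _ _).symm⟩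

theorem leftU {A : C} {e : Word U} (a : A ⟶ e.ev Z) :
    Coh (pair (e := one) (𝟙 (𝟙_ C)) a) a (λ_ A).hom := by
  refine ⟨.leftU _, ?_⟩
  have := leftUnitor_naturality a
  rw [← id_tensorHom] at this
  exact this.symm

variable {S T : Type} [Finite S] [Finite T]

/-- The identification with a formal product of the tensor product of a family. -/
noncomputable def fam {X : S → C} {k : S → Word U} (a : ∀ s, X s ⟶ (k s).ev Z) :
    tens X ⟶ ((std S).bind k).ev Z :=
  evBind k a (std S)

instance fam_isIso {X : S → C} {k : S → Word U} (a : ∀ s, X s ⟶ (k s).ev Z) [∀ s, IsIso (a s)] :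
    IsIso (fam a) :=
  evBind_isIso k a (std S)

instance pair_isIso {A B : C} {e e' : Word U} (a : A ⟶ e.ev Z) (b : B ⟶ e'.ev Z) [IsIso a]
    [IsIso b] : IsIso (pair a b) :=
  inferInstanceAs (IsIso (a ⊗ₘ b))

theorem tensMap {X : S → C} {Y : T → C} {k : S → Word U} {l : T → Word U}
    {a : ∀ s, X s ⟶ (k s).ev Z} {b : ∀ t, Y t ⟶ (l t).ev Z} (σ : S ≃ T)
    {φ : ∀ s, X s ⟶ Y (σ s)} (h : ∀ s, Coh (a s) (b (σ s)) (φ s)) :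
    Coh (fam a) (fam b) (TreeCooperad.tensMap σ φ) :=
  ((tensMap_rep σ φ).comp (Rep.evBind l b (std T))).congr fun s => h s

/-- By construction `merge` is a coherence isomorphism in the letters of `mergeFam`. When its
factors are themselves formal products in `Z`, substituting these products for the letters leaves it
one. -/
theorem merge {P : S → C} {R : S → Type} [∀ s, Finite (R s)] {Q : ∀ s, R s → C}
    {k : S → Word U} {l : ∀ s, R s → Word U} (p : ∀ s, P s ⟶ (k s).ev Z)
    (q : ∀ s r, Q s r ⟶ (l s r).ev Z) :
    Coh (pair (fam p) (fam (X := fun x : Σ s, R s => Q x.1 x.2) (k := fun x => l x.1 x.2)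
        fun x => q x.1 x.2)) (fam fun s => pair (p s) (fam (q s)))
      (TreeCooperad.merge P Q) := by
  -- The substitution: each letter of `mergeFam` is replaced by the word in `Z` that its factor is
  -- identified with.
  let K : S ⊕ (Σ s, R s) → Word U
    | .inl s => k s
    | .inr x => l x.1 x.2
  let z : ∀ u, mergeFam P Q u ⟶ (K u).ev Z
    | .inl s => p s
    | .inr x => q x.1 x.2
  obtain ⟨f₁, h₁⟩ := evBind_evBind (X := P) (Y := mergeFam P Q) (fun s => of (.inl s))
    (fun s => 𝟙 (P s)) K z (std S)
  obtain ⟨f₂, h₂⟩ := evBind_evBind (X := fun x : Σ s, R s => Q x.1 x.2) (Y := mergeFam P Q)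
    (fun x => of (.inr x)) (fun x => 𝟙 (Q x.1 x.2)) K z (std _)
  have h₃ : ∀ s, ∃ f : FHom (mul (k s) ((std (R s)).bind (l s))) ((mergeTgt S R s).bind K),
      splitFib P Q s ≫ evBind K z (mergeTgt S R s) = pair (p s) (fam (q s)) ≫ f.interp Z := by
    intro s
    obtain ⟨f, h⟩ := evBind_evBind (X := Q s) (Y := mergeFam P Q) (fun r => of (.inr ⟨s, r⟩))
      (fun r => 𝟙 (Q s r)) K z (std (R s))
    refine ⟨.tensor (.id _) f, ?_⟩
    have h' : evBind (fun r => l s r) (fun r => 𝟙 (Q s r) ≫ q s r) (std (R s)) = fam (q s) := by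
      simp only [Category.id_comp]; rfl
    refine (tensorHom_comp_tensorHom _ _ _ _).trans (Eq.trans ?_
      (tensorHom_comp_tensorHom _ _ _ _).symm)
    exact congr_arg₂ (fun x y => x ⊗ₘ y) ((Category.id_comp _).trans (Category.comp_id _).symm)
      (h.trans (congr_arg (· ≫ _) h'))
  choose f₃ h₃ using h₃
  obtain ⟨f₄, h₄⟩ := evBind_evBind (mergeTgt S R) (splitFib P Q) K z (std S)
  obtain ⟨f₅, h₅⟩ := evBind_congr (fun s => mul (k s) ((std (R s)).bind (l s)))
    (fun s => (mergeTgt S R s).bind K) (fun s => pair (p s) (fam (q s)))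
    (fun s => splitFib P Q s ≫ evBind K z (mergeTgt S R s)) f₃ h₃ (std S)
  -- The definition of `merge` ends with the inverse of `splitTgt`, so the comparison on the target
  -- side enters inverted.
  obtain ⟨g, hg⟩ := (f₅.comp f₄).exists_inv Z
  let c : FHom (mergeSrc S R) ((std S).bind (mergeTgt S R)) :=
    Classical.choice (FHom.exists_of_perm ((mergeSrc_full S R).perm (mergeTgt_full S R)))
  have h₆ : splitTgt P Q ≫ evBind K z _ =
      fam (fun s => pair (p s) (fam (q s))) ≫ (f₅.comp f₄).interp Z :=
    h₄.trans ((congr_arg (· ≫ _) h₅).trans (Category.assoc _ _ _))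
  have h₇ : splitSrc P Q ≫ evBind K z (mergeSrc S R) =
      pair (fam p) (fam (X := fun x : Σ s, R s => Q x.1 x.2) (k := fun x => l x.1 x.2)
        fun x => q x.1 x.2) ≫ (FHom.tensor f₁ f₂).interp Z := by
    refine (tensorHom_comp_tensorHom _ _ _ _).trans (Eq.trans ?_
      (tensorHom_comp_tensorHom _ _ _ _).symm)
    refine congr_arg₂ (fun x y => x ⊗ₘ y) (h₁.trans (congr_arg (· ≫ _) ?_))
      (h₂.trans (congr_arg (· ≫ _) ?_))
    · exact congr_arg (fun a => evBind k a (std S)) (funext fun s => Category.id_comp _)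
    · exact congr_arg (fun a => evBind (X := fun x : Σ s, R s => Q x.1 x.2)
        (fun x : Σ s, R s => l x.1 x.2) a (std _)) (funext fun s => Category.id_comp _)
  refine ⟨.comp (FHom.tensor f₁ f₂) ((c.bind K).comp g), ?_⟩
  -- The diagram chase, with arbitrary objects in place of the evaluated words.
  have aux : ∀ {A M N B D E F G : C} (s : A ⟶ M) (i : M ⟶ N) (t : B ⟶ N) [IsIso t] (b : B ⟶ D)
      (y : D ⟶ E) (y' : E ⟶ D) (n : N ⟶ E) (m : M ⟶ F) (j : F ⟶ E) (a : A ⟶ G) (x : G ⟶ F),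
      y ≫ y' = 𝟙 _ → t ≫ n = b ≫ y → i ≫ n = m ≫ j → s ≫ m = a ≫ x →
      (s ≫ i ≫ inv t) ≫ b = a ≫ x ≫ j ≫ y' := by
    intro A M N B D E F G s i t _ b y y' n m j a x hy ht hi hs
    have hb : inv t ≫ b = n ≫ y' := by
      rw [IsIso.inv_comp_eq, reassoc_of% ht, hy, Category.comp_id]
    rw [← reassoc_of% hs, ← reassoc_of% hi]
    simp only [Category.assoc, hb]
  exact aux _ _ _ _ _ _ _ _ _ _ _ hg h₆ (interp_evBind K z c) h₇

theorem tensPoint {X : C} {e : Word U} (a : X ⟶ e.ev Z) :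
    Coh (fam fun _ : PUnit => a) a (TreeCooperad.tensPoint X) :=
  ⟨_, interp_evBind (X := fun _ : PUnit => X) (Y := Z) (fun _ => e) (fun _ => a)
    (Classical.choice (FHom.exists_of_perm
    ((std_full PUnit).perm (e' := of PUnit.unit) ⟨by simp [flat], fun s => by simp [flat]⟩)))⟩

/-- `tensUnit` is a coherence isomorphism over the empty alphabet, and the empty substitution
carries it to any alphabet. -/
theorem tensUnit (Z : U → C) (S : Type) [Finite S] :
    Coh (Z := Z) (fam (X := fun _ : S => 𝟙_ C) (k := fun _ => one) fun _ => 𝟙 (𝟙_ C))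
      (e' := one) (𝟙 (𝟙_ C)) (TreeCooperad.tensUnit S) := by
  obtain ⟨f, hf⟩ := evBind_evBind (X := fun _ : S => 𝟙_ C) (Y := fun x : PEmpty => x.elim)
    (Z := Z) (fun _ => one) (fun _ => 𝟙 (𝟙_ C)) (fun x => x.elim) (fun x => x.elim) (std S)
  let c : FHom ((std S).bind fun _ => (one : Word PEmpty)) one :=
    Classical.choice (FHom.exists_of_perm (by rw [flat_bind]; simp [flat]))
  have h := interp_evBind (X := fun x : PEmpty => x.elim) (Y := Z) (fun x => x.elim)
    (fun x => x.elim) c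
  refine ⟨f.comp (c.bind _), ?_⟩
  have h' : evBind (X := fun _ : S => 𝟙_ C) (Y := Z) (fun _ => one)
      (fun _ => 𝟙 (𝟙_ C) ≫ 𝟙 (𝟙_ C)) (std S) =
      fam (X := fun _ : S => 𝟙_ C) (k := fun _ => one) fun _ => 𝟙 (𝟙_ C) :=
    congr_arg (fun a => evBind (X := fun _ : S => 𝟙_ C) (Y := Z) (fun _ => one) a (std S))
      (funext fun _ => Category.comp_id _)
  have aux : ∀ {A B D E F G : C} (x : A ⟶ B) (c : B ⟶ D) (w : D ⟶ E) (y : B ⟶ F) (d : F ⟶ E)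
      (z : A ⟶ G) (f : G ⟶ F), c ≫ w = y ≫ d → x ≫ y = z ≫ f → (x ≫ c) ≫ w = z ≫ f ≫ d := by
    intro A B D E F G x c w y d z f h₁ h₂
    rw [Category.assoc, h₁, reassoc_of% h₂]
  exact aux _ _ _ _ _ _ _ h (hf.trans (congr_arg (· ≫ _) h'))

end Coh
end Word
end TreeCooperad

/-! ### Associativity and unit laws of `merge` -/

namespace TreeCooperad

open Word

variable {C : Type u} [Category.{v} C] [MonoidalCategory C] [SymmetricCategory C]

namespace Word.Coh

theorem whiskerLeft {U : Type} {Z : U → C} {A B B' : C} {e e' k' : Word U} (a : A ⟶ e.ev Z)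
    {b : B ⟶ e'.ev Z} {b' : B' ⟶ k'.ev Z} {n : B ⟶ B'} (h : Coh b b' n) :
    Coh (pair a b) (pair a b') (A ◁ n) :=
  id_tensorHom A n ▸ (Coh.id a).tensor h

end Word.Coh

theorem nodup_flat_sum {S T U : Type} (e : Word S) (e' : Word T) (he : (e.flat []).Nodup)
    (he' : (e'.flat []).Nodup) (f : S → U) (g : T → U) (hf : f.Injective) (hg : g.Injective)
    (h : ∀ s t, f s ≠ g t) :
    ((mul (e.bind fun s => of (f s)) (e'.bind fun t => of (g t))).flat []).Nodup := by
  rw [flat_mul, flat_bind_of, flat_bind_of, List.nodup_append]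
  refine ⟨he.map hf, he'.map hg, fun a ha b hb => ?_⟩
  obtain ⟨s, -, rfl⟩ := List.mem_map.1 ha
  obtain ⟨t, -, rfl⟩ := List.mem_map.1 hb
  exact h s t

/-- The identification of an object with a formal product with one factor. -/
def leaf {U : Type} (Z : U → C) (u : U) : Z u ⟶ (of u).ev Z := 𝟙 (Z u)

instance {U : Type} (Z : U → C) (u : U) : IsIso (leaf Z u) := inferInstanceAs (IsIso (𝟙 (Z u)))

section

variable {I : Type} [Finite I] {J : I → Type} [∀ i, Finite (J i)] {K : ∀ i, J i → Type}
  [∀ i j, Finite (K i j)]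

/-- The coherence isomorphisms `merge` are associative. -/
theorem merge_merge (P : I → C) (P' : ∀ i, J i → C) (Q : ∀ i j, K i j → C) :
    (α_ (tens P) (tens fun p : Σ i, J i => P' p.1 p.2)
        (tens fun x : Σ p : (Σ i, J i), K p.1 p.2 => Q x.1.1 x.1.2 x.2)).hom ≫
      (tens P ◁ merge (fun p : Σ i, J i => P' p.1 p.2) (fun p k => Q p.1 p.2 k)) ≫
      merge P (fun i j => P' i j ⊗ tens (Q i j)) =
    (merge P P' ⊗ₘ tensMap (X := fun x : Σ p : (Σ i, J i), K p.1 p.2 => Q x.1.1 x.1.2 x.2)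
        (Y := fun x : Σ i, Σ j, K i j => Q x.1 x.2.1 x.2.2)
        (Equiv.sigmaAssoc K) (fun _ => 𝟙 _)) ≫
      merge (R := fun i => Σ j, K i j) (fun i => P i ⊗ tens (P' i)) (fun i x => Q i x.1 x.2) ≫
      tensMap (X := fun i => (P i ⊗ tens (P' i)) ⊗ tens fun x : Σ j, K i j => Q i x.1 x.2)
        (Y := fun i => P i ⊗ tens fun j => P' i j ⊗ tens (Q i j))
        (Equiv.refl I) (fun i => (α_ _ _ _).hom ≫ (P i ◁ merge (P' i) (Q i))) := by
  -- One letter for each factor `P i`, `P' i j` and `Q i j k`, so that the source word has no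
  -- repetitions.
  let Z : I ⊕ ((Σ i, J i) ⊕ (Σ p : (Σ i, J i), K p.1 p.2)) → C
    | .inl i => P i
    | .inr (.inl p) => P' p.1 p.2
    | .inr (.inr x) => Q x.1.1 x.1.2 x.2
  let a : ∀ i, P i ⟶ (of (.inl i)).ev Z := fun i => leaf Z (.inl i)
  let b : ∀ i j, P' i j ⟶ (of (.inr (.inl ⟨i, j⟩))).ev Z := fun i j => leaf Z (.inr (.inl ⟨i, j⟩))
  let d : ∀ i j k, Q i j k ⟶ (of (.inr (.inr ⟨⟨i, j⟩, k⟩))).ev Z := fun i j k =>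
    leaf Z (.inr (.inr ⟨⟨i, j⟩, k⟩))
  have ha : ∀ i, IsIso (a i) := fun i => inferInstanceAs (IsIso (leaf Z _))
  have hb : ∀ i j, IsIso (b i j) := fun i j => inferInstanceAs (IsIso (leaf Z _))
  have hd : ∀ i j k, IsIso (d i j k) := fun i j k => inferInstanceAs (IsIso (leaf Z _))
  let a' := Coh.fam a
  let b' := Coh.fam (X := fun p : Σ i, J i => P' p.1 p.2) fun p => b p.1 p.2
  let d' := Coh.fam (X := fun x : Σ p : (Σ i, J i), K p.1 p.2 => Q x.1.1 x.1.2 x.2)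
    fun x => d x.1.1 x.1.2 x.2
  let t := Coh.fam fun i => Coh.pair (a i) (Coh.fam fun j => Coh.pair (b i j) (Coh.fam (d i j)))
  have ht : IsIso t := inferInstance
  refine Coh.unique (a := Coh.pair (Coh.pair a' b') d') (b := t) ?_ ?_ ?_
  · exact (Coh.assoc a' b' d').comp ((Coh.whiskerLeft a' (Coh.merge
      (P := fun p : Σ i, J i => P' p.1 p.2) (Q := fun p k => Q p.1 p.2 k)
      (fun p : Σ i, J i => b p.1 p.2) (fun p k => d p.1 p.2 k))).comp
      (Coh.merge a fun i j => Coh.pair (b i j) (Coh.fam (d i j))))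
  · exact ((Coh.merge a b).tensor (Coh.tensMap
      (X := fun x : Σ p : (Σ i, J i), K p.1 p.2 => Q x.1.1 x.1.2 x.2)
      (Y := fun x : Σ i, Σ j, K i j => Q x.1 x.2.1 x.2.2)
      (a := fun x => d x.1.1 x.1.2 x.2) (b := fun x => d x.1 x.2.1 x.2.2)
      (Equiv.sigmaAssoc K) (fun x => Coh.id (d x.1.1 x.1.2 x.2)))).comp
      ((Coh.merge (R := fun i => Σ j, K i j) (Q := fun i x => Q i x.1 x.2)
        (fun i => Coh.pair (a i) (Coh.fam (b i)))
        (fun i x => d i x.1 x.2)).comp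
      (Coh.tensMap (X := fun i => (P i ⊗ tens (P' i)) ⊗ tens fun x : Σ j, K i j => Q i x.1 x.2)
        (Y := fun i => P i ⊗ tens fun j => P' i j ⊗ tens (Q i j)) (Equiv.refl I) (fun i =>
        (Coh.assoc (a i) (Coh.fam (b i))
          (Coh.fam (X := fun x : Σ j, K i j => Q i x.1 x.2) fun x => d i x.1 x.2)).comp
          (Coh.whiskerLeft (a i) (Coh.merge (b i) (d i))))))
  · rw [flat_mul, List.nodup_append]
    refine ⟨?_, ?_, ?_⟩
    · exact nodup_flat_sum _ _ (std_full _).1 (std_full _).1 Sum.inl (Sum.inr ∘ Sum.inl)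
        Sum.inl_injective (Sum.inr_injective.comp Sum.inl_injective) (by simp)
    · rw [flat_bind_of]
      exact (std_full _).1.map (Sum.inr_injective.comp Sum.inr_injective)
    · rw [flat_mul, flat_bind_of, flat_bind_of, flat_bind_of]
      rintro x hx y hy rfl
      simp at hx hy
      grind

end

/-- `merge` for a family indexed by one point. -/
theorem merge_tensPoint {R : Type} [Finite R] (P : C) (Q : R → C) :
    merge (fun _ : PUnit => P) (fun _ => Q) ≫ tensPoint (P ⊗ tens Q) =
      tensPoint P ⊗ₘ tensMap (X := fun x : Σ _ : PUnit, R => Q x.2) (Y := Q)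
        (Equiv.uniqueSigma fun _ : PUnit => R) (fun _ => 𝟙 _) := by
  let Z : PUnit ⊕ R → C
    | .inl _ => P
    | .inr r => Q r
  let a : P ⟶ (of (.inl PUnit.unit)).ev Z := leaf Z (.inl PUnit.unit)
  let b : ∀ r, Q r ⟶ (of (.inr r)).ev Z := fun r => leaf Z (.inr r)
  have ha : IsIso a := inferInstanceAs (IsIso (leaf Z _))
  have hb : ∀ r, IsIso (b r) := fun r => inferInstanceAs (IsIso (leaf Z _))
  refine Coh.unique (a := Coh.pair (Coh.fam (X := fun _ : PUnit => P) fun _ => a)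
      (Coh.fam (X := fun x : Σ _ : PUnit, R => Q x.2) fun x => b x.2))
    (b := Coh.pair a (Coh.fam b)) ?_ ?_ ?_
  · exact (Coh.merge (fun _ => a) (fun _ => b)).comp (Coh.tensPoint (Coh.pair a (Coh.fam b)))
  · exact (Coh.tensPoint a).tensor (Coh.tensMap (X := fun x : Σ _ : PUnit, R => Q x.2) (Y := Q)
      (a := fun x => b x.2) (b := b) (Equiv.uniqueSigma fun _ : PUnit => R)
      (fun x => Coh.id (b x.2)))
  · exact nodup_flat_sum _ _ (std_full _).1 (std_full _).1 Sum.inl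
      (fun x : Σ _ : PUnit, R => Sum.inr x.2)
      Sum.inl_injective (fun x y h => by cases x; cases y; simp_all) (by simp)

/-- `merge` for families indexed by one point. -/
theorem merge_unit {S : Type} [Finite S] (Q : S → C) :
    merge (R := fun _ => PUnit) (fun _ : S => 𝟙_ C) (fun s _ => Q s) ≫
      tensMap (X := fun s => 𝟙_ C ⊗ tens fun _ : PUnit => Q s) (Y := Q) (Equiv.refl S)
        (fun s => (𝟙 _ ⊗ₘ tensPoint (Q s)) ≫ (λ_ (Q s)).hom) =
    (tensUnit S ⊗ₘ tensMap (X := fun x : Σ _ : S, PUnit => Q x.1) (Y := Q)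
      (Equiv.sigmaPUnit S) (fun _ => 𝟙 _)) ≫ (λ_ (tens Q)).hom := by
  -- Only the factors `Q s` receive letters; the unit objects are evaluations of the empty word.
  -- This is what allows `tensUnit` and the left unitor to count as coherence.
  let b : ∀ s, Q s ⟶ (of s).ev Q := leaf Q
  let a : 𝟙_ C ⟶ one.ev Q := 𝟙 (𝟙_ C)
  have hb : ∀ s, IsIso (b s) := fun s => inferInstanceAs (IsIso (leaf Q _))
  refine Coh.unique (a := Coh.pair (Coh.fam (X := fun _ : S => 𝟙_ C) fun _ => a)
      (Coh.fam (X := fun x : Σ _ : S, PUnit => Q x.1) fun x => b x.1))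
    (b := Coh.fam b) ?_ ?_ ?_
  · exact (Coh.merge (fun _ => a) (fun s _ => b s)).comp (Coh.tensMap (Equiv.refl S) fun s =>
      ((Coh.id a).tensor (Coh.tensPoint (b s))).comp (Coh.leftU (b s)))
  · exact ((Coh.tensUnit Q S).tensor (Coh.tensMap (X := fun x : Σ _ : S, PUnit => Q x.1) (Y := Q)
      (a := fun x => b x.1) (b := b) (Equiv.sigmaPUnit S)
      (fun x => Coh.id (b x.1)))).comp (Coh.leftU (Coh.fam b))
  · rw [flat_mul, flat_bind_of, flat_bind]
    have : ((std S).flat []).flatMap (fun _ => (one : Word S).flat []) = [] := by simp [flat]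
    rw [this]
    exact (std_full _).1.map fun x y h => by cases x; cases y; simp_all

end TreeCooperad

/-! ### Cooperad axioms tensored with further factors -/

namespace TreeCooperad

open Word

variable {C : Type u} [Category.{v} C] [MonoidalCategory C]

/-- The monoidal skeleton of `distrib_assoc`, with the unordered products replaced by arbitrary
objects: `h₁` plays the coassociativity of a cooperad, `h₂` the naturality of `merge` and `h₃` its
associativity. -/
theorem distrib_assoc_aux {A A' B D P P' M Q Q' N E R X X' : C} (d : A ⟶ B ⊗ P')
    (d' : B ⟶ D ⊗ P) (m : P ⊗ P' ⟶ M) (m₁ : P' ⊗ Q ⟶ N) (m₂ : P ⊗ N ⟶ E) (g : A ⟶ A')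
    (e : A' ⟶ D ⊗ R) (f : R ⟶ M) (σ : Q ⟶ Q') (m₃ : R ⊗ Q' ⟶ X) (t : X ⟶ E)
    (m₄ : M ⊗ Q' ⟶ X') (t' : X' ⟶ E)
    (h₁ : d ≫ (d' ⊗ₘ 𝟙 P') ≫ (α_ D P P').hom ≫ (D ◁ m) = g ≫ e ≫ (D ◁ f))
    (h₂ : m₃ ≫ t = (f ⊗ₘ 𝟙 Q') ≫ m₄ ≫ t')
    (h₃ : (α_ P P' Q).hom ≫ (P ◁ m₁) ≫ m₂ = (m ⊗ₘ σ) ≫ m₄ ≫ t') :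
    ((d ⊗ₘ 𝟙 Q) ≫ (α_ B P' Q).hom ≫ (B ◁ m₁)) ≫ ((d' ⊗ₘ 𝟙 N) ≫ (α_ D P N).hom ≫ (D ◁ m₂)) =
      (g ⊗ₘ σ) ≫ ((e ⊗ₘ 𝟙 Q') ≫ (α_ D R Q').hom ≫ (D ◁ m₃)) ≫ (D ◁ t) := by
  -- Moving `f` ahead of the reshuffling collects `g ≫ e ≫ (D ◁ f)`, the right-hand side of `h₁`.
  have hr : (g ⊗ₘ σ) ≫ ((e ⊗ₘ 𝟙 Q') ≫ (α_ D R Q').hom ≫ (D ◁ m₃)) ≫ (D ◁ t) =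
      ((g ≫ e ≫ (D ◁ f)) ▷ Q) ≫ (_ ◁ σ) ≫ (α_ D M Q').hom ≫ (D ◁ (m₄ ≫ t')) := by
    simp only [Category.assoc, ← MonoidalCategory.whiskerLeft_comp, h₂]
    simp only [MonoidalCategory.whiskerLeft_comp, comp_whiskerRight, Category.assoc,
      MonoidalCategory.tensorHom_def]
    simp only [← whisker_exchange_assoc]
    simp
  have hl : (m ⊗ₘ σ) = (m ▷ Q) ≫ (M ◁ σ) := MonoidalCategory.tensorHom_def _ _
  rw [hl] at h₃
  rw [hr, ← h₁]
  have h₄ := congr_arg (fun k => (d ▷ Q) ≫ ((d' ▷ P') ▷ Q) ≫ ((α_ D P P').hom ▷ Q) ≫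
    (α_ D (P ⊗ P') Q).hom ≫ (D ◁ k)) h₃
  simp only [MonoidalCategory.whiskerLeft_comp, Category.assoc, tensorHom_id,
    comp_whiskerRight] at h₄ ⊢
  have h₅ : ((D ◁ m) ▷ Q) ≫ ((D ⊗ M) ◁ σ) ≫ (α_ D M Q').hom =
      (α_ D (P ⊗ P') Q).hom ≫ (D ◁ (m ▷ Q)) ≫ (D ◁ (M ◁ σ)) := by
    simp
  rw [reassoc_of% h₅, ← h₄]
  simp [whisker_exchange_assoc]

variable [SymmetricCategory C]

theorem tensMap_comp_refl {S : Type} [Finite S] {X Y Z : S → C} (φ : ∀ s, X s ⟶ Y s)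
    (ψ : ∀ s, Y s ⟶ Z s) :
    tensMap (Y := Z) (Equiv.refl S) (fun s => φ s ≫ ψ s) =
      tensMap (Y := Y) (Equiv.refl S) φ ≫ tensMap (Y := Z) (Equiv.refl S) ψ :=
  tensMap_comp (Equiv.refl S) (Equiv.refl S) φ ψ

theorem merge_natural_refl {S : Type} [Finite S] {R : S → Type} [∀ s, Finite (R s)]
    {P P' : S → C} {Q Q' : ∀ s, R s → C} (p : ∀ s, P s ⟶ P' s) (q : ∀ s r, Q s r ⟶ Q' s r) :
    (tensMap (Y := P') (Equiv.refl S) p ⊗ₘ tensMap (X := fun x : Σ s, R s => Q x.1 x.2)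
      (Y := fun x : Σ s, R s => Q' x.1 x.2) (Equiv.refl _) (fun x => q x.1 x.2)) ≫ merge P' Q' =
    merge P Q ≫ tensMap (X := fun s => P s ⊗ tens (Q s)) (Y := fun s => P' s ⊗ tens (Q' s))
      (Equiv.refl S) (fun s => p s ⊗ₘ tensMap (Y := Q' s) (Equiv.refl (R s)) (q s)) :=
  merge_natural (Equiv.refl S) (fun s => Equiv.refl (R s)) p q

/-- Naturality of `merge` with identities on the factors `Q`; the identity of an unordered product
has to be rewritten as `tensMap` of identities. -/
theorem merge_natural_left {S : Type} [Finite S] {R : S → Type} [∀ s, Finite (R s)]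
    {P P' : S → C} (p : ∀ s, P s ⟶ P' s) (Q : ∀ s, R s → C) :
    (tensMap (Y := P') (Equiv.refl S) p ⊗ₘ 𝟙 (tens fun x : Σ s, R s => Q x.1 x.2)) ≫ merge P' Q =
    merge P Q ≫ tensMap (X := fun s => P s ⊗ tens (Q s)) (Y := fun s => P' s ⊗ tens (Q s))
      (Equiv.refl S) (fun s => p s ⊗ₘ 𝟙 (tens (Q s))) := by
  refine Eq.trans (congr_arg (fun k => (tensMap (Y := P') (Equiv.refl S) p ⊗ₘ k) ≫ merge P' Q)
    (tensMap_id _).symm) ((merge_natural_refl p fun s r => 𝟙 (Q s r)).trans ?_)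
  refine congr_arg (fun k => merge P Q ≫ tensMap (X := fun s => P s ⊗ tens (Q s))
    (Y := fun s => P' s ⊗ tens (Q s)) (Equiv.refl S) k) (funext fun s => ?_)
  exact congr_arg (fun k => p s ⊗ₘ k) (tensMap_id (Q s))

theorem merge_natural_right {S : Type} [Finite S] {R : S → Type} [∀ s, Finite (R s)]
    (P : S → C) {Q Q' : ∀ s, R s → C} (q : ∀ s r, Q s r ⟶ Q' s r) :
    (tens P ◁ tensMap (X := fun x : Σ s, R s => Q x.1 x.2)
      (Y := fun x : Σ s, R s => Q' x.1 x.2) (Equiv.refl _) (fun x => q x.1 x.2)) ≫ merge P Q' =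
    merge P Q ≫ tensMap (X := fun s => P s ⊗ tens (Q s)) (Y := fun s => P s ⊗ tens (Q' s))
      (Equiv.refl S) (fun s => P s ◁ tensMap (Y := Q' s) (Equiv.refl (R s)) (q s)) := by
  refine Eq.trans ?_ ((merge_natural_refl (fun s => 𝟙 (P s)) q).trans ?_)
  · exact congr_arg (· ≫ merge P Q') ((id_tensorHom _ _).symm.trans
      (congr_arg (fun k => k ⊗ₘ _) (tensMap_id P).symm))
  · refine congr_arg (fun k => merge P Q ≫ tensMap (X := fun s => P s ⊗ tens (Q s))
      (Y := fun s => P s ⊗ tens (Q' s)) (Equiv.refl S) k) (funext fun s => ?_)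
    exact id_tensorHom _ _

/-- The morphism `A ⊗ ⨂_{(s, r)} Q_{s, r} ⟶ B ⊗ ⨂_s (P_s ⊗ ⨂_r Q_{s, r})` induced by a morphism
`A ⟶ B ⊗ ⨂_s P_s`. -/
noncomputable def distrib {S : Type} [Finite S] {R : S → Type} [∀ s, Finite (R s)] {A B : C}
    {P : S → C} (d : A ⟶ B ⊗ tens P) (Q : ∀ s, R s → C) :
    A ⊗ tens (fun x : Σ s, R s => Q x.1 x.2) ⟶ B ⊗ tens (fun s => P s ⊗ tens (Q s)) :=
  (d ⊗ₘ 𝟙 (tens fun x : Σ s, R s => Q x.1 x.2)) ≫ (α_ _ _ _).hom ≫ (B ◁ merge P Q)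

/-- The morphisms `q` pass `d` because they act on another tensor factor, and pass `merge` by its
naturality. -/
theorem distrib_natural {S : Type} [Finite S] {R : S → Type} [∀ s, Finite (R s)] {A B : C}
    {P : S → C} (d : A ⟶ B ⊗ tens P) {Q Q' : ∀ s, R s → C} (q : ∀ s r, Q s r ⟶ Q' s r) :
    distrib d Q ≫ (B ◁ tensMap (X := fun s => P s ⊗ tens (Q s)) (Y := fun s => P s ⊗ tens (Q' s))
      (Equiv.refl S) fun s => P s ◁ tensMap (Y := Q' s) (Equiv.refl (R s)) (q s)) =
    (A ◁ tensMap (X := fun x : Σ s, R s => Q x.1 x.2) (Y := fun x : Σ s, R s => Q' x.1 x.2)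
      (Equiv.refl _) (fun x => q x.1 x.2)) ≫ distrib d Q' := by
  have aux : ∀ {T Q₁ Q₂ M M' : C} (d : A ⟶ B ⊗ T) (m : T ⊗ Q₁ ⟶ M) (m' : T ⊗ Q₂ ⟶ M')
      (σ : Q₁ ⟶ Q₂) (n : M ⟶ M'), (T ◁ σ) ≫ m' = m ≫ n →
      ((d ⊗ₘ 𝟙 Q₁) ≫ (α_ _ _ _).hom ≫ (B ◁ m)) ≫ (B ◁ n) =
        (A ◁ σ) ≫ (d ⊗ₘ 𝟙 Q₂) ≫ (α_ _ _ _).hom ≫ (B ◁ m') := by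
    intro T Q₁ Q₂ M M' d m m' σ n h
    simp only [Category.assoc, ← MonoidalCategory.whiskerLeft_comp, ← h, tensorHom_id]
    simp only [MonoidalCategory.whiskerLeft_comp]
    rw [← associator_naturality_right_assoc, ← whisker_exchange_assoc]
  exact aux d _ _ _ _ (merge_natural_right P q)

/-- Coassociativity of `distrib`. -/
theorem distrib_assoc {I : Type} [Finite I] {J : I → Type} [∀ i, Finite (J i)]
    {K : ∀ i, J i → Type} [∀ i j, Finite (K i j)] {A A' B D : C} {P R : I → C}
    {P' : ∀ i, J i → C} (d : A ⟶ B ⊗ tens (fun p : Σ i, J i => P' p.1 p.2))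
    (d' : B ⟶ D ⊗ tens P) (g : A ⟶ A') (e : A' ⟶ D ⊗ tens R)
    (f : ∀ i, R i ⟶ P i ⊗ tens (P' i)) (Q : ∀ i j, K i j → C)
    (h : d ≫ distrib d' P' = g ≫ e ≫
      (D ◁ tensMap (Y := fun i => P i ⊗ tens (P' i)) (Equiv.refl I) f)) :
    distrib d (fun p k => Q p.1 p.2 k) ≫ distrib d' (fun i j => P' i j ⊗ tens (Q i j)) =
      (g ⊗ₘ tensMap (X := fun x : Σ p : (Σ i, J i), K p.1 p.2 => Q x.1.1 x.1.2 x.2)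
        (Y := fun x : Σ i, Σ j, K i j => Q x.1 x.2.1 x.2.2)
        (Equiv.sigmaAssoc K) (fun _ => 𝟙 _)) ≫
      distrib (R := fun i => Σ j, K i j) e (fun i x => Q i x.1 x.2) ≫
      (D ◁ tensMap (X := fun i => R i ⊗ tens fun x : Σ j, K i j => Q i x.1 x.2)
        (Y := fun i => P i ⊗ tens fun j => P' i j ⊗ tens (Q i j))
        (Equiv.refl I) fun i => distrib (f i) (Q i)) := by
  -- What remains is `h₂`: on the right, the morphisms `f i` are pulled out of the product over `I`
  -- and moved across `merge`.
  refine distrib_assoc_aux d d' (merge P P') _ _ g e _ _ _ _ _ _ h ?_ (merge_merge P P' Q)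
  refine Eq.trans ?_ ((congr_arg (· ≫ _) (merge_natural_left (R := fun i => Σ j, K i j)
    (P' := fun i => P i ⊗ tens (P' i)) f (fun i x => Q i x.1 x.2)).symm).trans
      (Category.assoc _ _ _))
  refine Eq.trans ?_ (Category.assoc _ _ _).symm
  exact congr_arg (_ ≫ ·) (tensMap_comp_refl
    (X := fun i => R i ⊗ tens fun x : Σ j, K i j => Q i x.1 x.2)
    (Y := fun i => (P i ⊗ tens (P' i)) ⊗ tens fun x : Σ j, K i j => Q i x.1 x.2)
    (Z := fun i => P i ⊗ tens fun j => P' i j ⊗ tens (Q i j)) _ _)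

/-- The left counit law with extra factors `Q`: over a one-point index, `merge` is the
identification of one-element products, by `merge_tensPoint`, so these factors are only reindexed.
-/
theorem distrib_point {R : Type} [Finite R] {A B P : C} (d : A ⟶ B ⊗ tens (fun _ : PUnit => P))
    (ε : B ⟶ 𝟙_ C) (g : A ⟶ P) (Q : R → C) (h : d ≫ (ε ⊗ₘ tensPoint P) ≫ (λ_ P).hom = g) :
    distrib d (fun _ => Q) ≫ (ε ⊗ₘ tensPoint (P ⊗ tens Q)) ≫ (λ_ (P ⊗ tens Q)).hom =
      g ⊗ₘ tensMap (X := fun x : Σ _ : PUnit, R => Q x.2) (Y := Q)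
        (Equiv.uniqueSigma fun _ : PUnit => R) (fun _ => 𝟙 _) := by
  have aux : ∀ {T Q₁ Q₂ M : C} (d : A ⟶ B ⊗ T) (m : T ⊗ Q₁ ⟶ M) (n : M ⟶ P ⊗ Q₂) (t : T ⟶ P)
      (σ : Q₁ ⟶ Q₂), m ≫ n = t ⊗ₘ σ → d ≫ (ε ⊗ₘ t) ≫ (λ_ P).hom = g →
      ((d ⊗ₘ 𝟙 Q₁) ≫ (α_ _ _ _).hom ≫ (B ◁ m)) ≫ (ε ⊗ₘ n) ≫ (λ_ (P ⊗ Q₂)).hom = g ⊗ₘ σ := by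
    rintro T Q₁ Q₂ M d m n t σ hm rfl
    have : (B ◁ m) ≫ (ε ⊗ₘ n) = ε ⊗ₘ (t ⊗ₘ σ) := by
      rw [← hm, ← id_tensorHom, tensorHom_comp_tensorHom, Category.id_comp]
    simp only [Category.assoc, reassoc_of% this]
    simp [MonoidalCategory.tensorHom_def]
  exact aux d _ _ _ _ (merge_tensPoint P Q) h

/-- The right counit law with extra factors `Q`: once `ε` has been moved before `merge`, the latter
only inserts units between the `Q s`, and `merge_unit` applies. -/
theorem distrib_unit {S : Type} [Finite S] {A B P : C} (d : A ⟶ B ⊗ tens (fun _ : S => P))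
    (ε : P ⟶ 𝟙_ C) (g : A ⟶ B) (Q : S → C)
    (h : d ≫ (B ◁ (tensMap (Y := fun _ : S => 𝟙_ C) (Equiv.refl S) (fun _ => ε) ≫ tensUnit S)) ≫
      (ρ_ B).hom = g) :
    distrib (R := fun _ : S => PUnit) d (fun s _ => Q s) ≫
      (B ◁ tensMap (X := fun s => P ⊗ tens fun _ : PUnit => Q s) (Y := Q) (Equiv.refl S)
        (fun s => (ε ⊗ₘ tensPoint (Q s)) ≫ (λ_ (Q s)).hom)) =
      g ⊗ₘ tensMap (X := fun x : Σ _ : S, PUnit => Q x.1) (Y := Q) (Equiv.sigmaPUnit S)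
        (fun _ => 𝟙 _) := by
  have hn := merge_natural_left (R := fun _ : S => PUnit) (P' := fun _ => 𝟙_ C) (fun _ => ε)
    (fun s _ => Q s)
  -- Splits off `ε`, the part to be moved across `merge`, from the removal of the units.
  have hs : tensMap (X := fun s => P ⊗ tens fun _ : PUnit => Q s) (Y := Q) (Equiv.refl S)
        (fun s => (ε ⊗ₘ tensPoint (Q s)) ≫ (λ_ (Q s)).hom) =
      tensMap (X := fun s => P ⊗ tens fun _ : PUnit => Q s)
        (Y := fun s => 𝟙_ C ⊗ tens fun _ : PUnit => Q s) (Equiv.refl S) (fun s => ε ⊗ₘ 𝟙 _) ≫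
      tensMap (X := fun s => 𝟙_ C ⊗ tens fun _ : PUnit => Q s) (Y := Q) (Equiv.refl S)
        (fun s => (𝟙 _ ⊗ₘ tensPoint (Q s)) ≫ (λ_ (Q s)).hom) := by
    have e : ∀ s, (ε ⊗ₘ tensPoint (Q s)) ≫ (λ_ (Q s)).hom =
        (ε ⊗ₘ 𝟙 (tens fun _ : PUnit => Q s)) ≫ (𝟙 _ ⊗ₘ tensPoint (Q s)) ≫ (λ_ (Q s)).hom := by
      intro s
      rw [tensorHom_comp_tensorHom_assoc, Category.id_comp, Category.comp_id]
    refine Eq.trans (congr_arg (tensMap (X := fun s => P ⊗ tens fun _ : PUnit => Q s) (Y := Q)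
      (Equiv.refl S)) (funext e)) (tensMap_comp_refl
      (X := fun s => P ⊗ tens fun _ : PUnit => Q s)
      (Y := fun s => 𝟙_ C ⊗ tens fun _ : PUnit => Q s) (Z := Q) _ _)
  rw [hs]
  have aux : ∀ {T T' Q₁ Q₂ M M' : C} (d : A ⟶ B ⊗ T) (m : T ⊗ Q₁ ⟶ M) (i : M ⟶ M')
      (j : M' ⟶ Q₂) (t : T ⟶ T') (u : T' ⟶ 𝟙_ C) (m' : T' ⊗ Q₁ ⟶ M') (σ : Q₁ ⟶ Q₂),
      m ≫ i = (t ⊗ₘ 𝟙 Q₁) ≫ m' → m' ≫ j = (u ⊗ₘ σ) ≫ (λ_ Q₂).hom →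
      d ≫ (B ◁ (t ≫ u)) ≫ (ρ_ B).hom = g →
      ((d ⊗ₘ 𝟙 Q₁) ≫ (α_ _ _ _).hom ≫ (B ◁ m)) ≫ (B ◁ (i ≫ j)) = g ⊗ₘ σ := by
    rintro T T' Q₁ Q₂ M M' d m i j t u m' σ h₁ h₂ rfl
    have : m ≫ i ≫ j = ((t ≫ u) ⊗ₘ σ) ≫ (λ_ Q₂).hom := by
      rw [reassoc_of% h₁, h₂, tensorHom_comp_tensorHom_assoc, Category.id_comp]
    simp only [Category.assoc, ← MonoidalCategory.whiskerLeft_comp, this]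
    simp [MonoidalCategory.tensorHom_def]
  exact aux d _ _ _ _ _ _ _ hn.symm (merge_unit Q) h

/-- Serves all the identities in which a counit is applied at the root and another operation, here
`φ`, in the only subtree above it. -/
theorem counitPoint_natural {A X Y : C} (ε : A ⟶ 𝟙_ C) (φ : X ⟶ Y) :
    (A ◁ tensMap (X := fun _ : PUnit => X) (Y := fun _ : PUnit => Y) (Equiv.refl PUnit)
      (fun _ => φ)) ≫ (ε ⊗ₘ tensPoint Y) ≫ (λ_ Y).hom =
      ((ε ⊗ₘ tensPoint X) ≫ (λ_ X).hom) ≫ φ := by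
  have h := tensPoint_natural φ
  rw [← id_tensorHom, tensorHom_comp_tensorHom_assoc, Category.id_comp, h]
  simp [MonoidalCategory.tensorHom_def]

end TreeCooperad

/-! ### Cocomposition and counit on wreath products -/

namespace TreeCooperad

open Word

variable {C : Type u} [Category.{v} C] [MonoidalCategory C] [SymmetricCategory C]

section

variable {W : Type*} [Category* W] (O : FinBij ⥤ C) (T : W ⥤ C) {S : FinBij}
  {x y : S.carrier → W}

theorem whiskerLeft_tensMap_comp (A : C) {S : Type} [Finite S] {X Y Z : S → C}
    (φ : ∀ s, X s ⟶ Y s) (ψ : ∀ s, Y s ⟶ Z s) :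
    (A ◁ tensMap (Y := Y) (Equiv.refl S) φ) ≫ (A ◁ tensMap (Y := Z) (Equiv.refl S) ψ) =
      A ◁ tensMap (Y := Z) (Equiv.refl S) (fun s => φ s ≫ ψ s) :=
  (MonoidalCategory.whiskerLeft_comp _ _ _).symm.trans
    (congr_arg (A ◁ ·) (tensMap_comp_refl φ ψ).symm)

/-- The morphism of `Σ_* ≀ W` given by morphisms in `W` over the identity of `S`. -/
def Wreath.homMk (a : ∀ s, x s ⟶ y s) : (⟨S, x⟩ : Wreath W) ⟶ ⟨S, y⟩ := ⟨Equiv.refl _, a⟩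

theorem circ_map_homMk (a : ∀ s, x s ⟶ y s) :
    (circ O T).map (Wreath.homMk a) =
      O.obj S ◁ tensMap (X := fun s => T.obj (x s)) (Y := fun s => T.obj (y s)) (Equiv.refl _)
        (fun s => T.map (a s)) :=
  (congr_arg (fun k => k ⊗ₘ _) (O.map_id S)).trans (id_tensorHom _ _)

/-- The inductive step: squares that commute up to morphisms `a s` in `W` assemble to one that
commutes up to the morphism of `Wreath W` formed by the `a s` over the identity of `S`. -/
theorem circ_square {B B' D : S.carrier → C} (f : ∀ s, T.obj (x s) ⟶ B s) (f' : ∀ s, B s ⟶ D s)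
    (g : ∀ s, T.obj (y s) ⟶ B' s) (g' : ∀ s, B' s ⟶ D s)
    (h : ∀ s, ∃ a : x s ⟶ y s, f s ≫ f' s = T.map a ≫ g s ≫ g' s) :
    ∃ a : (⟨S, x⟩ : Wreath W) ⟶ ⟨S, y⟩,
      (O.obj S ◁ tensMap (Y := B) (Equiv.refl _) f) ≫
        (O.obj S ◁ tensMap (Y := D) (Equiv.refl _) f') =
      (circ O T).map a ≫ (O.obj S ◁ tensMap (Y := B') (Equiv.refl _) g) ≫
        (O.obj S ◁ tensMap (Y := D) (Equiv.refl _) g') := by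
  choose a ha using h
  refine ⟨Wreath.homMk a, ?_⟩
  refine (whiskerLeft_tensMap_comp (O.obj S) f f').trans ((congr_arg (fun k =>
    O.obj S ◁ tensMap (X := fun s => T.obj (x s)) (Y := D) (Equiv.refl _) k) (funext ha)).trans ?_)
  refine (whiskerLeft_tensMap_comp (O.obj S) (X := fun s => T.obj (x s))
    (Y := fun s => T.obj (y s)) (Z := D) (fun s => T.map (a s)) _).symm.trans ?_
  exact congr_arg₂ (· ≫ ·) (circ_map_homMk O T a).symm
    (whiskerLeft_tensMap_comp (O.obj S) g g').symm

theorem circ_triangle {B : S.carrier → C} (f : ∀ s, T.obj (x s) ⟶ B s)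
    (f' : ∀ s, B s ⟶ T.obj (y s)) (h : ∀ s, ∃ a : x s ⟶ y s, f s ≫ f' s = T.map a) :
    ∃ a : (⟨S, x⟩ : Wreath W) ⟶ ⟨S, y⟩,
      (O.obj S ◁ tensMap (Y := B) (Equiv.refl _) f) ≫
        (O.obj S ◁ tensMap (Y := fun s => T.obj (y s)) (Equiv.refl _) f') =
      (circ O T).map a := by
  choose a ha using h
  refine ⟨Wreath.homMk a, ?_⟩
  exact (whiskerLeft_tensMap_comp (O.obj S) f f').trans ((congr_arg (fun k =>
    O.obj S ◁ tensMap (X := fun s => T.obj (x s)) (Y := fun s => T.obj (y s)) (Equiv.refl _) k)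
    (funext ha)).trans (circ_map_homMk O T a).symm)

/-- For naturality squares, where the two composite functors on trees give the same tree and no
correction is needed. -/
theorem circ_square_of_eq {w : Wreath W} {A B D : C} {f : (circ O T).obj w ⟶ A} {f' : A ⟶ D}
    {g : (circ O T).obj w ⟶ B} {g' : B ⟶ D} (h : f ≫ f' = g ≫ g') :
    ∃ a : w ⟶ w, f ≫ f' = (circ O T).map a ≫ g ≫ g' :=
  ⟨𝟙 w, by rw [h, CategoryTheory.Functor.map_id, Category.id_comp]⟩

end

section Functors

variable {W : Type*} [Category* W]

/-- The components of `cocompWreath` are instances of `distrib` by definition. The functor `G`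
allows `θ` to be a face or degeneracy transformation, which changes the tree. -/
theorem cocompWreath_natural {O : FinBij ⥤ C} (Δ : Wreath.total ⋙ O ⟶ circ O O) {W' : Type*}
    [Category* W'] {G : W' ⥤ W} {F : W ⥤ C} {F' : W' ⥤ C} (θ : G ⋙ F ⟶ F')
    (x : Wreath (Wreath W')) :
    (cocompWreath Δ F).app ((Wreath.map (Wreath.map G)).obj x) ≫
        (O.obj x.base ◁ tensMap (X := fun s => (circ O (G ⋙ F)).obj (x.fam s))
          (Y := fun s => (circ O F').obj (x.fam s)) (Equiv.refl _)
          fun s => (circMap O θ).app (x.fam s)) =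
      (circMap O θ).app ((Wreath.flatten W').obj x) ≫ (cocompWreath Δ F').app x :=
  distrib_natural (P := fun s => O.obj (x.fam s).base)
    (Δ.app ⟨x.base, fun s => (x.fam s).base⟩) (fun s r => θ.app ((x.fam s).fam r))

variable [HasTerminal C]

/-- Coassociativity of `cocompWreath`. -/
theorem cocompWreath_coassoc (O : Cooperad C) (F : W ⥤ C) (x : Wreath (Wreath (Wreath W))) :
    ∃ a : (Wreath.flatten W).obj ((Wreath.flatten (Wreath W)).obj x) ⟶
        (Wreath.flatten W).obj ((Wreath.map (Wreath.flatten W)).obj x),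
      (cocompWreath O.cocomp F).app ((Wreath.flatten (Wreath W)).obj x) ≫
          (cocompWreath O.cocomp (circ O.obj F)).app x =
        (circ O.obj F).map a ≫
          (cocompWreath O.cocomp F).app ((Wreath.map (Wreath.flatten W)).obj x) ≫
          (circMap O.obj (cocompWreath O.cocomp F)).app x := by
  -- The two ways of flattening differ by the bracketing of the disjoint union; the families above
  -- are untouched.
  refine ⟨⟨Equiv.sigmaAssoc fun s t => ((x.fam s).fam t).base.carrier, fun _ => 𝟙 _⟩, ?_⟩
  -- The truncation of `x`, on which the coassociativity axiom of `O` is used.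
  let y : Wreath (Wreath FinBij) :=
    ⟨x.base, fun s => ⟨(x.fam s).base, fun t => ((x.fam s).fam t).base⟩⟩
  refine (distrib_assoc
    (J := fun i => (x.fam i).base.carrier) (K := fun i j => ((x.fam i).fam j).base.carrier)
    (P' := fun i j => O.obj.obj ((x.fam i).fam j).base)
    (O.cocomp.app ((Wreath.flatten FinBij).obj y))
    (O.cocomp.app ⟨x.base, fun s => (x.fam s).base⟩)
    (O.obj.map (X := Wreath.total.obj ((Wreath.flatten FinBij).obj y))
      (Y := Wreath.total.obj ((Wreath.map Wreath.total).obj y))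
      (FinBij.homOf (Equiv.sigmaAssoc fun s t => ((y.fam s).fam t).carrier)))
    (O.cocomp.app ((Wreath.map Wreath.total).obj y))
    (fun i => O.cocomp.app (y.fam i))
    (fun i j k => F.obj (((x.fam i).fam j).fam k)) (O.coassoc y)).trans ?_
  refine congr_arg (fun k => (_ ⊗ₘ k) ≫ _) ?_
  exact congr_arg (tensMap _) (funext fun _ => (F.map_id _).symm)

theorem cocompWreath_counit_left (O : Cooperad C) (F : W ⥤ C) (x : Wreath W) :
    ∃ a : (Wreath.flatten W).obj ((Wreath.point (Wreath W)).obj x) ⟶ x,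
      (cocompWreath O.cocomp F).app ((Wreath.point (Wreath W)).obj x) ≫
        (counitPoint O.counit (circ O.obj F)).app x = (circ O.obj F).map a := by
  refine ⟨⟨Equiv.uniqueSigma fun _ : PUnit => x.base.carrier, fun _ => 𝟙 _⟩, ?_⟩
  have h := O.counit_left x.base
  -- The counit axiom with the bijection moved to the other side, the form that `distrib_point`
  -- takes as input.
  have h' : O.cocomp.app ((Wreath.point FinBij).obj x.base) ≫
      (counitPoint O.counit O.obj).app x.base =
      O.obj.map (X := Wreath.total.obj ((Wreath.point FinBij).obj x.base)) (Y := x.base)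
        (FinBij.homOf (Equiv.uniqueSigma fun _ : PUnit => x.base.carrier)) := by
    refine Eq.trans (Eq.trans ?_ (congr_arg (O.obj.map
      (X := Wreath.total.obj ((Wreath.point FinBij).obj x.base)) (Y := x.base)
        (FinBij.homOf (Equiv.uniqueSigma fun _ : PUnit => x.base.carrier)) ≫ ·) h))
      (Category.comp_id _)
    refine ((Category.id_comp _).symm.trans (congr_arg (· ≫ _) ?_)).trans (Category.assoc _ _ _)
    refine ((O.obj.map_id _).symm.trans ?_).trans (O.obj.map_comp _ _)
    refine congr_arg (O.obj.map) ?_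
    exact (Equiv.self_trans_symm (Equiv.uniqueSigma fun _ : PUnit => x.base.carrier)).symm
  refine (distrib_point (R := x.base.carrier) (P := O.obj.obj x.base)
    (O.cocomp.app ((Wreath.point FinBij).obj x.base))
    (counitPt O.counit) _ (fun s => F.obj (x.fam s)) h').trans ?_
  refine congr_arg (fun k => _ ⊗ₘ k) ?_
  exact congr_arg (tensMap _) (funext fun _ => (F.map_id _).symm)

theorem cocompWreath_counit_right (O : Cooperad C) (F : W ⥤ C) (x : Wreath W) :
    ∃ a : (Wreath.flatten W).obj ((Wreath.map (Wreath.point W)).obj x) ⟶ x,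
      (cocompWreath O.cocomp F).app ((Wreath.map (Wreath.point W)).obj x) ≫
        (circMap O.obj (counitPoint O.counit F)).app x = (circ O.obj F).map a := by
  refine ⟨⟨Equiv.sigmaPUnit x.base.carrier, fun _ => 𝟙 _⟩, ?_⟩
  have h := O.counit_right x.base
  -- As for the left counit, the bijection is moved to the other side of the axiom.
  have h' : O.cocomp.app ⟨x.base, fun _ => ⟨PUnit⟩⟩ ≫
      (O.obj.obj x.base ◁ (tensMap (Y := fun _ => 𝟙_ C) (Equiv.refl _)
        (fun _ => counitPt O.counit) ≫ tensUnit x.base.carrier)) ≫ (ρ_ _).hom =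
      O.obj.map (X := Wreath.total.obj ⟨x.base, fun _ => ⟨PUnit⟩⟩) (Y := x.base)
        (FinBij.homOf (Equiv.sigmaPUnit x.base.carrier)) := by
    refine Eq.trans (Eq.trans ?_ (congr_arg (O.obj.map
      (X := Wreath.total.obj ⟨x.base, fun _ => ⟨PUnit⟩⟩) (Y := x.base)
        (FinBij.homOf (Equiv.sigmaPUnit x.base.carrier)) ≫ ·) h))
      (Category.comp_id _)
    refine ((Category.id_comp _).symm.trans (congr_arg (· ≫ _) ?_)).trans (Category.assoc _ _ _)
    refine ((O.obj.map_id _).symm.trans ?_).trans (O.obj.map_comp _ _)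
    refine congr_arg (O.obj.map) ?_
    exact (Equiv.self_trans_symm (Equiv.sigmaPUnit x.base.carrier)).symm
  refine (distrib_unit (S := x.base.carrier) (O.cocomp.app ⟨x.base, fun _ => ⟨PUnit⟩⟩)
    (counitPt O.counit) _ (fun s => F.obj (x.fam s)) h').trans ?_
  refine congr_arg (fun k => _ ⊗ₘ k) ?_
  exact congr_arg (tensMap _) (funext fun _ => (F.map_id _).symm)

end Functors

/-! ### Simplicial identities at each tree -/

namespace Coalgebra

variable [HasTerminal C] {O : Cooperad C} (c : Coalgebra O)

/-- Coassociativity enters where two adjacent operations meet: that of the coalgebra at the top of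
the tree (`n = 0`), that of the cooperad for `i = j = 0` otherwise. For `i = 0 < j` naturality
suffices. -/
theorem faceTrans_faceTrans (n : ℕ) (i j : Fin (n + 1)) (h : i ≤ j) (x : Level (n + 2)) :
    ∃ a : (face n j).obj ((face (n + 1) i.castSucc).obj x) ⟶
        (face n i).obj ((face (n + 1) j.succ).obj x),
      (c.faceTrans n j).app ((face (n + 1) i.castSucc).obj x) ≫
          (c.faceTrans (n + 1) i.castSucc).app x =
        (c.treeFunctor n).map a ≫ (c.faceTrans n i).app ((face (n + 1) j.succ).obj x) ≫
          (c.faceTrans (n + 1) j.succ).app x := by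
  induction n with
  | zero =>
    obtain rfl : i = 0 := Subsingleton.elim (α := Fin 1) _ _
    obtain rfl : j = 0 := Subsingleton.elim (α := Fin 1) _ _
    exact ⟨𝟙 empty, (c.coassoc x).trans (Category.id_comp _).symm⟩
  | succ n ih =>
    rcases i with ⟨_ | i, hi⟩ <;> rcases j with ⟨_ | j, hj⟩
    · exact cocompWreath_coassoc O (c.treeFunctor n) x
    · refine circ_square_of_eq O.obj (c.treeFunctor n) ?_
      exact (cocompWreath_natural O.cocomp (c.faceTrans n ⟨j, by omega⟩) x).symm
    · simp at h
    · exact circ_square O.obj (c.treeFunctor n) _ _ _ _ fun s =>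
        ih ⟨i, by omega⟩ ⟨j, by omega⟩ (by simpa using h) (x.fam s)

/-- No axiom is needed: for `i = 0`, the counit at the root commutes with any operation above it. -/
theorem degenTrans_degenTrans (n : ℕ) (i j : Fin (n + 1)) (h : i ≤ j) (x : Level n) :
    ∃ a : (degen (n + 1) j.succ).obj ((degen n i).obj x) ⟶
        (degen (n + 1) i.castSucc).obj ((degen n j).obj x),
      (c.degenTrans (n + 1) j.succ).app ((degen n i).obj x) ≫ (c.degenTrans n i).app x =
        (c.treeFunctor (n + 2)).map a ≫
          (c.degenTrans (n + 1) i.castSucc).app ((degen n j).obj x) ≫ (c.degenTrans n j).app x := by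
  induction n with
  | zero =>
    obtain rfl : i = 0 := Subsingleton.elim (α := Fin 1) _ _
    obtain rfl : j = 0 := Subsingleton.elim (α := Fin 1) _ _
    exact circ_square_of_eq O.obj (c.treeFunctor 1)
      (counitPoint_natural (counitPt O.counit) ((c.degenTrans 0 0).app x))
  | succ n ih =>
    rcases i with ⟨_ | i, hi⟩ <;> rcases j with ⟨_ | j, hj⟩
    · exact circ_square_of_eq O.obj (c.treeFunctor (n + 2))
        (counitPoint_natural (counitPt O.counit) ((c.degenTrans (n + 1) ⟨0, hj⟩).app x))
    · exact circ_square_of_eq O.obj (c.treeFunctor (n + 2))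
        (counitPoint_natural (counitPt O.counit) ((c.degenTrans (n + 1) ⟨j + 1, hj⟩).app x))
    · simp at h
    · exact circ_square O.obj (c.treeFunctor (n + 2)) _ _ _ _ fun s =>
        ih ⟨i, by omega⟩ ⟨j, by omega⟩ (by simpa using h) (x.fam s)

/-- The induction ends in the left counit law of the cooperad or, when the coface applies the
comultiplication to `c`, in the counit law of the coalgebra. -/
theorem faceTrans_degenTrans_self (n : ℕ) (i : Fin (n + 1)) (x : Level n) :
    ∃ a : (face n i).obj ((degen n i).obj x) ⟶ x,
      (c.faceTrans n i).app ((degen n i).obj x) ≫ (c.degenTrans n i).app x =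
        (c.treeFunctor n).map a := by
  induction n with
  | zero =>
    obtain rfl : i = 0 := Subsingleton.elim (α := Fin 1) _ _
    have := x.2
    -- The face functor lands in the chosen empty set, whereas `x` may be another one.
    -- `c.treeFunctor 0` is constant, so this bijection acts as the identity.
    exact ⟨ObjectProperty.homMk (FinBij.homOf (Equiv.equivOfIsEmpty PEmpty x.1.carrier)),
      c.counit x⟩
  | succ n ih =>
    rcases i with ⟨_ | i, hi⟩
    · exact cocompWreath_counit_left O (c.treeFunctor n) x
    · exact circ_triangle O.obj (c.treeFunctor n) _ _ fun s => ih ⟨i, by omega⟩ (x.fam s)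

/-- Here the coface always splits a factor `O`, never `c`, so the right counit law of the cooperad
is the only input. -/
theorem faceTrans_degenTrans_succ (n : ℕ) (i : Fin (n + 1)) (x : Level (n + 1)) :
    ∃ a : (face (n + 1) i.castSucc).obj ((degen (n + 1) i.succ).obj x) ⟶ x,
      (c.faceTrans (n + 1) i.castSucc).app ((degen (n + 1) i.succ).obj x) ≫
        (c.degenTrans (n + 1) i.succ).app x = (c.treeFunctor (n + 1)).map a := by
  induction n with
  | zero =>
    obtain rfl : i = 0 := Subsingleton.elim (α := Fin 1) _ _
    exact cocompWreath_counit_right O (c.treeFunctor 0) x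
  | succ n ih =>
    rcases i with ⟨_ | i, hi⟩
    · exact cocompWreath_counit_right O (c.treeFunctor (n + 1)) x
    · exact circ_triangle O.obj (c.treeFunctor (n + 1)) _ _ fun s => ih ⟨i, by omega⟩ (x.fam s)

/-- The counit is applied strictly above both of the factors produced by the cocomposition, so the
induction ends in naturality of the cocomposition. -/
theorem faceTrans_degenTrans_of_le (n : ℕ) (i : Fin (n + 2)) (j : Fin (n + 1))
    (h : i ≤ j.castSucc) (x : Level (n + 2)) :
    ∃ a : (face (n + 2) i.castSucc).obj ((degen (n + 2) j.succ.succ).obj x) ⟶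
        (degen (n + 1) j.succ).obj ((face (n + 1) i).obj x),
      (c.faceTrans (n + 2) i.castSucc).app ((degen (n + 2) j.succ.succ).obj x) ≫
          (c.degenTrans (n + 2) j.succ.succ).app x =
        (c.treeFunctor (n + 2)).map a ≫
          (c.degenTrans (n + 1) j.succ).app ((face (n + 1) i).obj x) ≫
            (c.faceTrans (n + 1) i).app x := by
  induction n with
  | zero =>
    obtain rfl : j = 0 := Subsingleton.elim (α := Fin 1) _ _
    obtain rfl : i = 0 := by simpa using h
    exact circ_square_of_eq O.obj (c.treeFunctor 1)
      (cocompWreath_natural O.cocomp (c.degenTrans 0 0) x)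
  | succ n ih =>
    rcases i with ⟨_ | i, hi⟩
    · exact circ_square_of_eq O.obj (c.treeFunctor (n + 2))
        (cocompWreath_natural O.cocomp (c.degenTrans (n + 1) j) x)
    · rcases j with ⟨_ | j, hj⟩
      · simp at h
      · exact circ_square O.obj (c.treeFunctor (n + 2)) _ _ _ _ fun s =>
          ih ⟨i, by omega⟩ ⟨j, by omega⟩ (by simpa using h) (x.fam s)

/-- The counit is applied strictly below the coface, so the induction ends in naturality of the
counit. The case `j = 0` is what makes the leftover codegeneracy an extra one. -/
theorem faceTrans_degenTrans_of_ge (n : ℕ) (i j : Fin (n + 1)) (h : j ≤ i) (x : Level (n + 1)) :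
    ∃ a : (face (n + 1) i.succ).obj ((degen (n + 1) j.castSucc).obj x) ⟶
        (degen n j).obj ((face n i).obj x),
      (c.faceTrans (n + 1) i.succ).app ((degen (n + 1) j.castSucc).obj x) ≫
          (c.degenTrans (n + 1) j.castSucc).app x =
        (c.treeFunctor (n + 1)).map a ≫ (c.degenTrans n j).app ((face n i).obj x) ≫
            (c.faceTrans n i).app x := by
  induction n with
  | zero =>
    obtain rfl : i = 0 := Subsingleton.elim (α := Fin 1) _ _
    obtain rfl : j = 0 := Subsingleton.elim (α := Fin 1) _ _
    exact circ_square_of_eq O.obj (c.treeFunctor 0)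
      (counitPoint_natural (counitPt O.counit) ((c.faceTrans 0 0).app x))
  | succ n ih =>
    rcases j with ⟨_ | j, hj⟩
    · exact circ_square_of_eq O.obj (c.treeFunctor (n + 1))
        (counitPoint_natural (counitPt O.counit) ((c.faceTrans (n + 1) i).app x))
    · rcases i with ⟨_ | i, hi⟩
      · simp at h
      · exact circ_square O.obj (c.treeFunctor (n + 1)) _ _ _ _ fun s =>
          ih ⟨i, by omega⟩ ⟨j, by omega⟩ (by simpa using h) (x.fam s)

end Coalgebra

end TreeCooperad

/-! ### Passage to the right Kan extensions -/

namespace TreeCooperad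

instance sigma0_subsingleton_hom (E E' : Sigma0) : Subsingleton (E ⟶ E') where
  allEq f g := by
    have := E.2
    exact ObjectProperty.hom_ext _ (Equiv.ext fun s => (E.2.false s).elim)

/-- The morphism from the empty set to another empty set. -/
def ofEmpty (E : Sigma0) : empty ⟶ E :=
  have := E.2
  ObjectProperty.homMk (FinBij.homOf (Equiv.equivOfIsEmpty PEmpty E.1.carrier))

variable {C : Type u} [Category.{v} C] [MonoidalCategory C] [SymmetricCategory C] [HasLimits C]

namespace Coalgebra

variable {O : Cooperad C} (c : Coalgebra O)

/-- The projection of `O^{∘̂ n} ∘̂ c` to the value of `O^{⊚ n} ⊚ c` at a tree. -/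
noncomputable def termProj (n : ℕ) (x : Level n) : c.term n ⟶ (c.treeFunctor n).obj x :=
  (c.proj n).app x

/-- Naturality of the universal transformation, whose source is constant on `Level n` because `gam
n` is. This makes the choice of `a` in the tree identities irrelevant. -/
theorem termProj_map (n : ℕ) {x y : Level n} (a : x ⟶ y) :
    c.termProj n x ≫ (c.treeFunctor n).map a = c.termProj n y := by
  refine ((c.proj n).naturality a).symm.trans ?_
  have h : (gam n ⋙ c.kan n).map a = 𝟙 _ := (c.kan n).map_id empty
  rw [h]
  exact Category.id_comp _

/-- Between two empty sets there is exactly one morphism, so a morphism to the value at `empty`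
extends to a transformation from a constant functor on `Sigma0`. Uniqueness in the universal
property then applies. -/
theorem term_hom_ext {n : ℕ} {A : C} {f g : A ⟶ c.term n}
    (h : ∀ x, f ≫ c.termProj n x = g ≫ c.termProj n x) : f = g := by
  let F : (A ⟶ c.term n) → ((Functor.const Sigma0).obj A ⟶ c.kan n) := fun f =>
    { app := fun E => f ≫ (c.kan n).map (ofEmpty E)
      naturality := fun E E' a => by
        have : ofEmpty E' = ofEmpty E ≫ a := Subsingleton.elim _ _
        rw [this, CategoryTheory.Functor.map_comp]
        exact (Category.id_comp _).trans (Category.assoc _ _ _).symm }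
  have h₀ : ∀ f : A ⟶ c.term n, (F f).app empty = f := by
    intro f
    have : ofEmpty empty = 𝟙 empty := Subsingleton.elim _ _
    exact (congr_arg (f ≫ ·) ((congr_arg (c.kan n).map this).trans
      ((c.kan n).map_id empty))).trans (Category.comp_id f)
  have key : F f = F g := by
    refine (c.kan n).hom_ext_of_isRightKanExtension (c.proj n) _ _ ?_
    ext x
    have h' : ∀ f, (Functor.whiskerLeft (gam n) (F f) ≫ c.proj n).app x = f ≫ c.termProj n x :=
      fun f => congr_arg (· ≫ c.termProj n x) (h₀ f)
    rw [h', h', h]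
  rw [← h₀ f, ← h₀ g, key]

theorem coface_termProj (n : ℕ) (i : Fin (n + 1)) (x : Level (n + 1)) :
    c.coface n i ≫ c.termProj (n + 1) x =
      c.termProj n ((face n i).obj x) ≫ (c.faceTrans n i).app x :=
  (c.kan (n + 1)).liftOfIsRightKanExtension_fac_app (c.proj (n + 1)) (c.kan n)
    (Functor.whiskerLeft (face n i) (c.proj n) ≫ c.faceTrans n i) x

theorem codegen_termProj (n : ℕ) (i : Fin (n + 1)) (x : Level n) :
    c.codegen n i ≫ c.termProj n x =
      c.termProj (n + 1) ((degen n i).obj x) ≫ (c.degenTrans n i).app x :=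
  (c.kan n).liftOfIsRightKanExtension_fac_app (c.proj n) (c.kan (n + 1))
    (Functor.whiskerLeft (degen n i) (c.proj (n + 1)) ≫ c.degenTrans n i) x

theorem coaug_termProj (x : Level 1) : c.coaug ≫ c.termProj 1 x = c.comul.app x :=
  (c.kan 1).liftOfIsRightKanExtension_fac_app (c.proj 1) ((Functor.const Sigma0).obj c.obj)
    c.comul x

theorem coface_termProj_assoc {n : ℕ} (i : Fin (n + 1)) (x : Level (n + 1)) {A : C}
    (f : (c.treeFunctor (n + 1)).obj x ⟶ A) :
    c.coface n i ≫ c.termProj (n + 1) x ≫ f =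
      c.termProj n ((face n i).obj x) ≫ (c.faceTrans n i).app x ≫ f := by
  rw [← Category.assoc, coface_termProj, Category.assoc]

theorem codegen_termProj_assoc {n : ℕ} (i : Fin (n + 1)) (x : Level n) {A : C}
    (f : (c.treeFunctor n).obj x ⟶ A) :
    c.codegen n i ≫ c.termProj n x ≫ f =
      c.termProj (n + 1) ((degen n i).obj x) ≫ (c.degenTrans n i).app x ≫ f := by
  rw [← Category.assoc, codegen_termProj, Category.assoc]

/-- Turns an identity up to a morphism of trees into a strict one. -/
theorem termProj_eq {n : ℕ} {A : C} {x y : Level n} {f : (c.treeFunctor n).obj x ⟶ A}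
    {g : (c.treeFunctor n).obj y ⟶ A} (h : ∃ a : x ⟶ y, f = (c.treeFunctor n).map a ≫ g) :
    c.termProj n x ≫ f = c.termProj n y ≫ g := by
  obtain ⟨a, rfl⟩ := h
  rw [← Category.assoc, termProj_map]

theorem coface_coface (n : ℕ) (i j : Fin (n + 1)) (h : i ≤ j) :
    c.coface n i ≫ c.coface (n + 1) j.succ = c.coface n j ≫ c.coface (n + 1) i.castSucc := by
  refine c.term_hom_ext fun x => ?_
  rw [Category.assoc, Category.assoc, coface_termProj, coface_termProj, coface_termProj_assoc,
    coface_termProj_assoc]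
  exact (c.termProj_eq (c.faceTrans_faceTrans n i j h x)).symm

theorem codegen_codegen (n : ℕ) (i j : Fin (n + 1)) (h : i ≤ j) :
    c.codegen (n + 1) j.succ ≫ c.codegen n i = c.codegen (n + 1) i.castSucc ≫ c.codegen n j := by
  refine c.term_hom_ext fun x => ?_
  rw [Category.assoc, Category.assoc, codegen_termProj, codegen_termProj, codegen_termProj_assoc,
    codegen_termProj_assoc]
  exact c.termProj_eq (c.degenTrans_degenTrans n i j h x)

theorem coface_codegen_self (n : ℕ) (i : Fin (n + 1)) :
    c.coface n i ≫ c.codegen n i = 𝟙 _ := by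
  refine c.term_hom_ext fun x => ?_
  rw [Category.assoc, codegen_termProj, coface_termProj_assoc, Category.id_comp]
  obtain ⟨a, h⟩ := c.faceTrans_degenTrans_self n i x
  exact (congr_arg (_ ≫ ·) h).trans (c.termProj_map n a)

theorem coface_codegen_succ (n : ℕ) (i : Fin (n + 1)) :
    c.coface (n + 1) i.castSucc ≫ c.codegen (n + 1) i.succ = 𝟙 _ := by
  refine c.term_hom_ext fun x => ?_
  rw [Category.assoc, codegen_termProj, coface_termProj_assoc, Category.id_comp]
  obtain ⟨a, h⟩ := c.faceTrans_degenTrans_succ n i x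
  exact (congr_arg (_ ≫ ·) h).trans (c.termProj_map (n + 1) a)

theorem coface_codegen_of_le (n : ℕ) (i : Fin (n + 2)) (j : Fin (n + 1)) (h : i ≤ j.castSucc) :
    c.coface (n + 2) i.castSucc ≫ c.codegen (n + 2) j.succ.succ =
      c.codegen (n + 1) j.succ ≫ c.coface (n + 1) i := by
  refine c.term_hom_ext fun x => ?_
  rw [Category.assoc, Category.assoc, codegen_termProj, coface_termProj, coface_termProj_assoc,
    codegen_termProj_assoc]
  exact c.termProj_eq (c.faceTrans_degenTrans_of_le n i j h x)

theorem coface_codegen_of_ge (n : ℕ) (i j : Fin (n + 1)) (h : j ≤ i) :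
    c.coface (n + 1) i.succ ≫ c.codegen (n + 1) j.castSucc = c.codegen n j ≫ c.coface n i := by
  refine c.term_hom_ext fun x => ?_
  rw [Category.assoc, Category.assoc, codegen_termProj, coface_termProj, coface_termProj_assoc,
    codegen_termProj_assoc]
  exact c.termProj_eq (c.faceTrans_degenTrans_of_ge n i j h x)

/-- The projection `O^{∘̂ 0} ∘̂ c ⟶ c`. -/
noncomputable def termZero : c.term 0 ⟶ c.obj := c.termProj 0 empty

/-- With `codegen_termZero`, this relates `c.obj` to `c.term 0`, so that the general identities for
cofaces and codegeneracies also yield those for the coaugmentation and its retraction. Invertibility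
of `termZero` is not needed. -/
theorem termZero_coaug : c.termZero ≫ c.coaug = c.coface 0 0 := by
  refine c.term_hom_ext fun x => ?_
  rw [Category.assoc, coaug_termProj, coface_termProj]
  rfl

theorem codegen_termZero : c.codegen 0 0 ≫ c.termZero = c.coaugRetract :=
  c.codegen_termProj 0 0 empty

theorem coaug_coaugRetract : c.coaug ≫ c.coaugRetract = 𝟙 c.obj :=
  (Category.assoc _ _ _).symm.trans ((congr_arg (· ≫ _)
    (c.coaug_termProj ((Wreath.point Sigma0).obj empty))).trans (c.counit empty))

theorem coaug_coface : c.coaug ≫ c.coface 1 0 = c.coaug ≫ c.coface 1 1 := by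
  -- The counit law makes the coaugmentation factor through `c.coface 0 0`, which equalizes the next
  -- two cofaces.
  have h : c.coaug = (c.coaug ≫ c.codegen 0 0) ≫ c.coface 0 0 := by
    rw [← termZero_coaug, Category.assoc, ← Category.assoc (c.codegen 0 0), codegen_termZero,
      ← Category.assoc, coaug_coaugRetract, Category.id_comp]
  have h' := c.coface_coface 0 0 0 le_rfl
  rw [h]
  simp only [Category.assoc]
  exact congr_arg (fun k => c.coaug ≫ c.codegen 0 0 ≫ k) h'.symm

theorem coface_codegen_one : c.coface 1 1 ≫ c.codegen 1 0 = c.coaugRetract ≫ c.coaug := by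
  rw [← codegen_termZero, Category.assoc, termZero_coaug]
  exact c.coface_codegen_of_ge 0 0 0 le_rfl

theorem codegen_coaugRetract : c.codegen 1 1 ≫ c.coaugRetract = c.codegen 1 0 ≫ c.coaugRetract := by
  rw [← codegen_termZero, ← Category.assoc, ← Category.assoc]
  exact congr_arg (· ≫ _) (c.codegen_codegen 0 0 0 le_rfl)

end Coalgebra

end TreeCooperad

/-! ### The presented simplex category is equivalent to the simplex category -/

namespace SimplexCategoryGenRel

theorem eq_eqToHom_or_of_P_δ {n : ℕ} {x : SimplexCategoryGenRel} {f : x ⟶ mk (n + 1)} (hf : P_δ f) :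
    (∃ h : x = mk (n + 1), f = eqToHom h) ∨
      ∃ (i : Fin (n + 2)) (g : x ⟶ mk n), P_δ g ∧ f = g ≫ δ i := by
  cases hf with
  | of _ h => cases h; exact .inr ⟨_, 𝟙 _, P_δ.id_mem _, (Category.id_comp _).symm⟩
  | id => exact .inl ⟨rfl, rfl⟩
  | comp_of f g hf hg => cases hg; exact .inr ⟨_, f, hf, rfl⟩

theorem toSimplexCategory_map_comp_δ {n : ℕ} {x : SimplexCategoryGenRel} (g : x ⟶ mk n)
    (j : Fin (n + 2)) (k : Fin (x.len + 1)) :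
    (toSimplexCategory.map (g ≫ δ j)).toOrderHom k =
      j.succAbove ((toSimplexCategory.map g).toOrderHom k) := by
  rw [Functor.map_comp]
  rfl

/-- A composite of faces whose image misses `i` factors through `δ i`. -/
theorem exists_eq_comp_δ_of_P_δ {n : ℕ} {x : SimplexCategoryGenRel} {f : x ⟶ mk (n + 1)}
    (hf : P_δ f) (i : Fin (n + 2))
    (hi : ∀ k, (toSimplexCategory.map f).toOrderHom k ≠ i) :
    ∃ g : x ⟶ mk n, P_δ g ∧ f = g ≫ δ i := by
  induction n with
  | zero =>
    obtain ⟨rfl, rfl⟩ | ⟨j, g, hg, rfl⟩ := eq_eqToHom_or_of_P_δ hf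
    · exact absurd rfl (hi i)
    · refine ⟨g, hg, ?_⟩
      by_contra hij
      have hij : i ≠ j := fun h => hij (by rw [h])
      -- The target has two elements. If `i ≠ j`, the element missed by `δ j` is `j`, so the image
      -- would be exactly `i`.
      obtain ⟨k, hk⟩ := Fin.exists_succAbove_eq hij
      have h0 : (toSimplexCategory.map g).toOrderHom 0 = k := Subsingleton.elim (α := Fin 1) _ _
      refine hi 0 (Eq.trans ?_ hk)
      rw [← h0]
      exact toSimplexCategory_map_comp_δ g j 0
  | succ n ih =>
    obtain ⟨rfl, rfl⟩ | ⟨j, g, hg, rfl⟩ := eq_eqToHom_or_of_P_δ hf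
    · exact absurd rfl (hi i)
    · obtain hij | rfl | hij := lt_trichotomy i j
      -- As `i` is hit by `δ j`, its preimage is missed by `g`. The induction hypothesis splits a
      -- face off `g`, and the exchange relation moves it to the end.
      · obtain ⟨i, rfl⟩ := Fin.eq_castSucc_of_ne_last (Fin.ne_last_of_lt hij)
        obtain ⟨j, rfl⟩ := Fin.eq_succ_of_ne_zero (Fin.ne_zero_of_lt hij)
        have hij' : i ≤ j := Fin.castSucc_lt_succ_iff.1 hij
        obtain ⟨g', hg', rfl⟩ := ih hg i fun k hk => hi k <| by
          refine Eq.trans ?_ (Fin.succAbove_of_castSucc_lt j.succ i hij)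
          rw [← hk]
          exact toSimplexCategory_map_comp_δ g _ k
        exact ⟨g' ≫ δ j, P_δ.comp_mem _ _ hg' (P_δ.δ j), by
          rw [Category.assoc, Category.assoc, δ_comp_δ hij']⟩
      · exact ⟨g, hg, rfl⟩
      · obtain ⟨j, rfl⟩ := Fin.eq_castSucc_of_ne_last (Fin.ne_last_of_lt hij)
        obtain ⟨i, rfl⟩ := Fin.eq_succ_of_ne_zero (Fin.ne_zero_of_lt hij)
        have hij' : j ≤ i := Fin.castSucc_lt_succ_iff.1 hij
        obtain ⟨g', hg', rfl⟩ := ih hg i fun k hk => hi k <| by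
          refine Eq.trans ?_ (Fin.succAbove_of_le_castSucc j.castSucc i hij')
          rw [← hk]
          exact toSimplexCategory_map_comp_δ g _ k
        exact ⟨g' ≫ δ j, P_δ.comp_mem _ _ hg' (P_δ.δ j), by
          rw [Category.assoc, Category.assoc, ← δ_comp_δ hij']⟩

/-- If `f` ends with `δ i`, its image misses `i`. So does that of `f'`, which can then be rewritten
to end with `δ i` too; this face is monic and cancels. -/
theorem eq_of_map_eq_of_P_δ {n : ℕ} {x : SimplexCategoryGenRel} {f f' : x ⟶ mk n} (hf : P_δ f)
    (hf' : P_δ f') (h : toSimplexCategory.map f = toSimplexCategory.map f') : f = f' := by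
  induction n with
  | zero =>
    obtain ⟨rfl, rfl⟩ | h₁ := eq_or_len_le_of_P_δ hf
    · obtain ⟨_, rfl⟩ | h₁ := eq_or_len_le_of_P_δ hf'
      · rfl
      · simp at h₁
    · simp at h₁
  | succ n ih =>
    obtain ⟨rfl, rfl⟩ | ⟨i, g, hg, rfl⟩ := eq_eqToHom_or_of_P_δ hf
    · obtain ⟨_, rfl⟩ | h₁ := eq_or_len_le_of_P_δ hf'
      · rfl
      · simp at h₁
    · obtain ⟨g', hg', rfl⟩ := exists_eq_comp_δ_of_P_δ hf' i fun k hk => by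
        rw [← h] at hk
        exact Fin.succAbove_ne i _ ((toSimplexCategory_map_comp_δ g i k).symm.trans hk)
      rw [ih hg hg']
      rw [Functor.map_comp, Functor.map_comp] at h
      have : Mono (toSimplexCategory.map (δ i)) :=
        inferInstanceAs (Mono (SimplexCategory.δ i))
      exact (cancel_mono _).1 h

/-- Both have normal forms given by strictly increasing lists, and the list can be read off the
monotone map. -/
theorem eq_of_map_eq_of_P_σ {x y : SimplexCategoryGenRel} {f f' : x ⟶ y} (hf : P_σ f)
    (hf' : P_σ f') (h : toSimplexCategory.map f = toSimplexCategory.map f') : f = f' := by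
  obtain ⟨L, m, b, rfl, rfl, rfl, hL, rfl⟩ := exists_normal_form_P_σ f hf
  obtain ⟨L', m', b', h₁, h₂, rfl, hL', rfl⟩ := exists_normal_form_P_σ f' hf'
  obtain rfl : m' = m := congr_arg len h₁
  have h₃ : m' + L.length = m' + L'.length := congr_arg len h₂
  have hlen : L.length = L'.length := by omega
  have key : ∀ j < m' + L.length + 1, simplicialEvalσ L j = simplicialEvalσ L' j := by
    intro j hj
    rw [← simplicialEvalσ_of_isAdmissible L _ _ hL rfl j hj,
      ← simplicialEvalσ_of_isAdmissible L' _ _ hL' (by omega) j hj]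
    exact congr_arg (fun k : SimplexCategory.mk (m' + L.length) ⟶ SimplexCategory.mk m' =>
      (k.toOrderHom ⟨j, hj⟩ : ℕ)) h
  -- The members of an admissible list are the places `j` where the map takes the same value at `j`
  -- and `j + 1`.
  have hmem : ∀ j, j ∈ L ↔ j ∈ L' := by
    intro j
    rw [mem_isAdmissible_iff L hL, mem_isAdmissible_iff L' hL', hlen]
    refine and_congr_right fun hj => ?_
    rw [key j (by omega), key (j + 1) (by omega)]
  obtain rfl : L = L' := by
    refine List.Perm.eq_of_pairwise ?_ hL.sortedLT.pairwise hL'.sortedLT.pairwise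
      ((List.perm_ext_iff_of_nodup hL.sortedLT.nodup hL'.sortedLT.nodup).2 hmem)
    intro a b _ _ h h'
    omega
  rfl

/-- Uniqueness of the epi-mono factorization. Sections of the degeneracy parts compare the two
middle objects by monomorphisms in both directions, so these objects are equal and the comparison is
the identity; the two parts are then treated separately. -/
instance : toSimplexCategory.Faithful where
  map_injective {x y} f f' h := by
    obtain ⟨z, e, m, he, hm, rfl⟩ := exists_P_σ_P_δ_factorization f
    obtain ⟨z', e', m', he', hm', rfl⟩ := exists_P_σ_P_δ_factorization f'
    have := isSplitEpi_toSimplexCategory_map_of_P_σ he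
    have := isSplitEpi_toSimplexCategory_map_of_P_σ he'
    have := isSplitMono_toSimplexCategory_map_of_P_δ hm
    have := isSplitMono_toSimplexCategory_map_of_P_δ hm'
    rw [Functor.map_comp, Functor.map_comp] at h
    have h₁ : (section_ (toSimplexCategory.map e) ≫ toSimplexCategory.map e') ≫
        toSimplexCategory.map m' = toSimplexCategory.map m := by
      rw [Category.assoc, ← h, IsSplitEpi.id_assoc]
    have h₂ : (section_ (toSimplexCategory.map e') ≫ toSimplexCategory.map e) ≫
        toSimplexCategory.map m = toSimplexCategory.map m' := by
      rw [Category.assoc, h, IsSplitEpi.id_assoc]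
    have i₁ : Mono (section_ (toSimplexCategory.map e) ≫ toSimplexCategory.map e') := by
      have : Mono ((section_ (toSimplexCategory.map e) ≫ toSimplexCategory.map e') ≫
        toSimplexCategory.map m') := by rw [h₁]; infer_instance
      exact mono_of_mono _ (toSimplexCategory.map m')
    have i₂ : Mono (section_ (toSimplexCategory.map e') ≫ toSimplexCategory.map e) := by
      have : Mono ((section_ (toSimplexCategory.map e') ≫ toSimplexCategory.map e) ≫
        toSimplexCategory.map m) := by rw [h₂]; infer_instance
      exact mono_of_mono _ (toSimplexCategory.map m)
    obtain rfl : z = z' := SimplexCategoryGenRel.ext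
      (le_antisymm (@SimplexCategory.len_le_of_mono _ _ _ i₁)
        (@SimplexCategory.len_le_of_mono _ _ _ i₂))
    rw [@SimplexCategory.eq_id_of_mono _ _ i₁, Category.id_comp] at h₁
    rw [h₁, cancel_mono] at h
    rw [eq_of_map_eq_of_P_σ he he' h]
    cases y
    rw [eq_of_map_eq_of_P_δ hm hm' h₁.symm]

/-- The morphisms that lift contain identities, faces and degeneracies and are closed under
composition, so they are all morphisms. -/
instance : toSimplexCategory.Full where
  map_surjective {x y} f := by
    let W : MorphismProperty SimplexCategory := fun a b f =>
      ∃ g : mk a.len ⟶ mk b.len, toSimplexCategory.map g = f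
    have : W.IsMultiplicative :=
      { id_mem := fun a => ⟨𝟙 _, toSimplexCategory.map_id _⟩
        comp_mem := by
          rintro a b d f g ⟨f, rfl⟩ ⟨g, rfl⟩
          exact ⟨f ≫ g, toSimplexCategory.map_comp _ _⟩ }
    have hW := SimplexCategory.morphismProperty_eq_top W (fun i => ⟨δ i, rfl⟩) (fun i => ⟨σ i, rfl⟩)
    have hf : W f := by rw [hW]; trivial
    exact hf

instance : toSimplexCategory.EssSurj where
  mem_essImage a := ⟨mk a.len, ⟨Iso.refl _⟩⟩

instance : toSimplexCategory.IsEquivalence where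

end SimplexCategoryGenRel

/-! ### The coaugmented cosimplicial object -/

namespace TreeCooperad

variable {C : Type u} [Category.{v} C] [MonoidalCategory C] [SymmetricCategory C] [HasLimits C]

namespace Coalgebra

variable {O : Cooperad C} (c : Coalgebra O)

/-- The cofaces and codegeneracies between the objects `O^{∘̂ (n + 1)} ∘̂ c`. -/
noncomputable def cosimplicialQuiver : FreeSimplexQuiver ⥤q C where
  obj n := c.term (FreeSimplexQuiver.len n + 1)
  map f := match f with
    | @FreeSimplexQuiver.Hom.δ n i => c.coface (n + 1) i
    -- The successor skips the codegeneracy of index 0, which is kept as the extra one.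
    | @FreeSimplexQuiver.Hom.σ n i => c.codegen (n + 1) i.succ

theorem lift_cosimplicialQuiver {x y z : FreeSimplexQuiver} (f : x ⟶ y) (g : y ⟶ z) :
    (Paths.lift c.cosimplicialQuiver).map
        ((Paths.of FreeSimplexQuiver).map f ≫ (Paths.of FreeSimplexQuiver).map g) =
      c.cosimplicialQuiver.map f ≫ c.cosimplicialQuiver.map g := by
  refine (Functor.map_comp _ _ _).trans (congr_arg₂ (· ≫ ·) ?_ ?_) <;> exact Category.id_comp _

/-- The cosimplicial object `n ↦ O^{∘̂ (n + 1)} ∘̂ c`, as a functor on the category presented by the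
generators and relations of the simplex category. -/
noncomputable def cosimplicialGen : SimplexCategoryGenRel ⥤ C :=
  CategoryTheory.Quotient.lift _ (Paths.lift c.cosimplicialQuiver) fun _ _ _ _ h => by
    cases h with
    | @δ_comp_δ n i j H =>
      rw [lift_cosimplicialQuiver, lift_cosimplicialQuiver]
      exact c.coface_coface (n + 1) i j H
    | @δ_comp_σ_of_le n i j H =>
      rw [lift_cosimplicialQuiver, lift_cosimplicialQuiver]
      exact c.coface_codegen_of_le n i j H
    | @δ_comp_σ_self n i =>
      rw [lift_cosimplicialQuiver]
      exact c.coface_codegen_succ n i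
    | @δ_comp_σ_succ n i =>
      rw [lift_cosimplicialQuiver]
      exact c.coface_codegen_self (n + 1) i.succ
    | @δ_comp_σ_of_gt n i j H =>
      rw [lift_cosimplicialQuiver, lift_cosimplicialQuiver]
      exact c.coface_codegen_of_ge (n + 1) i j.succ (Fin.castSucc_lt_iff_succ_le.1 H)
    | @σ_comp_σ n i j H =>
      rw [lift_cosimplicialQuiver, lift_cosimplicialQuiver]
      exact (c.codegen_codegen (n + 1) i.succ j.succ (Fin.succ_le_succ_iff.2 H)).symm

theorem cosimplicialGen_map_δ {n : ℕ} (i : Fin (n + 2)) :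
    c.cosimplicialGen.map (SimplexCategoryGenRel.δ i) = c.coface (n + 1) i :=
  Category.id_comp _

theorem cosimplicialGen_map_σ {n : ℕ} (i : Fin (n + 1)) :
    c.cosimplicialGen.map (SimplexCategoryGenRel.σ i) = c.codegen (n + 1) i.succ :=
  Category.id_comp _

/-- The map `c ⟶ O^{∘̂ (n + 1)} ∘̂ c` that is the composite of the coaugmentation with cofaces. -/
noncomputable def augTerm : ∀ n : ℕ, c.obj ⟶ c.term (n + 1)
  | 0 => c.coaug
  | n + 1 => augTerm n ≫ c.coface (n + 1) 0

/-- Any string of cofaces after the coaugmentation gives the same map: the coface relation reduces a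
positive index by one level, down to `coaug_coface`. -/
theorem augTerm_coface (n : ℕ) (i : Fin (n + 2)) :
    c.augTerm n ≫ c.coface (n + 1) i = c.augTerm (n + 1) := by
  induction n with
  | zero =>
    induction i using Fin.cases with
    | zero => rfl
    | succ i =>
      obtain rfl : i = 0 := Subsingleton.elim (α := Fin 1) _ _
      exact c.coaug_coface.symm
  | succ n ih =>
    induction i using Fin.cases with
    | zero => rfl
    | succ i =>
      rw [augTerm, Category.assoc, c.coface_coface (n + 1) 0 i (Fin.zero_le _), ← Category.assoc,
        ih]
      rfl

/-- The last coface in `augTerm` may be chosen freely, hence to be one that the codegeneracy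
cancels. -/
theorem augTerm_codegen (n : ℕ) (i : Fin (n + 1)) :
    c.augTerm (n + 1) ≫ c.codegen (n + 1) i.succ = c.augTerm n := by
  rw [← c.augTerm_coface n i.succ, Category.assoc, coface_codegen_self, Category.comp_id]

theorem augTerm_map {x y : SimplexCategoryGenRel} (f : x ⟶ y) :
    c.augTerm x.len ≫ c.cosimplicialGen.map f = c.augTerm y.len :=
  SimplexCategoryGenRel.hom_induction
    (P := fun x y f => c.augTerm x.len ≫ c.cosimplicialGen.map f = c.augTerm y.len)
    ((congr_arg (_ ≫ ·) (c.cosimplicialGen.map_id _)).trans (Category.comp_id _))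
    (fun {_ m} u i hu =>
      (congr_arg (_ ≫ ·) (c.cosimplicialGen.map_comp u _)).trans <|
        (Category.assoc _ _ _).symm.trans <| (congr_arg (· ≫ _) hu).trans <|
          (congr_arg (_ ≫ ·) (c.cosimplicialGen_map_δ i)).trans (c.augTerm_coface m i))
    (fun {_ m} u i hu =>
      (congr_arg (_ ≫ ·) (c.cosimplicialGen.map_comp u _)).trans <|
        (Category.assoc _ _ _).symm.trans <| (congr_arg (· ≫ _) hu).trans <|
          (congr_arg (_ ≫ ·) (c.cosimplicialGen_map_σ i)).trans (c.augTerm_codegen m i))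
    f

/-- The coaugmentation of `cosimplicialGen`. -/
noncomputable def cosimplicialGenAug :
    (Functor.const SimplexCategoryGenRel).obj c.obj ⟶ c.cosimplicialGen where
  app x := c.augTerm x.len
  naturality _ _ f := (Category.id_comp _).trans (c.augTerm_map f).symm

/-- The coaugmented cosimplicial object `c ⟶ (O^{∘̂ (n + 1)} ∘̂ c)_n`. -/
noncomputable def cosimplicial : CosimplicialObject.Augmented C where
  left := c.obj
  right := SimplexCategoryGenRel.toSimplexCategory.inv ⋙ c.cosimplicialGen
  hom := Functor.whiskerLeft SimplexCategoryGenRel.toSimplexCategory.inv c.cosimplicialGenAug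

/-- The terms of the coaugmented cosimplicial object. -/
noncomputable def cosimplicialObjIso (n : ℕ) :
    c.cosimplicial.right.obj (SimplexCategory.mk n) ≅ c.term (n + 1) :=
  c.cosimplicialGen.mapIso
    (SimplexCategoryGenRel.toSimplexCategory.asEquivalence.unitIso.app
      (SimplexCategoryGenRel.mk n)).symm

/-- The inverse of the equivalence with the presented category recovers generators only up to the
unit isomorphism; naturality of the latter gives the comparison of structure maps. -/
theorem cosimplicial_map {n m : ℕ}
    (f : SimplexCategoryGenRel.mk n ⟶ SimplexCategoryGenRel.mk m) :
    c.cosimplicial.right.map (SimplexCategoryGenRel.toSimplexCategory.map f) ≫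
        (c.cosimplicialObjIso m).hom =
      (c.cosimplicialObjIso n).hom ≫ c.cosimplicialGen.map f :=
  (c.cosimplicialGen.map_comp _ _).symm.trans ((congr_arg c.cosimplicialGen.map
    (SimplexCategoryGenRel.toSimplexCategory.asEquivalence.unitIso.inv.naturality f)).trans
      (c.cosimplicialGen.map_comp _ _))

theorem cosimplicial_hom :
    c.cosimplicial.hom.app (SimplexCategory.mk 0) ≫ (c.cosimplicialObjIso 0).hom = c.coaug :=
  (c.cosimplicialGenAug.naturality _).symm.trans (Category.id_comp _)

end Coalgebra

end TreeCooperad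

theorem theoremL {C : Type u} [Category.{v} C] [MonoidalCategory C] [SymmetricCategory C]
    [HasLimits C] (O : TreeCooperad.Cooperad C) (c : TreeCooperad.Coalgebra O) :
    -- the coaugmented cosimplicial object, its terms, cofaces and codegeneracies
    (∃ (X : CosimplicialObject.Augmented C) (e₀ : X.left ≅ c.obj)
        (e : ∀ n : ℕ, X.right.obj (SimplexCategory.mk n) ≅ c.term (n + 1)),
      X.hom.app (SimplexCategory.mk 0) ≫ (e 0).hom = e₀.hom ≫ c.coaug ∧
      (∀ (n : ℕ) (i : Fin (n + 2)),
        X.right.δ i ≫ (e (n + 1)).hom = (e n).hom ≫ c.coface (n + 1) i) ∧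
      (∀ (n : ℕ) (j : Fin (n + 1)),
        X.right.σ j ≫ (e n).hom = (e (n + 1)).hom ≫ c.codegen (n + 1) j.succ)) ∧
    -- the extra codegeneracy
    c.coaug ≫ c.coaugRetract = 𝟙 c.obj ∧
    (∀ n : ℕ, c.coface (n + 1) 0 ≫ c.codegen (n + 1) 0 = 𝟙 (c.term (n + 1))) ∧
    c.coface 1 1 ≫ c.codegen 1 0 = c.coaugRetract ≫ c.coaug ∧
    (∀ (n : ℕ) (i : Fin (n + 2)),
      c.coface (n + 2) i.succ ≫ c.codegen (n + 2) 0 =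
        c.codegen (n + 1) 0 ≫ c.coface (n + 1) i) ∧
    c.codegen 1 1 ≫ c.coaugRetract = c.codegen 1 0 ≫ c.coaugRetract ∧
    (∀ (n : ℕ) (j : Fin (n + 1)),
      c.codegen (n + 2) j.succ.succ ≫ c.codegen (n + 1) 0 =
        c.codegen (n + 2) 0 ≫ c.codegen (n + 1) j.succ) := by
  -- In positive degrees the extra codegeneracy identities are those cases of the general ones in
  -- which one codegeneracy has index 0.
  refine ⟨⟨c.cosimplicial, Iso.refl _, c.cosimplicialObjIso, ?_, fun n i => ?_, fun n j => ?_⟩,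
    c.coaug_coaugRetract, fun n => c.coface_codegen_self (n + 1) 0, c.coface_codegen_one,
    fun n i => c.coface_codegen_of_ge (n + 1) i 0 (Fin.zero_le _), c.codegen_coaugRetract,
    fun n j => c.codegen_codegen (n + 1) 0 j.succ (Fin.zero_le _)⟩
  · exact c.cosimplicial_hom.trans (Category.id_comp _).symm
  · rw [← c.cosimplicialGen_map_δ i]
    exact c.cosimplicial_map (SimplexCategoryGenRel.δ i)
  · rw [← c.cosimplicialGen_map_σ j]
    exact c.cosimplicial_map (SimplexCategoryGenRel.σ j)
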